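/- **Theorem 2.2.** Let $d\ge 1$ and $n\ge 4$ be integers, let $\rho>0$, and let $U_1,\dots,U_n$ be independent random vectors, each uniformly distributed over the cube $C_n=[0,n^{1/d})^d$. Let $D$ denote the Euclidean toroidal metric on $C_n$, put $B_\rho(x)=\{y\in C_n : D(x,y)\le\rho\}$ and $\mathcal U_n=\{U_1,\dots,U_n\}$, and let $$S=\sum_{i=1}^n \mathbf 1\{\mathcal U_n\cap B_\rho(U_i)=\{U_i\}\}$$ be the number of isolated points. Write $\mu_S=\mathbb E[S]$ and $\sigma_S=\sqrt{\operatorname{Var}(S)}$. Let $\phi=\pi_d\rho^d$, where $\pi_d$ is the volume of the unit ball in $\mathbb R^d$. Let $\kappa_d$ be the maximum number of pairwise disjoint closed unit balls in $\mathbb R^d$ all of which intersect the closed unit ball centred at the origin, and put $\kappa_d^+=1+\kappa_d$. If $$n>\max(3^d,\,2^{d+1}+1)\,\phi,$$ then $\sigma_S>0$ and $$D_S:=\sup_{t\in\mathbb R}\left|P\left[\frac{S-\mu_S}{\sigma_S}\le t\right]-P[Z\le t]\right|\le\frac{n-\mu_S}{5\sigma_S^2}\left(\sqrt{\frac{11(\kappa_d^+)^2}{\sigma_S}+\frac{5\sqrt{\eta_S(n,\rho)}}{\sqrt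 n}}+\frac{2\kappa_d^+}{\sqrt{\sigma_S}}\right)^2,$$ where $Z$ is a standard normal random variable and $$\eta_S(n,\rho)=2(1+2\kappa_d)^2\left(1+(2^d+1)3^d\phi+\left(\frac{2n-3^d\phi}{n-3^d\phi}\right)9^d\phi^2\right)$$ $$\qquad{}+\frac{(\kappa_d^+)^2}{2}\left((2^d+2\cdot3^d+3)\phi+(2^{d+1}+1)\left(\frac{2n-(2^{d+1}+1)\phi}{n-(2^{d+1}+1)\phi}\right)\phi^2+\frac{4n-2}{n-1}\right).$$ -/

import Mathlib

open MeasureTheory ProbabilityTheory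

noncomputable section

namespace IsolatedPoints

/-- `Packs F`: the closed unit balls of `ℝ^d` with centres in `F` all intersect the closed unit ball
at the origin and are pairwise disjoint. -/
def Packs {d : ℕ} (F : Finset (EuclideanSpace ℝ (Fin d))) : Prop :=
  (∀ c ∈ F, (Metric.closedBall c 1 ∩ Metric.closedBall 0 1).Nonempty) ∧
    ∀ c ∈ F, ∀ c' ∈ F, c ≠ c' → Disjoint (Metric.closedBall c 1) (Metric.closedBall c' 1)

/-- `κ_d`: the maximum number of pairwise disjoint closed unit balls in `ℝ^d` all of which intersect
the closed unit ball at the origin. -/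
def kappa (d : ℕ) : ℕ :=
  sSup {m : ℕ | ∃ F : Finset (EuclideanSpace ℝ (Fin d)), Packs F ∧ F.card = m}

/-- The supremum defining `κ_d` is a maximum. -/
theorem isGreatest_kappa (d : ℕ) :
    IsGreatest {m : ℕ | ∃ F : Finset (EuclideanSpace ℝ (Fin d)), Packs F ∧ F.card = m}
      (kappa d) := by
  have hbdd : BddAbove {m : ℕ | ∃ F : Finset (EuclideanSpace ℝ (Fin d)), Packs F ∧ F.card = m} := by
    obtain ⟨t, -, htf, ht⟩ := Metric.finite_approx_of_totallyBounded
      (isCompact_closedBall (0 : EuclideanSpace ℝ (Fin d)) 2).totallyBounded 1 one_pos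
    refine ⟨htf.toFinset.card, ?_⟩
    rintro m ⟨F, ⟨hF1, hF2⟩, rfl⟩
    have hmem : ∀ c ∈ F, ∃ y ∈ t, dist c y < 1 := by
      intro c hc
      have h2 : c ∈ Metric.closedBall (0 : EuclideanSpace ℝ (Fin d)) 2 := by
        obtain ⟨z, hz1, hz2⟩ := hF1 c hc
        rw [Metric.mem_closedBall] at *
        have := dist_triangle c z 0
        rw [dist_comm c z] at this
        linarith
      have := ht h2
      simpa using this
    choose! f hf1 hf2 using hmem
    refine Finset.card_le_card_of_injOn f (fun c hc => by simpa using hf1 c hc) ?_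
    intro c hc c' hc' h
    by_contra hne
    have h1 : f c ∈ Metric.closedBall c 1 := by
      rw [Metric.mem_closedBall, dist_comm]
      exact (hf2 c hc).le
    have h2 : f c ∈ Metric.closedBall c' 1 := by
      rw [Metric.mem_closedBall, dist_comm, h]
      exact (hf2 c' hc').le
    exact Set.disjoint_left.mp (hF2 c hc c' hc' hne) h1 h2
  exact ⟨Nat.sSup_mem ⟨0, ∅, by simp [Packs], rfl⟩ hbdd, fun m hm => le_csSup hbdd hm⟩

/-- `φ = π_d ρ^d`, where `π_d` is the volume of the unit ball of `ℝ^d`. -/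
def phi (d : ℕ) (ρ : ℝ) : ℝ :=
  volume.real (Metric.ball (0 : EuclideanSpace ℝ (Fin d)) 1) * ρ ^ d

/-- The side length `n^{1/d}` of the cube of volume `n`. -/
def side (n d : ℕ) : ℝ := (n : ℝ) ^ (1 / (d : ℝ))

/-- The cube `C_n = [0, n^{1/d})^d`. -/
def cube (n d : ℕ) : Set (EuclideanSpace ℝ (Fin d)) :=
  {x | ∀ i, x i ∈ Set.Ico 0 (side n d)}

/-- The Euclidean toroidal metric on `C_n`: the norm on the circle `ℝ / Lℤ` is the distance
to the nearest multiple of `L`, where `L = n^{1/d}`. -/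
def torusDist (n d : ℕ) (x y : EuclideanSpace ℝ (Fin d)) : ℝ :=
  √(∑ i, ‖((x i - y i : ℝ) : AddCircle (side n d))‖ ^ 2)

/-- The ball `B_r(x) = {y ∈ C_n : D(x,y) ≤ r}`. -/
def torusBall (n d : ℕ) (r : ℝ) (x : EuclideanSpace ℝ (Fin d)) :
    Set (EuclideanSpace ℝ (Fin d)) :=
  {y ∈ cube n d | torusDist n d x y ≤ r}

open Classical in
/-- The number of isolated points of the configuration `u_1, …, u_n`: the number of indices `i` with
`{u_1, …, u_n} ∩ B_ρ(u_i) = {u_i}`. -/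
def numIsolated (n d : ℕ) (ρ : ℝ) (u : Fin n → EuclideanSpace ℝ (Fin d)) : ℝ :=
  ∑ i, if Set.range u ∩ torusBall n d ρ (u i) = {u i} then 1 else 0

/-- The Kolmogorov distance `D_X` between the law of `(X - E X) / SD(X)` and the standard normal
law. -/
def kolmogorovDist {Ω : Type*} [MeasurableSpace Ω] (P : Measure Ω) (X : Ω → ℝ) : ℝ :=
  ⨆ t : ℝ, |P.real {ω | (X ω - ∫ ω', X ω' ∂P) / √(variance X P) ≤ t} -
    (gaussianReal 0 1).real (Set.Iic t)|

/-- The constant `η_S(n,ρ)` in dimension `d`. -/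
def etaS (n d : ℕ) (ρ : ℝ) : ℝ :=
  2 * (1 + 2 * (kappa d : ℝ)) ^ 2 *
      (1 + (2 ^ d + 1) * 3 ^ d * phi d ρ +
        (2 * n - 3 ^ d * phi d ρ) / (n - 3 ^ d * phi d ρ) * 9 ^ d * phi d ρ ^ 2) +
    ((kappa d : ℝ) + 1) ^ 2 / 2 *
      ((2 ^ d + 2 * 3 ^ d + 3) * phi d ρ +
        (2 ^ (d + 1) + 1) *
          ((2 * n - (2 ^ (d + 1) + 1) * phi d ρ) / (n - (2 ^ (d + 1) + 1) * phi d ρ)) *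
            phi d ρ ^ 2 +
        (4 * n - 2) / (n - 1))

end IsolatedPoints

end

/-! The argument is Stein's method applied to a size-biasing move on the number `n - S` of
non-isolated points. Choose distinct indices `i`, `j` and, with a probability `α k` depending on the
number `k` of neighbours of `U_i`, move `U_j` to a uniform point of the ball around `U_i`. With `m =
n - 1` and `p` the probability that a given point falls in a given ball, the `α k` are chosen
(`exists_resampling_probabilities`) so that the count of neighbours of `U_i`, binomial with
parameters `m` and `p`, becomes the same binomial conditioned to be positive. By exchangeability the
move then realises the size-biased law of `n - S`. `ProximityModel.integral_totalEffect` states this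
as an identity for every continuous test function; after centring it expresses `E[W f(W)]`, where `W
= (S - μ)/σ`, as a constant times the mean of `f(W') - f(W)`.

Two facts make the identity useful. First, the move is bounded: a packing argument shows that
deleting or inserting a point changes `S` by at most `κ_d` or `1` according to sign, so `|S' - S| ≤
κ_d + 1`. Second, the conditional mean `g` of the change given the configuration has small variance.
This follows from the Efron–Stein inequality (`efron_stein`), comparing the total effect with the
one computed after deletion of the point `k`: only points within `3ρ` of `U_k` matter, and for the
remaining ones a pivotality count controls the difference (`ProximityModel.abs_totalEffect_sub_le`).

To reach the Kolmogorov distance `D`, half-line indicators are replaced by ramps of width `l`. The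
bounded Stein solution satisfies `|f| ≤ 13/10` and `|f'| ≤ 1`, but `f'` varies with the ramp. That
variation is averaged over the law of `W`, and the mass of an interval is bounded by its normal mass
plus `2D`. The outcome is a self-referential inequality `D ≤ A + E D / l + l / 5`, and choosing `l`
well gives the square of a sum of square roots (`le_of_forall_smoothing`,
`SteinCoupling.kolmogorov_le`).

The probabilistic part uses only an abstract adjacency relation with constant ball probability. The
torus enters through translation invariance, a volume comparison and the packing number. -/

open MeasureTheory ProbabilityTheory

namespace IsolatedPoints

/-! ### Stein's equation for the standard normal law -/

section SteinEquation

/-- The unnormalised standard Gaussian density. -/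
noncomputable def gaussWeight (t : ℝ) : ℝ := Real.exp (-(1 / 2) * t ^ 2)

lemma gaussWeight_pos (t : ℝ) : 0 < gaussWeight t := Real.exp_pos _

lemma gaussWeight_neg (t : ℝ) : gaussWeight (-t) = gaussWeight t := by simp [gaussWeight]

lemma continuous_gaussWeight : Continuous gaussWeight := by unfold gaussWeight; fun_prop

lemma integrable_gaussWeight : Integrable gaussWeight :=
  integrable_exp_neg_mul_sq (by norm_num : (0 : ℝ) < 1 / 2)

lemma integral_gaussWeight : ∫ t, gaussWeight t = √(2 * Real.pi) := by
  unfold gaussWeight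
  rw [integral_gaussian]; congr 1; field_simp

lemma integral_Ioi_zero_gaussWeight : ∫ t in Set.Ioi 0, gaussWeight t = √(2 * Real.pi) / 2 := by
  unfold gaussWeight
  rw [integral_gaussian_Ioi]; congr 2; field_simp

lemma hasDerivAt_gaussWeight (t : ℝ) : HasDerivAt gaussWeight (-(t * gaussWeight t)) t := by
  unfold gaussWeight
  have h : HasDerivAt (fun t : ℝ => -(1 / 2) * t ^ 2) (-(1 / 2) * (2 * t)) t := by
    simpa using (hasDerivAt_pow 2 t).const_mul (-(1 / 2) : ℝ)
  convert h.exp using 1; ring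

lemma integrable_mul_gaussWeight : Integrable fun t => t * gaussWeight t :=
  integrable_mul_exp_neg_mul_sq (by norm_num : (0 : ℝ) < 1 / 2)

lemma tendsto_gaussWeight_atTop : Filter.Tendsto gaussWeight Filter.atTop (nhds 0) := by
  have h : Filter.Tendsto (fun t : ℝ => 1 / 2 * t ^ 2) Filter.atTop Filter.atTop :=
    (Filter.tendsto_pow_atTop two_ne_zero).const_mul_atTop (by norm_num)
  have := Real.tendsto_exp_neg_atTop_nhds_zero.comp h
  refine this.congr fun t => ?_
  simp [gaussWeight]

lemma integral_Ioi_mul_gaussWeight (w : ℝ) :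
    ∫ t in Set.Ioi w, t * gaussWeight t = gaussWeight w := by
  have h := integral_Ioi_of_hasDerivAt_of_tendsto' (a := w) (f := fun t => -gaussWeight t)
    (f' := fun t => t * gaussWeight t) (m := 0)
    (fun t _ => (hasDerivAt_gaussWeight t).neg.congr_deriv (by ring))
    integrable_mul_gaussWeight.integrableOn (by simpa using tendsto_gaussWeight_atTop.neg)
  simpa using h

/-- Mills' inequality. -/
lemma mul_integral_Ioi_gaussWeight_le (w : ℝ) :
    w * ∫ t in Set.Ioi w, gaussWeight t ≤ gaussWeight w := by
  rw [← integral_Ioi_mul_gaussWeight, ← integral_const_mul]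
  refine setIntegral_mono_on (integrable_gaussWeight.const_mul w).integrableOn
    integrable_mul_gaussWeight.integrableOn measurableSet_Ioi fun t ht => ?_
  exact mul_le_mul_of_nonneg_right (le_of_lt ht) (gaussWeight_pos t).le

/-- For `t ≥ w ≥ 0` one has `t² ≥ w² + (t - w)²`, so the tail is at most `gaussWeight w` times half
the total mass. The constant is an upper bound for `√(2π)/2`. -/
lemma integral_Ioi_gaussWeight_le {w : ℝ} (hw : 0 ≤ w) :
    ∫ t in Set.Ioi w, gaussWeight t ≤ 13 / 10 * gaussWeight w := by
  have h1 : ∫ t in Set.Ioi w, gaussWeight t ≤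
      ∫ t in Set.Ioi w, gaussWeight w * gaussWeight (t - w) := by
    refine setIntegral_mono_on integrable_gaussWeight.integrableOn
      ((integrable_gaussWeight.comp_sub_right w).const_mul _).integrableOn measurableSet_Ioi
      fun t ht => ?_
    unfold gaussWeight
    rw [← Real.exp_add]
    refine Real.exp_le_exp.mpr ?_
    have : w ≤ t := le_of_lt ht
    nlinarith
  have h2 : ∫ t in Set.Ioi w, gaussWeight (t - w) = ∫ t in Set.Ioi 0, gaussWeight t := by
    rw [← integral_indicator measurableSet_Ioi, ← integral_indicator measurableSet_Ioi,
      ← integral_add_right_eq_self _ w]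
    congr 1; ext t
    simp [Set.indicator]
  rw [integral_const_mul, h2, integral_Ioi_zero_gaussWeight] at h1
  have h3 : √(2 * Real.pi) ≤ 2.6 := by
    rw [Real.sqrt_le_left (by norm_num)]
    nlinarith [Real.pi_lt_d2]
  nlinarith [gaussWeight_pos w]

lemma integral_Iic_gaussWeight (w : ℝ) :
    ∫ t in Set.Iic w, gaussWeight t = ∫ t in Set.Ioi (-w), gaussWeight t := by
  rw [← integral_comp_neg_Iic]
  simp_rw [gaussWeight_neg]

variable {h : ℝ → ℝ} {c : ℝ}

/-- The bounded solution of Stein's equation `f' w - w f w = h w - c`. -/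
noncomputable def steinSol (h : ℝ → ℝ) (c w : ℝ) : ℝ :=
  (gaussWeight w)⁻¹ * ∫ t in Set.Iic w, (h t - c) * gaussWeight t

/-- A continuous function with values in `[0,1]` and Gaussian mean `c`. -/
structure IsTest (h : ℝ → ℝ) (c : ℝ) : Prop where
  cont : Continuous h
  nonneg : ∀ t, 0 ≤ h t
  le_one : ∀ t, h t ≤ 1
  nonneg_c : 0 ≤ c
  c_le_one : c ≤ 1
  mean : ∫ t, (h t - c) * gaussWeight t = 0

lemma IsTest.integrable (H : IsTest h c) : Integrable fun t => (h t - c) * gaussWeight t := by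
  refine integrable_gaussWeight.bdd_mul (c := 1) (by have := H.cont; fun_prop) (ae_of_all _ fun t => ?_)
  rw [Real.norm_eq_abs, abs_le]
  constructor <;> linarith [H.nonneg t, H.le_one t, H.nonneg_c, H.c_le_one]

lemma IsTest.compl (H : IsTest h c) : IsTest (fun t => 1 - h t) (1 - c) where
  cont := by have := H.cont; fun_prop
  nonneg t := by linarith [H.le_one t]
  le_one t := by linarith [H.nonneg t]
  nonneg_c := by linarith [H.c_le_one]
  c_le_one := by linarith [H.nonneg_c]
  mean := by
    have : ∀ t, (1 - h t - (1 - c)) * gaussWeight t = -((h t - c) * gaussWeight t) := fun t => by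
      ring
    simp_rw [this, integral_neg, H.mean, neg_zero]

lemma steinSol_compl (h : ℝ → ℝ) (c w : ℝ) :
    steinSol (fun t => 1 - h t) (1 - c) w = -steinSol h c w := by
  have : ∀ t, (1 - h t - (1 - c)) * gaussWeight t = -((h t - c) * gaussWeight t) := fun t => by
    ring
  simp only [steinSol, this, integral_neg, mul_neg]

lemma IsTest.steinSol_eq_Ioi (H : IsTest h c) (w : ℝ) :
    steinSol h c w = -((gaussWeight w)⁻¹ * ∫ t in Set.Ioi w, (h t - c) * gaussWeight t) := by
  have := integral_add_compl (measurableSet_Iic (a := w)) H.integrable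
  rw [H.mean, Set.compl_Iic] at this
  rw [steinSol, ← mul_neg]
  congr 1; linarith

lemma IsTest.steinSol_hasDerivAt (H : IsTest h c) (w : ℝ) :
    HasDerivAt (steinSol h c) (w * steinSol h c w + (h w - c)) w := by
  have hG : Continuous fun t => (h t - c) * gaussWeight t := by
    have := H.cont; have := continuous_gaussWeight; fun_prop
  have h1 : (fun x => ∫ t in Set.Iic x, (h t - c) * gaussWeight t) =
      fun x => (∫ t in (0 : ℝ)..x, (h t - c) * gaussWeight t) +
        ∫ t in Set.Iic 0, (h t - c) * gaussWeight t := by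
    ext x
    rw [← intervalIntegral.integral_Iic_sub_Iic H.integrable.integrableOn H.integrable.integrableOn]
    ring
  have h2 : HasDerivAt (fun x => ∫ t in Set.Iic x, (h t - c) * gaussWeight t)
      ((h w - c) * gaussWeight w) w := by
    rw [h1]
    exact (intervalIntegral.integral_hasDerivAt_right H.integrable.intervalIntegrable
      (hG.stronglyMeasurableAtFilter _ _) hG.continuousAt).add_const _
  have h3 := ((hasDerivAt_gaussWeight w).inv (gaussWeight_pos w).ne').mul h2
  refine h3.congr_deriv ?_
  have := (gaussWeight_pos w).ne'
  simp only [steinSol, Pi.inv_apply]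
  field_simp

lemma IsTest.integral_mono_weight (H : IsTest h c) {s : Set ℝ} :
    |∫ t in s, (h t - c) * gaussWeight t| ≤ ∫ t in s, gaussWeight t := by
  rw [← Real.norm_eq_abs]
  refine (norm_integral_le_integral_norm _).trans ?_
  refine integral_mono H.integrable.norm.integrableOn integrable_gaussWeight.integrableOn fun t => ?_
  simp only [norm_mul, Real.norm_eq_abs, abs_of_pos (gaussWeight_pos t)]
  refine mul_le_of_le_one_left (gaussWeight_pos t).le ?_
  rw [abs_le]
  constructor <;> linarith [H.nonneg t, H.le_one t, H.nonneg_c, H.c_le_one]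

lemma IsTest.abs_steinSol_le (H : IsTest h c) (w : ℝ) : |steinSol h c w| ≤ 13 / 10 := by
  have hp := gaussWeight_pos w
  rcases le_total 0 w with hw | hw
  · rw [H.steinSol_eq_Ioi, abs_neg, abs_mul, abs_of_pos (inv_pos.mpr hp), inv_mul_le_iff₀ hp]
    linarith [H.integral_mono_weight (s := Set.Ioi w), integral_Ioi_gaussWeight_le hw]
  · rw [steinSol, abs_mul, abs_of_pos (inv_pos.mpr hp), inv_mul_le_iff₀ hp]
    have h1 := H.integral_mono_weight (s := Set.Iic w)
    rw [integral_Iic_gaussWeight] at h1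
    have h2 := integral_Ioi_gaussWeight_le (w := -w) (by linarith)
    rw [gaussWeight_neg] at h2
    linarith

lemma IsTest.neg_const_mul_le (H : IsTest h c) (s : Set ℝ) :
    -(c * ∫ t in s, gaussWeight t) ≤ ∫ t in s, (h t - c) * gaussWeight t := by
  rw [← integral_const_mul, ← integral_neg]
  refine integral_mono (integrable_gaussWeight.const_mul c).neg.integrableOn
    H.integrable.integrableOn fun t => ?_
  simp only
  nlinarith [mul_nonneg (H.nonneg t) (gaussWeight_pos t).le]

/-- Bounding `h - c` below by `-c` reduces this to Mills' inequality. The integral is taken over the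
tail on the side of `w` away from the origin, which the zero mean permits. -/
lemma IsTest.mul_steinSol_le (H : IsTest h c) (w : ℝ) : w * steinSol h c w ≤ c := by
  have hp := gaussWeight_pos w
  have hc := H.nonneg_c
  rcases le_total 0 w with hw | hw
  · rw [H.steinSol_eq_Ioi]
    have h1 := H.neg_const_mul_le (Set.Ioi w)
    have h2 := mul_le_mul_of_nonneg_left (mul_integral_Ioi_gaussWeight_le w) hc
    have h3 := mul_le_mul_of_nonneg_left h1 hw
    have : w * -((gaussWeight w)⁻¹ * ∫ t in Set.Ioi w, (h t - c) * gaussWeight t) =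
      (gaussWeight w)⁻¹ * (-(w * ∫ t in Set.Ioi w, (h t - c) * gaussWeight t)) := by ring
    rw [this, inv_mul_le_iff₀ hp]
    linarith
  · rw [steinSol]
    have h1 := H.neg_const_mul_le (Set.Iic w)
    have h2 := mul_le_mul_of_nonneg_left (mul_integral_Ioi_gaussWeight_le (-w)) hc
    rw [integral_Iic_gaussWeight] at h1
    rw [gaussWeight_neg] at h2
    have h3 := mul_le_mul_of_nonneg_left h1 (neg_nonneg.mpr hw)
    have : w * ((gaussWeight w)⁻¹ * ∫ t in Set.Iic w, (h t - c) * gaussWeight t) =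
      (gaussWeight w)⁻¹ * (-(-w * ∫ t in Set.Iic w, (h t - c) * gaussWeight t)) := by ring
    rw [this, inv_mul_le_iff₀ hp]
    linarith

/-- The bound on `w f(w)` for `h` and for `1 - h` gives `c - 1 ≤ w f(w) ≤ c`; adding `h w - c`
leaves a number between `h w - 1` and `h w`. -/
lemma IsTest.abs_deriv_le (H : IsTest h c) (w : ℝ) :
    |w * steinSol h c w + (h w - c)| ≤ 1 := by
  have h1 := H.mul_steinSol_le w
  have h2 := H.compl.mul_steinSol_le w
  rw [steinSol_compl] at h2
  rw [abs_le]
  constructor <;> linarith [H.nonneg w, H.le_one w]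

lemma IsTest.abs_steinSol_sub_le (H : IsTest h c) (x y : ℝ) :
    |steinSol h c y - steinSol h c x| ≤ |y - x| := by
  have := Convex.norm_image_sub_le_of_norm_hasDerivWithin_le (f := steinSol h c) (C := 1)
    (s := Set.univ) (fun x _ => (H.steinSol_hasDerivAt x).hasDerivWithinAt)
    (fun x _ => H.abs_deriv_le x) convex_univ (Set.mem_univ x) (Set.mem_univ y)
  simpa using this

lemma IsTest.continuous_steinSol (H : IsTest h c) : Continuous (steinSol h c) :=
  continuous_iff_continuousAt.mpr fun x => (H.steinSol_hasDerivAt x).continuousAt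

/-- The derivative of the Stein solution. -/
noncomputable def steinDeriv (h : ℝ → ℝ) (c w : ℝ) : ℝ := w * steinSol h c w + (h w - c)

lemma IsTest.continuous_steinDeriv (H : IsTest h c) : Continuous (steinDeriv h c) := by
  have := H.continuous_steinSol; have := H.cont
  unfold steinDeriv; fun_prop

/-- The increment of `w f(w)` is split so that the factor `|w|` meets the Lipschitz bound of `f` and
not its size. The increment of `h` is kept as it is, to be averaged over the law of `W` later. -/
lemma IsTest.abs_steinDeriv_sub_le (H : IsTest h c) (w s : ℝ) :
    |steinDeriv h c s - steinDeriv h c w| ≤ |s - w| * (13 / 10 + |w|) + |h s - h w| := by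
  have h1 : steinDeriv h c s - steinDeriv h c w =
      (s - w) * steinSol h c s + w * (steinSol h c s - steinSol h c w) + (h s - h w) := by
    unfold steinDeriv; ring
  rw [h1]
  refine (abs_add_le _ _).trans (add_le_add_left ((abs_add_le _ _).trans ?_) _)
  rw [abs_mul, abs_mul]
  have h2 := mul_le_mul_of_nonneg_left (H.abs_steinSol_le s) (abs_nonneg (s - w))
  have h3 := mul_le_mul_of_nonneg_left (H.abs_steinSol_sub_le w s) (abs_nonneg w)
  linarith

/-- Second-order remainder of the Stein solution of a non-increasing test function. -/
lemma IsTest.taylor_remainder_le (H : IsTest h c) (hanti : Antitone h) {δ w w' : ℝ}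
    (hw : |w' - w| ≤ δ) :
    |steinSol h c w' - steinSol h c w - (w' - w) * steinDeriv h c w| ≤
      δ ^ 2 / 2 * (13 / 10 + |w|) + ∫ t in (0 : ℝ)..δ, (h (w - t) - h (w + t)) := by
  have hδ : 0 ≤ δ := (abs_nonneg _).trans hw
  have hcont := H.cont
  have hD := H.continuous_steinDeriv
  -- The sign `ε` treats upward and downward moves together. Monotonicity of `h` bounds both `h (w -
  -- t) - h w` and `h w - h (w + t)` by the same nonnegative integrand, so the integral may be
  -- extended from `r` to `δ`.
  have hint : ∀ ε : ℝ, (ε = 1 ∨ ε = -1) → ∀ r, 0 ≤ r → r ≤ δ →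
      |steinSol h c (w + ε * r) - steinSol h c w - ε * r * steinDeriv h c w| ≤
      δ ^ 2 / 2 * (13 / 10 + |w|) + ∫ t in (0 : ℝ)..δ, (h (w - t) - h (w + t)) := by
    intro ε hε r hr hrδ
    have hεε : ε * ε = 1 := by rcases hε with rfl | rfl <;> norm_num
    have habs : |ε| = 1 := by rcases hε with rfl | rfl <;> norm_num
    have e1 : ∫ t in (0 : ℝ)..r, ε * (steinDeriv h c (w + ε * t) - steinDeriv h c w) =
        steinSol h c (w + ε * r) - steinSol h c w - ε * r * steinDeriv h c w := by
      have := intervalIntegral.integral_eq_sub_of_hasDerivAt (a := 0) (b := r)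
        (f := fun t => steinSol h c (w + ε * t) - ε * t * steinDeriv h c w)
        (f' := fun t => ε * (steinDeriv h c (w + ε * t) - steinDeriv h c w))
        (fun t _ => by
          have d1 : HasDerivAt (fun t : ℝ => w + ε * t) ε t := by
            simpa using ((hasDerivAt_id t).const_mul ε).const_add w
          have d2 := (H.steinSol_hasDerivAt (w + ε * t)).comp t d1
          have d3 : HasDerivAt (fun t : ℝ => ε * t * steinDeriv h c w)
              (ε * steinDeriv h c w) t := by
            simpa using ((hasDerivAt_id t).const_mul ε).mul_const (steinDeriv h c w)
          refine (d2.sub d3).congr_deriv ?_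
          unfold steinDeriv; ring)
        (by apply Continuous.intervalIntegrable; fun_prop)
      rw [this]; simp; ring
    rw [← e1, ← Real.norm_eq_abs]
    have hb : ∀ t ∈ Set.Icc (0 : ℝ) δ, ‖ε * (steinDeriv h c (w + ε * t) - steinDeriv h c w)‖ ≤
        t * (13 / 10 + |w|) + (h (w - t) - h (w + t)) := by
      intro t ht
      rw [norm_mul, Real.norm_eq_abs, habs, one_mul, Real.norm_eq_abs]
      refine (H.abs_steinDeriv_sub_le w (w + ε * t)).trans ?_
      rw [add_sub_cancel_left, abs_mul, habs, one_mul, abs_of_nonneg ht.1]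
      have a1 : h (w + t) ≤ h w := hanti (by linarith [ht.1])
      have a2 : h w ≤ h (w - t) := hanti (by linarith [ht.1])
      gcongr
      rcases hε with rfl | rfl
      · rw [one_mul, abs_of_nonpos (by linarith)]; linarith
      · rw [neg_one_mul, ← sub_eq_add_neg, abs_of_nonneg (by linarith)]; linarith
    have i1 : ∀ a b : ℝ, IntervalIntegrable
        (fun t => ‖ε * (steinDeriv h c (w + ε * t) - steinDeriv h c w)‖) volume a b :=
      fun a b => by apply Continuous.intervalIntegrable; fun_prop
    calc ‖∫ t in (0 : ℝ)..r, ε * (steinDeriv h c (w + ε * t) - steinDeriv h c w)‖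
        ≤ ∫ t in (0 : ℝ)..r, ‖ε * (steinDeriv h c (w + ε * t) - steinDeriv h c w)‖ :=
          intervalIntegral.norm_integral_le_integral_norm hr
      _ ≤ ∫ t in (0 : ℝ)..δ, ‖ε * (steinDeriv h c (w + ε * t) - steinDeriv h c w)‖ :=
          intervalIntegral.integral_mono_interval le_rfl hr hrδ
            (ae_of_all _ fun t => norm_nonneg _) (i1 _ _)
      _ ≤ ∫ t in (0 : ℝ)..δ, (t * (13 / 10 + |w|) + (h (w - t) - h (w + t))) :=
          intervalIntegral.integral_mono_on hδ (i1 _ _)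
            (by apply Continuous.intervalIntegrable; fun_prop) hb
      _ = _ := by
          rw [intervalIntegral.integral_add (by apply Continuous.intervalIntegrable; fun_prop)
            (by apply Continuous.intervalIntegrable; fun_prop)]
          simp
  rcases le_total w w' with hle | hle
  · rw [abs_of_nonneg (by linarith)] at hw
    have := hint 1 (Or.inl rfl) (w' - w) (by linarith) hw
    simpa using this
  · rw [abs_of_nonpos (by linarith)] at hw
    have := hint (-1) (Or.inr rfl) (w - w') (by linarith) (by linarith)
    simpa using this

end SteinEquation

end IsolatedPoints

namespace IsolatedPoints

/-! ### Ramp functions and smoothing of distribution functions -/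

section Smoothing

/-- The piecewise linear function equal to `1` up to `z` and to `0` from `z + l` on. -/
noncomputable def ramp (z l x : ℝ) : ℝ := l⁻¹ * max 0 (min l (z + l - x))

variable {z l : ℝ}

lemma continuous_ramp : Continuous (ramp z l) := by unfold ramp; fun_prop

lemma ramp_nonneg (hl : 0 < l) (x : ℝ) : 0 ≤ ramp z l x :=
  mul_nonneg (inv_pos.mpr hl).le (le_max_left _ _)

lemma ramp_le_one (hl : 0 < l) (x : ℝ) : ramp z l x ≤ 1 := by
  rw [ramp, inv_mul_le_iff₀ hl, mul_one]
  exact max_le hl.le (min_le_left _ _)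

lemma antitone_ramp (hl : 0 < l) : Antitone (ramp z l) := by
  intro x y hxy
  unfold ramp
  have := (inv_pos.mpr hl).le
  gcongr

lemma ramp_of_le (hl : 0 < l) {x : ℝ} (hx : x ≤ z) : ramp z l x = 1 := by
  rw [ramp, min_eq_left (by linarith), max_eq_right hl.le, inv_mul_cancel₀ hl.ne']

lemma ramp_of_ge {x : ℝ} (hx : z + l ≤ x) : ramp z l x = 0 := by
  rw [ramp, max_eq_left ((min_le_right _ _).trans (by linarith)), mul_zero]

lemma ramp_add (x s : ℝ) : ramp z l (x + s) = ramp (z - s) l x := by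
  unfold ramp
  rw [show z + l - (x + s) = z - s + l - x by ring]

lemma ramp_eq_integral (x : ℝ) :
    ramp z l x = l⁻¹ * ∫ y in Set.Ioc z (z + l), (Set.Ici x).indicator (fun _ => (1 : ℝ)) y := by
  have h1 : ∫ y in Set.Ioc z (z + l), (Set.Ici x).indicator (fun _ => (1 : ℝ)) y =
      volume.real (Set.Ioc (max z x) (z + l)) := by
    rw [setIntegral_indicator measurableSet_Ici, setIntegral_const, smul_eq_mul, mul_one]
    refine measureReal_congr ?_
    have : Set.Ioc (max z x) (z + l) = Set.Ioc z (z + l) ∩ Set.Ioi x := by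
      ext y; simp [and_right_comm]
    rw [this]
    exact (ae_eq_refl _).inter Ioi_ae_eq_Ici.symm
  rw [h1, Real.volume_real_Ioc, ramp]
  congr 1
  rw [max_comm]
  congr 1
  rcases le_total z x with h | h
  · rw [max_eq_right h, min_eq_right (by linarith)]
  · rw [max_eq_left h, min_eq_left (by linarith)]; ring

variable (ν : Measure ℝ) [IsProbabilityMeasure ν]

lemma monotone_measureReal_Iic : Monotone fun y => ν.real (Set.Iic y) :=
  fun _ _ h => measureReal_mono (Set.Iic_subset_Iic.mpr h)

/-- A ramp is the average of the indicators of `(-∞, y]` over `y` in `(z, z + l]`, so by Fubini its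
integral is an average of the distribution function. -/
lemma integral_ramp (hl : 0 < l) :
    ∫ x, ramp z l x ∂ν = l⁻¹ * ∫ y in z..(z + l), ν.real (Set.Iic y) := by
  simp_rw [ramp_eq_integral]
  rw [integral_const_mul, intervalIntegral.integral_of_le (by linarith), integral_integral_swap]
  · congr 1
    refine integral_congr_ae (ae_of_all _ fun y => ?_)
    have : ∀ x, (Set.Ici x).indicator (fun _ => (1 : ℝ)) y =
        (Set.Iic y).indicator (fun _ => (1 : ℝ)) x := fun x => by simp [Set.indicator]
    simp_rw [this]
    simp [integral_indicator measurableSet_Iic]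
  · have hm : Measurable (Function.uncurry fun x y : ℝ =>
        (Set.Ici x).indicator (fun _ => (1 : ℝ)) y) := by
      have : (Function.uncurry fun x y : ℝ => (Set.Ici x).indicator (fun _ => (1 : ℝ)) y) =
          {q : ℝ × ℝ | q.1 ≤ q.2}.indicator fun _ => (1 : ℝ) := by
        ext ⟨x, y⟩; simp [Set.indicator]
      rw [this]
      exact measurable_const.indicator (measurableSet_le measurable_fst measurable_snd)
    refine Integrable.of_bound hm.aestronglyMeasurable 1 (ae_of_all _ fun q => ?_)
    simp only [Function.uncurry, Set.indicator]
    split_ifs <;> simp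

/-- The normal density is at most `1/√(2π)`, which is below `2/5`. Averaging this slope over a
window of width `l` is what produces the smoothing error `l/5`. -/
lemma gaussianReal_Iic_sub_le {a b : ℝ} (hab : a ≤ b) :
    (gaussianReal 0 1).real (Set.Iic b) - (gaussianReal 0 1).real (Set.Iic a) ≤
      2 / 5 * (b - a) := by
  have h1 : (gaussianReal 0 1).real (Set.Iic b) - (gaussianReal 0 1).real (Set.Iic a) =
      (gaussianReal 0 1).real (Set.Ioc a b) := by
    rw [← Set.Iic_sdiff_Iic, measureReal_sdiff (Set.Iic_subset_Iic.mpr hab) measurableSet_Iic]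
  rw [h1, Measure.real, gaussianReal_apply_eq_integral 0 one_ne_zero,
    ENNReal.toReal_ofReal (integral_nonneg fun x => gaussianPDFReal_nonneg _ _ _)]
  calc ∫ x in Set.Ioc a b, gaussianPDFReal 0 1 x ≤ ∫ x in Set.Ioc a b, (2 / 5 : ℝ) := by
        refine integral_mono (integrable_gaussianPDFReal 0 1).integrableOn
          (integrableOn_const (by simp)) fun x => ?_
        have h2 : (5 / 2 : ℝ) ≤ √(2 * Real.pi * (1 : NNReal)) := by
          apply Real.le_sqrt_of_sq_le
          have := Real.pi_gt_d2
          push_cast; nlinarith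
        have h3 : Real.exp (-(x - 0) ^ 2 / (2 * (1 : NNReal))) ≤ 1 := by
          rw [Real.exp_le_one_iff]; push_cast; nlinarith [sq_nonneg (x - 0)]
        simp only [gaussianPDFReal]
        have h4 : (√(2 * Real.pi * (1 : NNReal)))⁻¹ ≤ 2 / 5 := by
          exact (inv_anti₀ (by norm_num) h2).trans (by norm_num)
        exact (mul_le_of_le_one_right (by positivity) h3).trans h4
    _ = 2 / 5 * (b - a) := by
        rw [setIntegral_const, Real.volume_real_Ioc_of_le hab, smul_eq_mul, mul_comm]

lemma integral_ramp_gaussian_le (hl : 0 < l) :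
    ∫ x, ramp z l x ∂(gaussianReal 0 1) ≤ (gaussianReal 0 1).real (Set.Iic z) + l / 5 := by
  rw [integral_ramp _ hl, inv_mul_le_iff₀ hl]
  have h : ∫ y in z..(z + l), (gaussianReal 0 1).real (Set.Iic y) ≤
      ∫ y in z..(z + l), ((gaussianReal 0 1).real (Set.Iic z) + 2 / 5 * (y - z)) := by
    refine intervalIntegral.integral_mono_on (by linarith)
      (monotone_measureReal_Iic _).intervalIntegrable
      (by apply Continuous.intervalIntegrable; fun_prop) fun y hy => ?_
    linarith [gaussianReal_Iic_sub_le hy.1]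
  refine h.trans (le_of_eq ?_)
  rw [intervalIntegral.integral_add (by simp) (by apply Continuous.intervalIntegrable; fun_prop),
    intervalIntegral.integral_const_mul, intervalIntegral.integral_comp_sub_right (fun y => y) z]
  simp
  ring

lemma le_integral_ramp_gaussian (hl : 0 < l) :
    (gaussianReal 0 1).real (Set.Iic z) - l / 5 ≤ ∫ x, ramp (z - l) l x ∂(gaussianReal 0 1) := by
  rw [integral_ramp _ hl, le_inv_mul_iff₀ hl, sub_add_cancel]
  have h : ∫ y in (z - l)..z, ((gaussianReal 0 1).real (Set.Iic z) - 2 / 5 * (z - y)) ≤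
      ∫ y in (z - l)..z, (gaussianReal 0 1).real (Set.Iic y) := by
    refine intervalIntegral.integral_mono_on (by linarith)
      (by apply Continuous.intervalIntegrable; fun_prop)
      (monotone_measureReal_Iic _).intervalIntegrable fun y hy => ?_
    linarith [gaussianReal_Iic_sub_le hy.2]
  refine le_trans (le_of_eq ?_) h
  rw [intervalIntegral.integral_sub (by simp) (by apply Continuous.intervalIntegrable; fun_prop),
    intervalIntegral.integral_const_mul, intervalIntegral.integral_comp_sub_left (fun y => y) z]
  simp
  ring

lemma measureReal_Iic_le_integral_ramp (hl : 0 < l) :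
    ν.real (Set.Iic z) ≤ ∫ x, ramp z l x ∂ν := by
  have : ν.real (Set.Iic z) = ∫ x, (Set.Iic z).indicator (fun _ => (1 : ℝ)) x ∂ν := by
    simp [integral_indicator measurableSet_Iic]
  rw [this]
  refine integral_mono ((integrable_const _).indicator measurableSet_Iic)
    (Integrable.of_bound continuous_ramp.aestronglyMeasurable 1 (ae_of_all _ fun x => ?_))
    fun x => ?_
  · rw [Real.norm_eq_abs, abs_of_nonneg (ramp_nonneg hl x)]; exact ramp_le_one hl x
  · by_cases hx : x ≤ z
    · simp [Set.indicator, hx, ramp_of_le hl hx]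
    · simp [Set.indicator, hx, ramp_nonneg hl x]

lemma integral_ramp_le_measureReal_Iic (hl : 0 < l) :
    ∫ x, ramp (z - l) l x ∂ν ≤ ν.real (Set.Iic z) := by
  have : ν.real (Set.Iic z) = ∫ x, (Set.Iic z).indicator (fun _ => (1 : ℝ)) x ∂ν := by
    simp [integral_indicator measurableSet_Iic]
  rw [this]
  refine integral_mono
    (Integrable.of_bound continuous_ramp.aestronglyMeasurable 1 (ae_of_all _ fun x => ?_))
    ((integrable_const _).indicator measurableSet_Iic) fun x => ?_
  · rw [Real.norm_eq_abs, abs_of_nonneg (ramp_nonneg hl x)]; exact ramp_le_one hl x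
  · by_cases hx : x ≤ z
    · simp [Set.indicator, hx, ramp_le_one hl x]
    · simp only [Set.indicator, Set.mem_Iic, hx, if_false]
      rw [ramp_of_ge (by linarith)]

/-- If the distribution function of `ν` is within `D` of the standard normal one, then shifts of
the averages of `ramp z l` are controlled by `D`. -/
lemma integral_ramp_shift_sub_le (hl : 0 < l) {D : ℝ}
    (hD : ∀ y, |ν.real (Set.Iic y) - (gaussianReal 0 1).real (Set.Iic y)| ≤ D) {t : ℝ}
    (ht : 0 ≤ t) :
    ∫ x, ramp z l (x - t) ∂ν - ∫ x, ramp z l (x + t) ∂ν ≤ 2 * t * (2 / 5 + 2 * D / l) := by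
  have hi : ∀ a b, IntervalIntegrable (fun y => ν.real (Set.Iic y)) volume a b :=
    fun a b => (monotone_measureReal_Iic ν).intervalIntegrable
  have e1 : ∀ x, ramp z l (x - t) = ramp (z + t) l x := fun x => by
    rw [sub_eq_add_neg, ramp_add, sub_neg_eq_add]
  simp_rw [e1, ramp_add, integral_ramp ν hl, ← mul_sub]
  rw [inv_mul_le_iff₀ hl]
  -- The two windows have equal length `l` and are shifted by `2t`. Rearranging exchanges the roles
  -- of shift and width: the integrand becomes the mass of an interval of length `l`, which `D` and
  -- the normal density control.
  have h1 : (∫ y in (z + t)..(z + t + l), ν.real (Set.Iic y)) -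
      ∫ y in (z - t)..(z - t + l), ν.real (Set.Iic y) =
      ∫ y in (z - t)..(z + t), (ν.real (Set.Iic (y + l)) - ν.real (Set.Iic y)) := by
    rw [intervalIntegral.integral_sub _ (hi _ _),
      intervalIntegral.integral_comp_add_right (fun y => ν.real (Set.Iic y)),
      ← intervalIntegral.integral_add_adjacent_intervals (hi (z - t) (z + t)) (hi (z + t) _),
      ← intervalIntegral.integral_add_adjacent_intervals (hi (z - t) (z + t)) (hi (z + t) _),
      ← intervalIntegral.integral_add_adjacent_intervals (hi (z + t) (z - t + l)) (hi _ (z + t + l))]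
    · simp only [intervalIntegral.integral_same]; ring
    · exact Monotone.intervalIntegrable fun a b hab =>
        monotone_measureReal_Iic ν (by simpa using hab)
  rw [h1]
  have h2 : ∫ y in (z - t)..(z + t), (ν.real (Set.Iic (y + l)) - ν.real (Set.Iic y)) ≤
      ∫ y in (z - t)..(z + t), (2 / 5 * l + 2 * D) := by
    refine intervalIntegral.integral_mono_on (by linarith) ?_ (by simp) fun y _ => ?_
    · refine IntervalIntegrable.sub (Monotone.intervalIntegrable fun a b hab =>
        monotone_measureReal_Iic ν (by simpa using hab)) (hi _ _)
    · have a1 := abs_le.mp (hD (y + l))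
      have a2 := abs_le.mp (hD y)
      have a3 := gaussianReal_Iic_sub_le (a := y) (b := y + l) (by linarith)
      linarith
  refine h2.trans (le_of_eq ?_)
  rw [intervalIntegral.integral_const, smul_eq_mul]
  field_simp
  ring

lemma integral_ramp_integral_le (hl : 0 < l) {D : ℝ}
    (hD : ∀ y, |ν.real (Set.Iic y) - (gaussianReal 0 1).real (Set.Iic y)| ≤ D) {δ : ℝ}
    (hδ : 0 ≤ δ) :
    ∫ x, (∫ t in (0 : ℝ)..δ, (ramp z l (x - t) - ramp z l (x + t))) ∂ν ≤
      δ ^ 2 * (2 / 5 + 2 * D / l) := by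
  have hr := continuous_ramp (z := z) (l := l)
  have hb : ∀ x, ‖ramp z l x‖ ≤ 1 := fun x => by
    rw [Real.norm_eq_abs, abs_of_nonneg (ramp_nonneg hl x)]; exact ramp_le_one hl x
  have hint : ∀ f : ℝ → ℝ, Continuous f → Integrable (fun x => ramp z l (f x)) ν := fun f hf =>
    Integrable.of_bound (hr.comp hf).aestronglyMeasurable 1 (ae_of_all _ fun x => hb _)
  simp_rw [intervalIntegral.integral_of_le hδ]
  rw [integral_integral_swap]
  · have : ∫ t in Set.Ioc 0 δ, ∫ x, (ramp z l (x - t) - ramp z l (x + t)) ∂ν ≤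
        ∫ t in Set.Ioc 0 δ, 2 * t * (2 / 5 + 2 * D / l) := by
      refine setIntegral_mono_on ?_ ?_ measurableSet_Ioc fun t ht => ?_
      · refine Integrable.of_bound (C := 2) ?_ (ae_of_all _ fun t => ?_)
        · refine StronglyMeasurable.aestronglyMeasurable ?_
          exact (Continuous.stronglyMeasurable (f := fun q : ℝ × ℝ =>
            ramp z l (q.2 - q.1) - ramp z l (q.2 + q.1)) (by fun_prop)).integral_prod_right
        · refine (norm_integral_le_of_norm_le_const (C := 2) (ae_of_all _ fun x => ?_)).trans
            (by simp)
          refine (norm_sub_le _ _).trans ?_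
          linarith [hb (x - t), hb (x + t)]
      · refine Continuous.integrableOn_Ioc (by fun_prop)
      · rw [integral_sub (hint _ (by fun_prop)) (hint _ (by fun_prop))]
        exact integral_ramp_shift_sub_le ν hl hD ht.1.le
    refine this.trans (le_of_eq ?_)
    rw [← intervalIntegral.integral_of_le hδ, intervalIntegral.integral_mul_const,
      intervalIntegral.integral_const_mul]
    simp
    left; ring
  · refine Integrable.of_bound (C := 2) (Continuous.aestronglyMeasurable (by
      unfold Function.uncurry; fun_prop)) (ae_of_all _ fun q => ?_)
    refine (norm_sub_le _ _).trans ?_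
    linarith [hb (q.1 - q.2), hb (q.1 + q.2)]

lemma isTest_ramp (hl : 0 < l) :
    IsTest (ramp z l) (∫ x, ramp z l x ∂(gaussianReal 0 1)) where
  cont := continuous_ramp
  nonneg := ramp_nonneg hl
  le_one := ramp_le_one hl
  nonneg_c := integral_nonneg (ramp_nonneg hl)
  c_le_one := by
    refine (integral_mono_of_nonneg (ae_of_all _ (ramp_nonneg hl)) (integrable_const 1)
      (ae_of_all _ (ramp_le_one hl))).trans (by simp)
  mean := by
    have e : ∀ x, gaussianPDFReal 0 1 x = (√(2 * Real.pi))⁻¹ * gaussWeight x := fun x => by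
      simp only [gaussianPDFReal, gaussWeight, NNReal.coe_one, mul_one]
      congr 2; ring
    have hs : √(2 * Real.pi) ≠ 0 := by positivity
    have h1 : ∫ x, ramp z l x ∂(gaussianReal 0 1) =
        (√(2 * Real.pi))⁻¹ * ∫ x, ramp z l x * gaussWeight x := by
      rw [integral_gaussianReal_eq_integral_smul one_ne_zero, ← integral_const_mul]
      simp only [e, smul_eq_mul]
      refine integral_congr_ae (ae_of_all _ fun x => ?_)
      simp only; ring
    simp_rw [sub_mul]
    rw [integral_sub (integrable_gaussWeight.bdd_mul (c := 1)
      continuous_ramp.aestronglyMeasurable (ae_of_all _ fun x => ?_))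
      (integrable_gaussWeight.const_mul _), integral_const_mul, h1, integral_gaussWeight]
    · field_simp; ring
    · rw [Real.norm_eq_abs, abs_of_nonneg (ramp_nonneg hl x)]; exact ramp_le_one hl x

end Smoothing

end IsolatedPoints

namespace IsolatedPoints

/-! ### Kolmogorov bound from a bounded coupling -/

section SteinMethod

/-- A bounded coupling for Stein's method, in operator form: `K f x` is to be thought of as the
conditional expectation of `f W' - f W` given `x`, where `|W' - W| ≤ δ`, and `g` as that of
`W' - W`. -/
structure SteinCoupling {X : Type*} [MeasurableSpace X] (P : Measure X) (W : X → ℝ)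
    (K : (ℝ → ℝ) → X → ℝ) (g : X → ℝ) (θ δ v : ℝ) : Prop where
  measurable : Measurable W
  integrable_sq : Integrable (fun x => W x ^ 2) P
  integral_sq_le : ∫ x, W x ^ 2 ∂P ≤ 1
  integrable_op : ∀ f : ℝ → ℝ, Continuous f → Integrable (K f) P
  stein : ∀ f : ℝ → ℝ, Continuous f → ∫ x, W x * f (W x) ∂P = θ * ∫ x, K f x ∂P
  local_bound : ∀ f : ℝ → ℝ, Continuous f → ∀ (x : X) (a R : ℝ),
    (∀ w', |w' - W x| ≤ δ → |f w' - f (W x) - (w' - W x) * a| ≤ R) → |K f x - a * g x| ≤ R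
  integrable_g : Integrable g P
  mean : θ * ∫ x, g x ∂P = 1
  integrable_g_sq : Integrable (fun x => (g x - ∫ y, g y ∂P) ^ 2) P
  var_le : ∫ x, (g x - ∫ y, g y ∂P) ^ 2 ∂P ≤ v ^ 2
  delta_nonneg : 0 ≤ δ
  v_pos : 0 < v

variable {X : Type*} [MeasurableSpace X] {P : Measure X} [IsProbabilityMeasure P] {W : X → ℝ}
  {K : (ℝ → ℝ) → X → ℝ} {g : X → ℝ} {θ δ v : ℝ}

lemma SteinCoupling.integrable_abs (H : SteinCoupling P W K g θ δ v) :
    Integrable (fun x => |W x|) P := by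
  refine (H.integrable_sq.add (integrable_const 1)).mono' H.measurable.abs.aestronglyMeasurable
    (ae_of_all _ fun x => ?_)
  simp only [Pi.add_apply, Real.norm_eq_abs, abs_abs]
  rw [← sq_abs]
  nlinarith [sq_nonneg (|W x| - 1)]

lemma SteinCoupling.integral_abs_le (H : SteinCoupling P W K g θ δ v) :
    ∫ x, |W x| ∂P ≤ 1 := by
  have h1 : ∫ x, |W x| ∂P ≤ ∫ x, (1 / 2 * W x ^ 2 + 1 / 2) ∂P := by
    refine integral_mono H.integrable_abs
      ((H.integrable_sq.const_mul _).add (integrable_const _)) fun x => ?_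
    simp only
    rw [← sq_abs]
    nlinarith [sq_nonneg (|W x| - 1)]
  rw [integral_add (H.integrable_sq.const_mul _) (integrable_const _), integral_const_mul] at h1
  simp at h1
  linarith [H.integral_sq_le]

/-- Since `θ` times the mean of `g` is `1`, this is the first absolute moment of `g` about its mean,
up to `|θ|`. The inequality `|y| ≤ y²/(2v) + v/2` takes the place of Cauchy–Schwarz. -/
lemma SteinCoupling.integral_abs_one_sub_le (H : SteinCoupling P W K g θ δ v) :
    ∫ x, |1 - θ * g x| ∂P ≤ |θ| * v := by
  have hv := H.v_pos
  have e : ∀ x, |1 - θ * g x| = |θ| * |g x - ∫ y, g y ∂P| := fun x => by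
    rw [← H.mean, ← mul_sub, abs_mul, abs_sub_comm]
  simp_rw [e]
  rw [integral_const_mul]
  refine mul_le_mul_of_nonneg_left ?_ (abs_nonneg _)
  have h1 : ∫ x, |g x - ∫ y, g y ∂P| ∂P ≤
      ∫ x, ((2 * v)⁻¹ * (g x - ∫ y, g y ∂P) ^ 2 + v / 2) ∂P := by
    refine integral_mono (H.integrable_g.sub (integrable_const _)).abs
      ((H.integrable_g_sq.const_mul _).add (integrable_const _)) fun x => ?_
    simp only
    rw [← sq_abs, ← mul_le_mul_iff_right₀ (show 0 < 2 * v by linarith), mul_add,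
      mul_inv_cancel_left₀ (by linarith)]
    nlinarith [sq_nonneg (|g x - ∫ y, g y ∂P| - v)]
  rw [integral_add (H.integrable_g_sq.const_mul _) (integrable_const _), integral_const_mul] at h1
  have h2 : (2 * v)⁻¹ * ∫ x, (g x - ∫ y, g y ∂P) ^ 2 ∂P ≤ v / 2 := by
    rw [inv_mul_le_iff₀ (by linarith)]
    linarith [H.var_le]
  simp at h1 h2
  linarith

variable {l : ℝ}

/-- Stein's method estimate for a smoothed half-line indicator. -/
lemma SteinCoupling.abs_integral_ramp_sub_le (H : SteinCoupling P W K g θ δ v) (hl : 0 < l)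
    {D : ℝ} (hD : ∀ y, |(P.map W).real (Set.Iic y) - (gaussianReal 0 1).real (Set.Iic y)| ≤ D)
    (z : ℝ) :
    |∫ x, ramp z l x ∂(P.map W) - ∫ x, ramp z l x ∂(gaussianReal 0 1)| ≤
      |θ| * (v + δ ^ 2 * (31 / 20 + 2 * D / l)) := by
  have : IsProbabilityMeasure (P.map W) :=
    Measure.isProbabilityMeasure_map H.measurable.aemeasurable
  set c := ∫ x, ramp z l x ∂(gaussianReal 0 1) with hc
  have T : IsTest (ramp z l) c := isTest_ramp hl
  have hW := H.measurable
  have cf := T.continuous_steinSol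
  have cD := T.continuous_steinDeriv
  have cr := continuous_ramp (z := z) (l := l)
  set f := steinSol (ramp z l) c
  set f' := steinDeriv (ramp z l) c with hf'
  have e1 : ∫ x, ramp z l x ∂(P.map W) = ∫ x, ramp z l (W x) ∂P :=
    integral_map hW.aemeasurable cr.aestronglyMeasurable
  have ir : Integrable (fun x => ramp z l (W x)) P :=
    Integrable.of_bound (cr.measurable.comp hW).aestronglyMeasurable 1 (ae_of_all _ fun x => by
      rw [Real.norm_eq_abs, abs_of_nonneg (ramp_nonneg hl _)]; exact ramp_le_one hl _)
  have iD : Integrable (fun x => f' (W x)) P :=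
    Integrable.of_bound (cD.measurable.comp hW).aestronglyMeasurable 1 (ae_of_all _ fun x =>
      T.abs_deriv_le _)
  have iDg : Integrable (fun x => f' (W x) * g x) P :=
    H.integrable_g.bdd_mul (c := 1) (cD.measurable.comp hW).aestronglyMeasurable
      (ae_of_all _ fun x => T.abs_deriv_le _)
  have iWf : Integrable (fun x => W x * f (W x)) P := by
    have : (fun x => W x * f (W x)) = fun x => f' (W x) - (ramp z l (W x) - c) := by
      ext x; simp only [hf', steinDeriv]; ring
    rw [this]
    exact iD.sub (ir.sub (integrable_const _))
  -- Stein's equation turns the left side into the mean of `f'(W) - W f(W)`. The coupling identity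
  -- rewrites the second term, and splitting off the linear part `f'(W) g` leaves a variance term
  -- and a Taylor remainder.
  have e2 : ∫ x, ramp z l (W x) ∂P - c =
      ∫ x, f' (W x) * (1 - θ * g x) ∂P - θ * ∫ x, (K f x - f' (W x) * g x) ∂P := by
    have h1 : ∫ x, ramp z l (W x) ∂P - c = ∫ x, f' (W x) ∂P - ∫ x, W x * f (W x) ∂P := by
      rw [← integral_sub iD iWf]
      have : ∀ x, f' (W x) - W x * f (W x) = ramp z l (W x) - c := fun x => by
        simp only [hf', steinDeriv]; ring
      simp_rw [this]
      rw [integral_sub ir (integrable_const _)]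
      simp
    have h2 : ∫ x, f' (W x) * (1 - θ * g x) ∂P =
        ∫ x, f' (W x) ∂P - θ * ∫ x, f' (W x) * g x ∂P := by
      rw [← integral_const_mul, ← integral_sub iD (iDg.const_mul θ)]
      congr 1; ext x; ring
    rw [h1, h2, H.stein f cf, integral_sub (H.integrable_op f cf) iDg]
    ring
  have ig1 : Integrable (fun x => |1 - θ * g x|) P :=
    ((integrable_const 1).sub (H.integrable_g.const_mul θ)).abs
  have b1 : |∫ x, f' (W x) * (1 - θ * g x) ∂P| ≤ |θ| * v := by
    rw [← Real.norm_eq_abs]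
    refine (norm_integral_le_of_norm_le ig1 (ae_of_all _ fun x => ?_)).trans
      H.integral_abs_one_sub_le
    rw [norm_mul, Real.norm_eq_abs, Real.norm_eq_abs]
    exact mul_le_of_le_one_left (abs_nonneg _) (T.abs_deriv_le _)
  set q : ℝ → ℝ := fun w => ∫ t in (0 : ℝ)..δ, (ramp z l (w - t) - ramp z l (w + t)) with hq
  have mq : Measurable q := by
    have : StronglyMeasurable q := by
      simp only [hq, intervalIntegral.integral_of_le H.delta_nonneg]
      exact (Continuous.stronglyMeasurable (f := fun r : ℝ × ℝ =>
            ramp z l (r.1 - r.2) - ramp z l (r.1 + r.2)) (by fun_prop)).integral_prod_right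
    exact this.measurable
  have iq : Integrable (fun x => q (W x)) P := by
    refine Integrable.of_bound (C := 2 * δ) (mq.comp hW).aestronglyMeasurable
      (ae_of_all _ fun x => ?_)
    have := intervalIntegral.norm_integral_le_of_norm_le_const (a := 0) (b := δ) (C := 2)
      (f := fun t => ramp z l (W x - t) - ramp z l (W x + t)) fun t _ => by
        rw [Real.norm_eq_abs, abs_le]
        constructor <;> linarith [ramp_nonneg (z := z) hl (W x - t),
          ramp_nonneg (z := z) hl (W x + t),
          ramp_le_one (z := z) hl (W x - t), ramp_le_one (z := z) hl (W x + t)]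
    simpa [abs_of_nonneg H.delta_nonneg] using this
  have iR : Integrable (fun x => δ ^ 2 / 2 * (13 / 10 + |W x|) + q (W x)) P :=
    (((integrable_const _).add H.integrable_abs).const_mul _).add iq
  have b2 : |∫ x, (K f x - f' (W x) * g x) ∂P| ≤ δ ^ 2 * (31 / 20 + 2 * D / l) := by
    rw [← Real.norm_eq_abs]
    refine (norm_integral_le_of_norm_le iR (ae_of_all _ fun x => ?_)).trans ?_
    · exact H.local_bound f cf x _ _ fun w' hw' => T.taylor_remainder_le (antitone_ramp hl) hw'
    · have iA : Integrable (fun x => δ ^ 2 / 2 * (13 / 10 + |W x|)) P :=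
        ((integrable_const _).add H.integrable_abs).const_mul _
      rw [integral_add iA iq, integral_const_mul, integral_add (integrable_const _) H.integrable_abs]
      have e3 : ∫ x, q (W x) ∂P = ∫ x, q x ∂(P.map W) :=
        (integral_map hW.aemeasurable mq.aestronglyMeasurable).symm
      have b3 := integral_ramp_integral_le (z := z) (P.map W) hl hD H.delta_nonneg
      rw [e3]
      have b4 := H.integral_abs_le
      -- Here `E|W| ≤ 1`. Half of `23/10` plus the `2/5` from the ramp term is the constant `31/20`.
      have : δ ^ 2 / 2 * (∫ _, (13 / 10 : ℝ) ∂P + ∫ x, |W x| ∂P) ≤ δ ^ 2 / 2 * (23 / 10) := by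
        refine mul_le_mul_of_nonneg_left ?_ (by positivity)
        simp; linarith
      refine (add_le_add this b3).trans (le_of_eq ?_)
      ring
  rw [e1, e2]
  refine (abs_sub _ _).trans ?_
  rw [abs_mul, mul_add]
  exact add_le_add b1 (mul_le_mul_of_nonneg_left b2 (abs_nonneg _))

lemma SteinCoupling.abs_cdf_sub_le (H : SteinCoupling P W K g θ δ v) (hl : 0 < l)
    {D : ℝ} (hD : ∀ y, |(P.map W).real (Set.Iic y) - (gaussianReal 0 1).real (Set.Iic y)| ≤ D)
    (z : ℝ) :
    |(P.map W).real (Set.Iic z) - (gaussianReal 0 1).real (Set.Iic z)| ≤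
      |θ| * (v + δ ^ 2 * (31 / 20 + 2 * D / l)) + l / 5 := by
  have : IsProbabilityMeasure (P.map W) :=
    Measure.isProbabilityMeasure_map H.measurable.aemeasurable
  have h1 := abs_le.mp (H.abs_integral_ramp_sub_le hl hD z)
  have h2 := abs_le.mp (H.abs_integral_ramp_sub_le hl hD (z - l))
  have h3 := measureReal_Iic_le_integral_ramp (P.map W) (z := z) hl
  have h4 := integral_ramp_le_measureReal_Iic (P.map W) (z := z) hl
  have h5 := integral_ramp_gaussian_le (z := z) hl
  have h6 := le_integral_ramp_gaussian (z := z) hl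
  rw [abs_le]
  constructor <;> linarith

/-- The unknown `D` occurs on both sides; a width large enough to make its coefficient on the right
less than `1` lets it be absorbed on the left. -/
lemma le_of_forall_smoothing {D A E : ℝ} (hA : 0 < A) (hE : 0 ≤ E)
    (h : ∀ l, 0 < l → D ≤ A + E * D / l + l / 5) :
    D ≤ 1 / 5 * (√(5 * A + E) + √E) ^ 2 := by
  rcases hE.eq_or_lt with rfl | hE
  · have h1 : D ≤ A := by
      refine le_of_forall_pos_le_add fun ε hε => ?_
      have := h (5 * ε) (by linarith)
      simp at this
      linarith
    rw [Real.sqrt_zero, add_zero, add_zero, Real.sq_sqrt (by linarith)]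
    linarith
  · set a := √(5 * A + E)
    set b := √E
    have ha : 0 < a := Real.sqrt_pos.mpr (by linarith)
    have hb : 0 < b := Real.sqrt_pos.mpr hE
    have ha2 : a ^ 2 = 5 * A + E := Real.sq_sqrt (by linarith)
    have hb2 : b ^ 2 = E := Real.sq_sqrt hE.le
    -- The width `l = b² + ab` makes the coefficient of `D` on the right equal to `b/(a + b)`, and
    -- the rest sums to `a(a + b)/5`, whence `D ≤ (a + b)²/5`. For `E = 0` this width is zero, which
    -- is why that case is handled by a limit.
    have hl : 0 < b ^ 2 + a * b := by positivity
    have h1 := h _ hl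
    rw [← hb2, show A = (a ^ 2 - b ^ 2) / 5 by linarith] at h1
    have h2 : b ^ 2 * D / (b ^ 2 + a * b) = b * D / (a + b) := by field_simp; ring
    rw [h2] at h1
    have h3 : D * (a / (a + b)) = D - b * D / (a + b) := by field_simp; ring
    have h4 : D * (a / (a + b)) ≤ (a * (a + b)) / 5 := by rw [h3]; linarith
    rw [← mul_div_assoc, div_le_iff₀ (by positivity)] at h4
    have h5 : D * a ≤ (1 / 5 * (a + b) ^ 2) * a := h4.trans (le_of_eq (by ring))
    exact le_of_mul_le_mul_right h5 ha

/-- The Kolmogorov bound for a bounded coupling. -/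
theorem SteinCoupling.kolmogorov_le (H : SteinCoupling P W K g θ δ v) :
    ⨆ z, |(P.map W).real (Set.Iic z) - (gaussianReal 0 1).real (Set.Iic z)| ≤
      |θ| / 5 * (√(11 * δ ^ 2 + 5 * v) + 2 * δ) ^ 2 := by
  have hP : IsProbabilityMeasure (P.map W) :=
    Measure.isProbabilityMeasure_map H.measurable.aemeasurable
  set D := ⨆ z, |(P.map W).real (Set.Iic z) - (gaussianReal 0 1).real (Set.Iic z)|
  have hbdd : BddAbove (Set.range fun z =>
      |(P.map W).real (Set.Iic z) - (gaussianReal 0 1).real (Set.Iic z)|) := by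
    refine ⟨1, ?_⟩
    rintro _ ⟨z, rfl⟩
    simp only
    rw [abs_le]
    constructor <;> linarith [measureReal_nonneg (μ := P.map W) (s := Set.Iic z),
      measureReal_nonneg (μ := gaussianReal 0 1) (s := Set.Iic z),
      measureReal_le_one (μ := P.map W) (s := Set.Iic z),
      measureReal_le_one (μ := gaussianReal 0 1) (s := Set.Iic z)]
  have hD : ∀ z, |(P.map W).real (Set.Iic z) - (gaussianReal 0 1).real (Set.Iic z)| ≤ D :=
    fun z => le_ciSup hbdd z
  have hθ : 0 < |θ| := by
    rw [abs_pos]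
    rintro rfl
    simpa using H.mean
  have hv := H.v_pos
  have hδ := H.delta_nonneg
  -- The constant `31/20` is relaxed to `9/5` so that `5 · 9/5 + 2 = 11`.
  have h1 : D ≤ 1 / 5 * (√(5 * (|θ| * (v + 9 / 5 * δ ^ 2)) + 2 * |θ| * δ ^ 2) +
      √(2 * |θ| * δ ^ 2)) ^ 2 := by
    refine le_of_forall_smoothing (by positivity) (by positivity) fun l hl => ?_
    refine ciSup_le fun z => (H.abs_cdf_sub_le hl hD z).trans ?_
    have : |θ| * (v + δ ^ 2 * (31 / 20 + 2 * D / l)) =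
      |θ| * (v + 31 / 20 * δ ^ 2) + 2 * |θ| * δ ^ 2 * D / l := by ring
    rw [this]
    have h31 : (31 / 20 : ℝ) ≤ 9 / 5 := by norm_num
    gcongr
  refine h1.trans ?_
  have e1 : √(5 * (|θ| * (v + 9 / 5 * δ ^ 2)) + 2 * |θ| * δ ^ 2) =
      √|θ| * √(11 * δ ^ 2 + 5 * v) := by
    rw [← Real.sqrt_mul hθ.le]; congr 1; ring
  have e2 : √(2 * |θ| * δ ^ 2) ≤ √|θ| * (2 * δ) := by
    rw [Real.sqrt_le_left (by positivity), mul_pow, Real.sq_sqrt hθ.le]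
    nlinarith [mul_nonneg hθ.le (sq_nonneg δ)]
  have e3 : |θ| / 5 * (√(11 * δ ^ 2 + 5 * v) + 2 * δ) ^ 2 =
      1 / 5 * (√|θ| * √(11 * δ ^ 2 + 5 * v) + √|θ| * (2 * δ)) ^ 2 := by
    rw [← mul_add, mul_pow, Real.sq_sqrt hθ.le]; ring
  rw [e3, e1]
  gcongr

end SteinMethod

end IsolatedPoints

namespace IsolatedPoints

/-! ### Resampling coordinates and the Efron–Stein inequality -/

section Resampling

set_option linter.unusedSectionVars false

variable {ι E : Type*} [Fintype ι] [DecidableEq ι] [MeasurableSpace E]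
  (γ : Measure E) [IsProbabilityMeasure γ]

lemma measurePreserving_optionEquiv :
    MeasurePreserving (fun x : Option ι → E => ((fun i => x (some i) : ι → E), x none))
      (Measure.pi fun _ => γ) ((Measure.pi fun _ => γ).prod γ) := by
  have h := Measure.pi_map_piOptionEquivProd (ι := ι) (fun _ => γ)
  refine ⟨by fun_prop, ?_⟩
  rw [← h]
  exact (MeasurableEquiv.piOptionEquivProd fun _ : Option ι => E).map_map_symm

/-- Exchanging one coordinate of an iid configuration with an independent copy. -/
lemma measurePreserving_exchange (j : ι) :
    MeasurePreserving (fun q : (ι → E) × E => (Function.update q.1 j q.2, q.1 j))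
      ((Measure.pi fun _ => γ).prod γ) ((Measure.pi fun _ => γ).prod γ) := by
  have he := measurePreserving_optionEquiv (ι := ι) γ
  have hm : Measurable fun q : (ι → E) × E => (Function.update q.1 j q.2, q.1 j) := by
    refine Measurable.prodMk ?_ (by fun_prop)
    refine measurable_pi_iff.mpr fun i => ?_
    by_cases hi : i = j
    · subst hi; simpa using measurable_snd
    · simp only [Function.update_of_ne hi]; fun_prop
  -- The independent copy is treated as one more coordinate, indexed by `none`; the exchange is then
  -- a transposition of coordinates of an iid family.
  have hc := measurePreserving_piCongrLeft (fun _ : Option ι => γ)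
    (Equiv.swap none (some j))
  refine ⟨hm, ?_⟩
  conv_lhs => rw [← he.map_eq]
  rw [Measure.map_map hm he.measurable]
  have : ((fun q : (ι → E) × E => (Function.update q.1 j q.2, q.1 j)) ∘
      fun x : Option ι → E => ((fun i => x (some i) : ι → E), x none)) =
      (fun x : Option ι → E => ((fun i => x (some i) : ι → E), x none)) ∘
        MeasurableEquiv.piCongrLeft (fun _ : Option ι => E) (Equiv.swap none (some j)) := by
    funext x
    have key : ∀ a, MeasurableEquiv.piCongrLeft (fun _ : Option ι => E)
        (Equiv.swap none (some j)) x a = x (Equiv.swap none (some j) a) := fun a => by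
      have := MeasurableEquiv.piCongrLeft_apply_apply (Equiv.swap none (some j))
        (β := fun _ : Option ι => E) x (Equiv.swap none (some j) a)
      rwa [Equiv.swap_apply_self] at this
    simp only [Function.comp, key]
    refine Prod.ext (funext fun i => ?_) ?_
    · by_cases hi : i = j
      · subst hi; simp
      · simp [Equiv.swap_apply_of_ne_of_ne, hi]
    · simp
  rw [this]
  exact (he.comp hc).map_eq

lemma measurable_update_prod (j : ι) :
    Measurable fun q : (ι → E) × E => Function.update q.1 j q.2 := by
  refine measurable_pi_iff.mpr fun i => ?_
  by_cases hi : i = j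
  · subst hi; simpa using measurable_snd
  · simp only [Function.update_of_ne hi]; fun_prop

/-- Averaging a function of the configuration over its `j`-th coordinate. -/
noncomputable def resample (j : ι) (F : (ι → E) → ℝ) (u : ι → E) : ℝ :=
  ∫ v, F (Function.update u j v) ∂γ

/-- Bounded measurable functions. -/
structure BddMeas {X : Type*} [MeasurableSpace X] (F : X → ℝ) : Prop where
  meas : Measurable F
  bdd : ∃ C, ∀ x, |F x| ≤ C

section BddMeas
variable {X Y : Type*} [MeasurableSpace X] [MeasurableSpace Y] {F G : X → ℝ}

lemma BddMeas.integrable (hF : BddMeas F) (μ : Measure X) [IsFiniteMeasure μ] :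
    Integrable F μ := by
  obtain ⟨C, hC⟩ := hF.bdd
  exact Integrable.of_bound hF.meas.aestronglyMeasurable C (ae_of_all _ hC)

lemma BddMeas.add (hF : BddMeas F) (hG : BddMeas G) : BddMeas fun x => F x + G x := by
  obtain ⟨C, hC⟩ := hF.bdd
  obtain ⟨D, hD⟩ := hG.bdd
  exact ⟨hF.meas.add hG.meas, C + D, fun x =>
    (abs_add_le _ _).trans (add_le_add (hC x) (hD x))⟩

lemma BddMeas.mul (hF : BddMeas F) (hG : BddMeas G) : BddMeas fun x => F x * G x := by
  obtain ⟨C, hC⟩ := hF.bdd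
  obtain ⟨D, hD⟩ := hG.bdd
  refine ⟨hF.meas.mul hG.meas, C * D, fun x => ?_⟩
  rw [abs_mul]
  exact mul_le_mul (hC x) (hD x) (abs_nonneg _) ((abs_nonneg _).trans (hC x))

lemma BddMeas.const (c : ℝ) : BddMeas fun _ : X => c := ⟨measurable_const, |c|, fun _ => le_rfl⟩

lemma BddMeas.sub (hF : BddMeas F) (hG : BddMeas G) : BddMeas fun x => F x - G x := by
  convert hF.add ((BddMeas.const (-1)).mul hG) using 2
  ring

lemma BddMeas.sq (hF : BddMeas F) : BddMeas fun x => F x ^ 2 := by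
  simpa only [pow_two] using hF.mul hF

lemma BddMeas.comp (hF : BddMeas F) {f : Y → X} (hf : Measurable f) : BddMeas fun y => F (f y) := by
  obtain ⟨C, hC⟩ := hF.bdd
  exact ⟨hF.meas.comp hf, C, fun y => hC _⟩

lemma BddMeas.sum {κ : Type*} (s : Finset κ) {F : κ → X → ℝ} (hF : ∀ k ∈ s, BddMeas (F k)) :
    BddMeas fun x => ∑ k ∈ s, F k x := by
  classical
  induction s using Finset.induction_on with
  | empty => simpa using BddMeas.const 0
  | insert a s ha ih =>
    simp_rw [Finset.sum_insert ha]
    exact (hF a (Finset.mem_insert_self a s)).add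
      (ih fun k hk => hF k (Finset.mem_insert_of_mem hk))

lemma BddMeas.integral_right {F : X × E → ℝ} (hF : BddMeas F) :
    BddMeas fun x => ∫ v, F (x, v) ∂γ := by
  obtain ⟨C, hC⟩ := hF.bdd
  refine ⟨(hF.meas.stronglyMeasurable.integral_prod_right' (ν := γ)).measurable, C, fun x => ?_⟩
  have h : ‖∫ v, F (x, v) ∂γ‖ ≤ C * γ.real Set.univ :=
    norm_integral_le_of_norm_le_const (ae_of_all _ fun v => hC (x, v))
  simpa using h

end BddMeas

variable {F G : (ι → E) → ℝ}

lemma BddMeas.resample (hF : BddMeas F) (j : ι) : BddMeas (resample γ j F) :=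
  BddMeas.integral_right γ (F := fun q => F (Function.update q.1 j q.2))
    (hF.comp (measurable_update_prod j))

lemma integral_exchange {F : (ι → E) → E → ℝ} (hF : BddMeas (Function.uncurry F)) (j : ι) :
    ∫ u, ∫ v, F (Function.update u j v) (u j) ∂γ ∂(Measure.pi fun _ => γ) =
      ∫ u, ∫ v, F u v ∂γ ∂(Measure.pi fun _ : ι => γ) := by
  have h := measurePreserving_exchange γ j
  have e2 := integral_prod (μ := Measure.pi fun _ : ι => γ) (ν := γ) _ (hF.integrable _)
  have e3 := integral_prod (μ := Measure.pi fun _ : ι => γ) (ν := γ) _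
    ((hF.comp h.measurable).integrable _)
  simp only [Function.uncurry] at e2 e3
  rw [← e2, ← e3]
  exact h.integral_comp' (f := ⟨⟨_, fun q : (ι → E) × E => (Function.update q.1 j q.2, q.1 j),
    fun q => by simp, fun q => by simp⟩, h.measurable, h.measurable⟩) (Function.uncurry F)

lemma integral_resample (hF : BddMeas F) (j : ι) :
    ∫ u, resample γ j F u ∂(Measure.pi fun _ => γ) = ∫ u, F u ∂(Measure.pi fun _ => γ) := by
  have := integral_exchange γ (F := fun u _ => F u) (hF.comp measurable_fst) j
  simpa [resample] using this

lemma resample_update (i : ι) (F : (ι → E) → ℝ) (u : ι → E) (v : E) :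
    resample γ i F (Function.update u i v) = resample γ i F u := by
  simp [resample]

lemma resample_update_of_indep {i j : ι} (hF : ∀ u v, F (Function.update u j v) = F u)
    (u : ι → E) (v : E) : resample γ i F (Function.update u j v) = resample γ i F u := by
  by_cases h : i = j
  · subst h; exact resample_update γ i F u v
  · simp only [resample]
    congr 1; ext w
    rw [Function.update_comm (Ne.symm h), hF]

lemma resample_sub (hF : BddMeas F) (hG : BddMeas G) (j : ι) (u : ι → E) :
    resample γ j (fun u => F u - G u) u = resample γ j F u - resample γ j G u := by
  have hm : Measurable fun v => Function.update u j v :=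
    (measurable_update_prod j).comp (measurable_const.prodMk measurable_id)
  exact integral_sub ((hF.comp hm).integrable _) ((hG.comp hm).integrable _)

lemma integral_mul_resample (hF : BddMeas F) (hG : BddMeas G) (j : ι)
    (hi : ∀ u v, G (Function.update u j v) = G u) :
    ∫ u, resample γ j F u * G u ∂(Measure.pi fun _ => γ) =
      ∫ u, F u * G u ∂(Measure.pi fun _ => γ) := by
  rw [← integral_resample γ (hF.mul hG) j]
  congr 1; ext u
  simp only [resample, hi, integral_mul_const]

/-- Pythagoras for the conditional expectation `resample`. -/
lemma integral_sq_eq_resample (hF : BddMeas F) (hG : BddMeas G) (j : ι)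
    (hi : ∀ u v, G (Function.update u j v) = G u) :
    ∫ u, (F u - G u) ^ 2 ∂(Measure.pi fun _ => γ) =
      ∫ u, (F u - resample γ j F u) ^ 2 ∂(Measure.pi fun _ => γ) +
        ∫ u, (resample γ j F u - G u) ^ 2 ∂(Measure.pi fun _ => γ) := by
  have hR := hF.resample γ j
  have h1 := integral_mul_resample γ hF (hR.sub hG) j fun u v => by
    rw [resample_update, hi]
  have e : ∀ u, (F u - G u) ^ 2 = (F u - resample γ j F u) ^ 2 +
      ((resample γ j F u - G u) ^ 2 + 2 * (F u * (resample γ j F u - G u) -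
        resample γ j F u * (resample γ j F u - G u))) := fun u => by ring
  simp_rw [e]
  have i1 := ((hF.mul (hR.sub hG)).integrable (Measure.pi fun _ : ι => γ))
  have i2 := ((hR.mul (hR.sub hG)).integrable (Measure.pi fun _ : ι => γ))
  rw [integral_add ((hF.sub hR).sq.integrable _), integral_add ((hR.sub hG).sq.integrable _),
    integral_const_mul, integral_sub i1 i2, h1]
  · ring
  · exact (i1.sub i2).const_mul 2
  · exact ((hR.sub hG).sq.integrable _).add ((i1.sub i2).const_mul 2)

lemma integral_resample_sq_le (hF : BddMeas F) (j : ι) :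
    ∫ u, resample γ j F u ^ 2 ∂(Measure.pi fun _ => γ) ≤
      ∫ u, F u ^ 2 ∂(Measure.pi fun _ => γ) := by
  have h := integral_sq_eq_resample γ hF (BddMeas.const 0) j fun _ _ => rfl
  simp only [sub_zero] at h
  rw [h]
  have : 0 ≤ ∫ u, (F u - resample γ j F u) ^ 2 ∂(Measure.pi fun _ => γ) :=
    integral_nonneg fun _ => sq_nonneg _
  linarith

lemma integral_sub_resample_sq_le (hF : BddMeas F) (hG : BddMeas G) (j : ι)
    (hi : ∀ u v, G (Function.update u j v) = G u) :
    ∫ u, (F u - resample γ j F u) ^ 2 ∂(Measure.pi fun _ => γ) ≤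
      ∫ u, (F u - G u) ^ 2 ∂(Measure.pi fun _ => γ) := by
  rw [integral_sq_eq_resample γ hF hG j hi]
  have : 0 ≤ ∫ u, (resample γ j F u - G u) ^ 2 ∂(Measure.pi fun _ => γ) :=
    integral_nonneg fun _ => sq_nonneg _
  linarith

/-- Averaging over a list of coordinates. -/
noncomputable def resampleList (L : List ι) (F : (ι → E) → ℝ) : (ι → E) → ℝ :=
  L.foldl (fun F j => resample γ j F) F

lemma integral_resampleList (L : List ι) : ∀ {F : (ι → E) → ℝ}, BddMeas F →
    ∫ u, resampleList γ L F u ∂(Measure.pi fun _ => γ) = ∫ u, F u ∂(Measure.pi fun _ => γ) := by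
  induction L with
  | nil => exact fun _ => rfl
  | cons k L ih => exact fun hF => (ih (hF.resample γ k)).trans (integral_resample γ hF k)

lemma resampleList_update_of_indep (L : List ι) {j : ι} : ∀ {F : (ι → E) → ℝ},
    (∀ u v, F (Function.update u j v) = F u) → ∀ u v,
      resampleList γ L F (Function.update u j v) = resampleList γ L F u := by
  induction L with
  | nil => exact fun hF => hF
  | cons k L ih => exact fun hF => ih fun u v => resample_update_of_indep γ hF u v

lemma resampleList_update (L : List ι) {j : ι} : ∀ (F : (ι → E) → ℝ), j ∈ L → ∀ u v,
      resampleList γ L F (Function.update u j v) = resampleList γ L F u := by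
  induction L with
  | nil => simp
  | cons k L ih =>
    intro F hj
    rcases List.mem_cons.mp hj with rfl | hj
    · exact resampleList_update_of_indep γ L fun u v => resample_update γ j F u v
    · exact ih _ hj

/-- Each averaging step splits off, by Pythagoras, the squared distance from `F` to its average over
`k`, which is the least distance to functions independent of coordinate `k`. Averaging is a
contraction and preserves independence of a coordinate, so the induction can proceed with the
averaged comparison functions. -/
lemma integral_sq_le_sum_add (L : List ι) : ∀ {F : (ι → E) → ℝ} {g : ι → (ι → E) → ℝ},
    BddMeas F → (∀ k, BddMeas (g k)) → (∀ k u v, g k (Function.update u k v) = g k u) →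
    ∫ u, F u ^ 2 ∂(Measure.pi fun _ => γ) ≤
      (L.map fun k => ∫ u, (F u - g k u) ^ 2 ∂(Measure.pi fun _ => γ)).sum +
        ∫ u, resampleList γ L F u ^ 2 ∂(Measure.pi fun _ => γ) := by
  induction L with
  | nil => intro F g _ _ _; simp [resampleList]
  | cons k L ih =>
    intro F g hF hg hi
    have h1 := integral_sq_eq_resample γ hF (BddMeas.const 0) k fun _ _ => rfl
    simp only [sub_zero] at h1
    have h2 := integral_sub_resample_sq_le γ hF (hg k) k (hi k)
    have h3 := ih (g := fun j => resample γ k (g j)) (hF.resample γ k)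
      (fun j => (hg j).resample γ k) fun j u v => resample_update_of_indep γ (hi j) u v
    have h4 : (L.map fun j => ∫ u, (resample γ k F u - resample γ k (g j) u) ^ 2
        ∂(Measure.pi fun _ => γ)).sum ≤
        (L.map fun j => ∫ u, (F u - g j u) ^ 2 ∂(Measure.pi fun _ => γ)).sum := by
      refine List.sum_le_sum fun j _ => ?_
      have := integral_resample_sq_le γ (hF.sub (hg j)) k
      simp_rw [resample_sub γ hF (hg j) k] at this
      exact this
    rw [List.map_cons, List.sum_cons]
    have e : resampleList γ (k :: L) F = resampleList γ L (resample γ k F) := rfl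
    rw [e]
    linarith

/-- The Efron–Stein inequality. -/
theorem efron_stein {g : ι → (ι → E) → ℝ} (hF : BddMeas F) (hg : ∀ k, BddMeas (g k))
    (hi : ∀ k u v, g k (Function.update u k v) = g k u) :
    ∫ u, (F u - ∫ w, F w ∂(Measure.pi fun _ => γ)) ^ 2 ∂(Measure.pi fun _ => γ) ≤
      ∑ k, ∫ u, (F u - g k u) ^ 2 ∂(Measure.pi fun _ => γ) := by
  set m := ∫ w, F w ∂(Measure.pi fun _ => γ)
  have hFm := hF.sub (BddMeas.const m)
  have h := integral_sq_le_sum_add γ (Finset.univ : Finset ι).toList hFm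
    (fun k => (hg k).sub (BddMeas.const m)) fun k u v => by simp only [hi]
  set R := resampleList γ (Finset.univ : Finset ι).toList fun u => F u - m
  -- After averaging over every index the function is invariant under each single update. Passing
  -- from `u` to `w` one coordinate at a time shows that it is constant, hence equal to its mean,
  -- which is zero.
  have hconst : ∀ u w, R u = R w := by
    intro u w
    have hs : ∀ s : Finset ι, R (s.piecewise w u) = R u := by
      intro s
      induction s using Finset.induction_on with
      | empty => simp
      | insert a s _ ih =>
        rw [Finset.piecewise_insert, ← ih]
        exact resampleList_update γ _ _ (by simp) _ _
    simpa using (hs Finset.univ).symm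
  have hR0 : ∀ u, R u = 0 := by
    intro u
    have h1 := integral_resampleList γ (Finset.univ : Finset ι).toList hFm
    rw [integral_sub (hF.integrable _) (integrable_const _)] at h1
    have h2 : ∫ w, R w ∂(Measure.pi fun _ => γ) = R u := by
      simp_rw [fun w => hconst w u]; simp
    rw [← h2, h1]
    simp [m]
  simp_rw [hR0] at h
  simpa [sub_sub_sub_cancel_right] using h

end Resampling

end IsolatedPoints

namespace IsolatedPoints

/-! ### Conditioning a binomial count to be positive -/

section ResamplingProbabilities

/-- Resampling probabilities turning a binomial count into the same count conditioned to be
positive. -/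
lemma exists_resampling_probabilities (m : ℕ) (hm : 1 ≤ m) (p : ℝ) (hp0 : 0 < p) (hp1 : p < 1) :
    ∃ α : ℕ → ℝ, (∀ k, 0 ≤ α k) ∧ (∀ k, α k ≤ 1) ∧ α 0 = 1 ∧
      ∀ k < m, ((k : ℝ) + 1) * ((1 - p) * α k + p * α (k + 1)) =
        m * p * ((1 - (1 - p) ^ m)⁻¹ - 1 + α (k + 1)) := by
  set q := 1 - p with hq
  have hq0 : 0 < q := by linarith
  have hq1 : q < 1 := by linarith
  have hqm : q ^ m < 1 := pow_lt_one₀ hq0.le hq1 (by omega)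
  have hmR : (0 : ℝ) < m := by exact_mod_cast hm
  have hqm0 : 0 < q ^ m := by positivity
  have hτ : 0 < 1 - q ^ m := by linarith
  -- For `k < m` this incomplete beta integral is, up to the factor `m · (m-1 choose k)`, the
  -- binomial tail `P(N > k)`. Using the integral avoids binomial sums: the recursion is an
  -- integration by parts and the bound is pointwise.
  set I : ℕ → ℝ := fun k => ∫ t in (0 : ℝ)..p, t ^ k * (1 - t) ^ (m - k - 1) with hI
  set C : ℝ := q ^ m / (1 - q ^ m) * m / q with hC
  have hC0 : 0 < C := by positivity
  have hd1 : ∀ (k : ℕ) (t : ℝ), HasDerivAt (fun t : ℝ => (1 - t) ^ k)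
      (-(k * (1 - t) ^ (k - 1))) t := fun k t => by
    exact (((hasDerivAt_id t).const_sub 1).fun_pow k).congr_deriv (by simp)
  have hI0 : I 0 = (1 - q ^ m) / m := by
    have h := intervalIntegral.integral_eq_sub_of_hasDerivAt (a := 0) (b := p)
      (f := fun t : ℝ => -((1 - t) ^ m) / m) (f' := fun t : ℝ => (1 - t) ^ (m - 1))
      (fun t _ => by
        refine ((hd1 m t).neg.div_const (m : ℝ)).congr_deriv ?_
        field_simp)
      (by apply Continuous.intervalIntegrable; fun_prop)
    simp only [hI, pow_zero, one_mul, Nat.sub_zero, h]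
    rw [← hq]; simp; ring
  have hrec : ∀ k < m, ((k : ℝ) + 1) * I k - (m - (k + 1 : ℝ)) * I (k + 1) =
      p ^ (k + 1) * q ^ (m - (k + 1)) := by
    intro k hk
    have hcast : ((m - (k + 1) : ℕ) : ℝ) = m - (k + 1 : ℝ) := by
      rw [Nat.cast_sub hk]; push_cast; ring
    have h := intervalIntegral.integral_eq_sub_of_hasDerivAt (a := 0) (b := p)
      (f := fun t : ℝ => t ^ (k + 1) * (1 - t) ^ (m - (k + 1)))
      (f' := fun t : ℝ => ((k : ℝ) + 1) * (t ^ k * (1 - t) ^ (m - k - 1)) -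
        (m - (k + 1 : ℝ)) * (t ^ (k + 1) * (1 - t) ^ (m - (k + 1) - 1)))
      (fun t _ => by
        refine ((hasDerivAt_pow (k + 1) t).mul (hd1 (m - (k + 1)) t)).congr_deriv ?_
        rw [hcast, Nat.add_sub_cancel, Nat.sub_sub m k 1]
        push_cast; ring)
      (by apply Continuous.intervalIntegrable; fun_prop)
    rw [intervalIntegral.integral_sub (by apply Continuous.intervalIntegrable; fun_prop)
      (by apply Continuous.intervalIntegrable; fun_prop), intervalIntegral.integral_const_mul,
      intervalIntegral.integral_const_mul] at h
    simpa [hI, ← hq] using h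
  -- On `[0, p]` one has `t ≤ p` and `q ≤ 1 - t`, which compares the integrands. This says `α k ≤ α
  -- 0`, and `C` is normalised so that `α 0 = 1`.
  have hIle : ∀ k, q ^ (m - 1) * I k ≤ p ^ k * q ^ (m - k - 1) * I 0 := by
    intro k
    simp only [hI, ← intervalIntegral.integral_const_mul]
    refine intervalIntegral.integral_mono_on hp0.le
      (by apply Continuous.intervalIntegrable; fun_prop)
      (by apply Continuous.intervalIntegrable; fun_prop) fun t ht => ?_
    set j := m - k - 1 with hj
    obtain ⟨i, hi⟩ : ∃ i, m - 1 = j + i := Nat.exists_eq_add_of_le (by omega)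
    have h1 : t ^ k ≤ p ^ k := pow_le_pow_left₀ ht.1 ht.2 k
    have ht1 : 0 < 1 - t := by linarith [ht.2]
    have h2 : q ^ i ≤ (1 - t) ^ i := pow_le_pow_left₀ hq0.le (by linarith [ht.2]) i
    have e : m - 0 - 1 = j + i := by omega
    rw [hi, e, pow_add, pow_add, pow_zero, one_mul]
    have h3 : t ^ k * q ^ i ≤ p ^ k * (1 - t) ^ i :=
      mul_le_mul h1 h2 (by positivity) (by positivity)
    calc q ^ j * q ^ i * (t ^ k * (1 - t) ^ j) = (q ^ j * (1 - t) ^ j) * (t ^ k * q ^ i) := by ring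
      _ ≤ (q ^ j * (1 - t) ^ j) * (p ^ k * (1 - t) ^ i) := by gcongr
      _ = _ := by ring
  have hInn : ∀ k, 0 ≤ I k := fun k => intervalIntegral.integral_nonneg hp0.le fun t ht =>
    mul_nonneg (pow_nonneg ht.1 _) (pow_nonneg (by linarith [ht.2]) _)
  have hqq : q ^ m = q * q ^ (m - 1) := by
    rw [← pow_succ']; congr 1; omega
  refine ⟨fun k => C * (I k / (p ^ k * q ^ (m - k - 1))), fun k => ?_, fun k => ?_, ?_, ?_⟩
  · have := hInn k
    positivity
  · have h1 : I k / (p ^ k * q ^ (m - k - 1)) ≤ I 0 / q ^ (m - 1) := by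
      rw [div_le_div_iff₀ (by positivity) (by positivity)]
      linarith [hIle k]
    refine (mul_le_mul_of_nonneg_left h1 hC0.le).trans (le_of_eq ?_)
    rw [hI0, hC, hqq]
    rw [hqq] at hτ
    field_simp
  · simp only [hI0, hC, Nat.sub_zero, pow_zero, one_mul]
    rw [hqq]
    rw [hqq] at hτ
    field_simp
  · intro k hk
    have h := hrec k hk
    have e1 : m - k - 1 = m - (k + 1) := by omega
    have e2 : (1 - q ^ m)⁻¹ - 1 = q ^ m / (1 - q ^ m) := by field_simp; ring
    have key : ((k : ℝ) + 1) * (C * (I k / (p ^ k * q ^ (m - k - 1)))) * q = m * p *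
        ((1 - q ^ m)⁻¹ - 1) + (m - (k + 1)) * p *
          (C * (I (k + 1) / (p ^ (k + 1) * q ^ (m - (k + 1) - 1)))) := by
      rw [e1, e2]
      have hIk : ((k : ℝ) + 1) * I k = p ^ (k + 1) * q ^ (m - (k + 1)) +
        (m - (k + 1 : ℝ)) * I (k + 1) := by linarith
      have l1 : ((k : ℝ) + 1) * (C * (I k / (p ^ k * q ^ (m - (k + 1))))) * q =
          C * q / (p ^ k * q ^ (m - (k + 1))) * (((k : ℝ) + 1) * I k) := by ring
      rw [l1, hIk]
      rcases Nat.lt_or_ge (k + 1) m with hlt | hge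
      · have e3 : q ^ (m - (k + 1)) = q * q ^ (m - (k + 1) - 1) := by
          rw [← pow_succ']; congr 1; omega
        rw [e3, hC]
        field_simp
        ring
      -- At `k + 1 = m` the subtraction in the exponent of `I m` truncates to `0`; this is harmless
      -- because the coefficient `m - (k + 1)` vanishes.
      · have e4 : (m : ℝ) = k + 1 := by exact_mod_cast (by omega : m = k + 1)
        have e5 : m - (k + 1) = 0 := by omega
        rw [e5, hC, ← e4]
        simp only [sub_self, zero_mul, pow_zero, mul_one, add_zero]
        field_simp
        rw [pow_succ]
    linear_combination key

end ResamplingProbabilities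

end IsolatedPoints

namespace IsolatedPoints

/-! ### Isolated points under insertion, deletion and moves -/

section Counting

set_option linter.unusedSectionVars false

open Classical in
/-- The configuration `u` has no point with index in `s` adjacent to `u l`, other than `u l`. -/
def IsolatedIn {ι E : Type*} (c : E → E → Prop) (s : Finset ι) (u : ι → E) (l : ι) : Prop :=
  ∀ b ∈ s, b ≠ l → ¬c (u l) (u b)

open Classical in
/-- The number of isolated points among those with index in `s`. -/
noncomputable def countIso {ι E : Type*} (c : E → E → Prop) (s : Finset ι) (u : ι → E) : ℝ :=
  ∑ l ∈ s, if IsolatedIn c s u l then 1 else 0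

open Classical in
/-- The number of neighbours of `u l` with index in `s`. -/
noncomputable def nbrs {ι E : Type*} (c : E → E → Prop) (s : Finset ι) (u : ι → E) (l : ι) : ℕ :=
  (s.filter fun b => b ≠ l ∧ c (u l) (u b)).card

open Classical in
/-- The change of `countIso` caused by the point with index `k`. -/
noncomputable def gain {ι E : Type*} (c : E → E → Prop) (s : Finset ι) (u : ι → E) (k : ι) : ℝ :=
  countIso c s u - countIso c (s.erase k) u

variable {ι E : Type*} {c : E → E → Prop} {s : Finset ι} {u w : ι → E} {i j k l : ι}

open Classical

lemma isolatedIn_congr (h : ∀ b ∈ s, u b = w b) (hl : l ∈ s) :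
    IsolatedIn c s u l ↔ IsolatedIn c s w l := by
  unfold IsolatedIn
  refine forall₂_congr fun b hb => ?_
  rw [h b hb, h l hl]

lemma countIso_congr (h : ∀ b ∈ s, u b = w b) : countIso c s u = countIso c s w :=
  Finset.sum_congr rfl fun l hl => by simp only [isolatedIn_congr h hl]

lemma countIso_erase_update (s : Finset ι) (u : ι → E) (j : ι) (v : E) :
    countIso c (s.erase j) (Function.update u j v) = countIso c (s.erase j) u :=
  countIso_congr fun b hb => by rw [Function.update_of_ne (Finset.ne_of_mem_erase hb)]

lemma nbrs_erase_update (s : Finset ι) (u : ι → E) (j : ι) (v : E) (hl : l ≠ j) :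
    nbrs c (s.erase j) (Function.update u j v) l = nbrs c (s.erase j) u l := by
  unfold nbrs
  congr 1
  refine Finset.filter_congr fun b hb => ?_
  rw [Function.update_of_ne (Finset.ne_of_mem_erase hb), Function.update_of_ne hl]

lemma isolatedIn_iff_erase (hk : k ∈ s) (hl : l ≠ k) :
    IsolatedIn c s u l ↔ IsolatedIn c (s.erase k) u l ∧ ¬c (u l) (u k) := by
  constructor
  · exact fun h => ⟨fun b hb => h b (Finset.mem_of_mem_erase hb), h k hk hl.symm⟩
  · rintro ⟨h1, h2⟩ b hb hbl
    by_cases hbk : b = k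
    · rwa [hbk]
    · exact h1 b (Finset.mem_erase.mpr ⟨hbk, hb⟩) hbl

/-- Inserting a point adds that point if it is isolated, and destroys the isolation of exactly those
of its neighbours that were isolated without it. -/
lemma gain_eq (hk : k ∈ s) :
    gain c s u k = (if IsolatedIn c s u k then 1 else 0) -
      ∑ l ∈ s.erase k, if c (u l) (u k) ∧ IsolatedIn c (s.erase k) u l then 1 else 0 := by
  unfold gain countIso
  rw [← Finset.add_sum_erase s _ hk, add_sub_assoc, ← Finset.sum_sub_distrib, sub_eq_add_neg,
    ← Finset.sum_neg_distrib]
  congr 1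
  refine Finset.sum_congr rfl fun l hl => ?_
  rw [isolatedIn_iff_erase hk (Finset.ne_of_mem_erase hl)]
  by_cases h1 : IsolatedIn c (s.erase k) u l <;> by_cases h2 : c (u l) (u k) <;> simp [h1, h2]

/-- At most `κ` pairwise non-adjacent points of a configuration are adjacent to any given point. -/
def PackingBound (ι : Type*) {E : Type*} (c : E → E → Prop) (κ : ℕ) : Prop :=
  ∀ (x : E) (F : Finset ι) (u : ι → E), (∀ l ∈ F, c (u l) x) →
    (∀ l ∈ F, ∀ l' ∈ F, l ≠ l' → ¬c (u l) (u l')) → F.card ≤ κ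

variable {κ : ℕ}

/-- Isolated points are pairwise non-adjacent, so those adjacent to `x` form a packing. -/
lemma sum_isolated_nbrs_le (hpack : PackingBound ι c κ) (s : Finset ι) (u : ι → E) (x : E) :
    (∑ l ∈ s, if c (u l) x ∧ IsolatedIn c s u l then (1 : ℝ) else 0) ≤ κ := by
  rw [Finset.sum_boole]
  have h := hpack x (s.filter fun l => c (u l) x ∧ IsolatedIn c s u l) u
    (fun l hl => (Finset.mem_filter.mp hl).2.1)
    fun l hl l' hl' hne => (Finset.mem_filter.mp hl).2.2 l' (Finset.mem_filter.mp hl').1 hne.symm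
  exact_mod_cast h

lemma gain_le_one (hk : k ∈ s) : gain c s u k ≤ 1 := by
  rw [gain_eq hk]
  have h : 0 ≤ ∑ l ∈ s.erase k,
      if c (u l) (u k) ∧ IsolatedIn c (s.erase k) u l then (1 : ℝ) else 0 :=
    Finset.sum_nonneg fun _ _ => by split_ifs <;> norm_num
  split_ifs <;> linarith

lemma neg_le_gain (hpack : PackingBound ι c κ) (hk : k ∈ s) : -(κ : ℝ) ≤ gain c s u k := by
  rw [gain_eq hk]
  have h := sum_isolated_nbrs_le hpack (s.erase k) u (u k)
  split_ifs <;> linarith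

lemma gain_le_zero (hk : k ∈ s) (hi : i ∈ s) (hik : i ≠ k) (hc : c (u k) (u i)) :
    gain c s u k ≤ 0 := by
  rw [gain_eq hk, if_neg fun h => h i hi hik hc]
  have h : 0 ≤ ∑ l ∈ s.erase k,
      if c (u l) (u k) ∧ IsolatedIn c (s.erase k) u l then (1 : ℝ) else 0 :=
    Finset.sum_nonneg fun _ _ => by split_ifs <;> norm_num
  linarith

lemma countIso_update_sub (s : Finset ι) (u : ι → E) (j : ι) (v : E) :
    countIso c s (Function.update u j v) - countIso c s u =
      gain c s (Function.update u j v) j - gain c s u j := by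
  unfold gain
  rw [countIso_erase_update]; ring

/-- A point dropped into the ball of `u i` is not isolated, so its insertion cannot increase the
count; the deletion from the old place frees at most `κ` points. -/
lemma countIso_update_sub_le (hsymm : ∀ x y, c x y → c y x) (hpack : PackingBound ι c κ)
    (hi : i ∈ s) (hj : j ∈ s) (hij : i ≠ j) {v : E} (hv : c (u i) v) :
    countIso c s (Function.update u j v) - countIso c s u ≤ κ := by
  rw [countIso_update_sub]
  have h1 := gain_le_zero (c := c) (u := Function.update u j v) hj hi hij
    (by simpa [hij] using hsymm _ _ hv)
  have h2 := neg_le_gain (u := u) hpack hj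
  linarith

lemma neg_le_countIso_update_sub (hpack : PackingBound ι c κ) (hj : j ∈ s) (v : E) :
    -((κ : ℝ) + 1) ≤ countIso c s (Function.update u j v) - countIso c s u := by
  rw [countIso_update_sub]
  have h1 := neg_le_gain (u := Function.update u j v) hpack hj
  have h2 := gain_le_one (c := c) (u := u) hj
  linarith

section Far

variable [Fintype ι]

/-- The indicator that removing the point with index `j` can change the effect on the point with
index `l` of the point with index `k`. -/
noncomputable def pivot (c : E → E → Prop) (u : ι → E) (k l j : ι) : ℝ :=
  if c (u l) (u k) ∧ (l ≠ j → c (u l) (u j)) ∧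
    ∀ b, b ≠ l → b ≠ k → b ≠ j → ¬c (u l) (u b) then 1 else 0

/-- For fixed neighbours `k` and `l` the pivotal index is determined: it is the only neighbour of
`l` besides `k`, or `l` itself if there is none. -/
lemma sum_pivot_le (k l : ι) :
    ∑ j ∈ Finset.univ.erase k, pivot c u k l j ≤ if c (u l) (u k) then 1 else 0 := by
  by_cases hc : c (u l) (u k)
  · rw [if_pos hc]
    unfold pivot
    rw [Finset.sum_boole]
    have : (Finset.filter (fun j => c (u l) (u k) ∧ (l ≠ j → c (u l) (u j)) ∧
        ∀ b, b ≠ l → b ≠ k → b ≠ j → ¬c (u l) (u b)) (Finset.univ.erase k)).card ≤ 1 := by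
      rw [Finset.card_le_one]
      intro a ha b hb
      simp only [Finset.mem_filter, Finset.mem_erase] at ha hb
      by_contra hab
      obtain ⟨⟨hak, _⟩, _, ha1, ha2⟩ := ha
      obtain ⟨⟨hbk, _⟩, _, hb1, hb2⟩ := hb
      by_cases hal : a = l
      · subst hal
        exact ha2 b (Ne.symm hab) hbk (Ne.symm hab) (hb1 hab)
      · exact hb2 a hal hak hab (ha1 (Ne.symm hal))
    exact_mod_cast this
  · simp [pivot, hc]

/-- The new position `v` is invisible to `k` and to every point adjacent to `k`, so only the
disappearance of `u j` matters. It can alter the isolation of `k` if `u j` is adjacent to it, and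
the loss at a neighbour `l` of `k` only if `j` is pivotal for `l`. -/
lemma abs_gain_update_sub_le (hsymm : ∀ x y, c x y → c y x) (hjk : j ≠ k) {v : E}
    (h1 : ¬c v (u k)) (h2 : ∀ x, c x (u k) → ¬c x v) :
    |gain c Finset.univ (Function.update u j v) k - gain c Finset.univ u k| ≤
      (if c (u j) (u k) then 1 else 0) + ∑ l ∈ Finset.univ.erase k, pivot c u k l j := by
  set u' := Function.update u j v with hu'
  have hk' : u' k = u k := by simp [hu', hjk.symm]
  have hj' : u' j = v := by simp [hu']
  have ho : ∀ b, b ≠ j → u' b = u b := fun b hb => by simp [hu', hb]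
  rw [gain_eq (Finset.mem_univ k), gain_eq (Finset.mem_univ k), sub_sub_sub_comm,
    ← Finset.sum_sub_distrib]
  refine (abs_sub _ _).trans (add_le_add ?_ ((Finset.abs_sum_le_sum_abs _ _).trans
    (Finset.sum_le_sum fun l hl => ?_)))
  · by_cases hc : c (u j) (u k)
    · rw [if_pos hc]
      split_ifs <;> norm_num
    · have : IsolatedIn c Finset.univ u' k ↔ IsolatedIn c Finset.univ u k := by
        refine forall₂_congr fun b _ => ?_
        rw [hk']
        by_cases hb : b = j
        · subst hb
          rw [hj']
          exact ⟨fun _ _ h => hc (hsymm _ _ h), fun _ _ h => h1 (hsymm _ _ h)⟩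
        · rw [ho b hb]
      simp [this, hc]
  · have hlk := Finset.ne_of_mem_erase hl
    by_cases hlj : l = j
    · subst hlj
      rw [hj', hk', if_neg (fun h => h1 h.1), zero_sub, abs_neg]
      unfold pivot
      by_cases h : c (u l) (u k) ∧ IsolatedIn c (Finset.univ.erase k) u l
      · rw [if_pos h, if_pos]
        · simp
        · exact ⟨h.1, fun h => absurd rfl h,
            fun b hb1 hb2 _ => h.2 b (by simp [hb2]) hb1⟩
      · rw [if_neg h, abs_zero]; split_ifs <;> norm_num
    · rw [ho l hlj, hk']
      by_cases hc : c (u l) (u k)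
      · have e1 : IsolatedIn c (Finset.univ.erase k) u' l ↔
            ∀ b, b ≠ l → b ≠ k → b ≠ j → ¬c (u l) (u b) := by
          constructor
          · intro h b hb1 hb2 hb3
            have := h b (by simp [hb2]) hb1
            rwa [ho l hlj, ho b hb3] at this
          · intro h b hb hbl
            rw [ho l hlj]
            by_cases hbj : b = j
            · subst hbj; rw [hj']; exact h2 _ hc
            · rw [ho b hbj]; exact h b hbl (Finset.ne_of_mem_erase hb) hbj
        have e2 : IsolatedIn c (Finset.univ.erase k) u l ↔
            (∀ b, b ≠ l → b ≠ k → b ≠ j → ¬c (u l) (u b)) ∧ ¬c (u l) (u j) := by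
          constructor
          · exact fun h => ⟨fun b hb1 hb2 _ => h b (by simp [hb2]) hb1,
              h j (by simp [hjk]) (Ne.symm hlj)⟩
          · rintro ⟨ha, hb⟩ b hb' hbl
            by_cases hbj : b = j
            · rwa [hbj]
            · exact ha b hbl (Finset.ne_of_mem_erase hb') hbj
        rw [e1, e2]
        unfold pivot
        split_ifs <;> first | (norm_num; done) | (exfalso; tauto)
      · simp only [hc, false_and, if_false, sub_self, abs_zero]
        unfold pivot
        split_ifs <;> norm_num

end Far

end Counting

end IsolatedPoints

namespace IsolatedPoints

/-! ### The move, its effect, and sensitivity to deleting a point -/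

section Coupling

set_option linter.unusedSectionVars false

open Classical

/-- The properties of the relation `c` ("within distance `ρ`") and the law `γ` of a single point
used in the normal approximation. -/
structure ProximityModel (ι : Type*) {E : Type*} [MeasurableSpace E] (c near : E → E → Prop)
    (γ : Measure E) (p p' : ℝ) (κ : ℕ) : Prop where
  symm : ∀ x y, c x y → c y x
  refl : ∀ x, c x x
  meas_c : MeasurableSet {q : E × E | c q.1 q.2}
  meas_near : MeasurableSet {q : E × E | near q.1 q.2}
  prob : ∀ x, γ.real {v | c x v} = p
  p_pos : 0 < p
  p_lt_one : p < 1
  near_prob : ∀ x, γ.real {y | near y x} ≤ p'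
  chain : ∀ x v y z, c x v → c v y → c y z → near x z
  pack : PackingBound ι c κ

variable {ι E : Type*} [Fintype ι] [MeasurableSpace E] {c near : E → E → Prop}
  {γ : Measure E} [IsProbabilityMeasure γ] {p p' : ℝ} {κ : ℕ}

lemma BddMeas.comp_continuous {X : Type*} [MeasurableSpace X] {G : X → ℝ} (hG : BddMeas G)
    {f : ℝ → ℝ} (hf : Continuous f) : BddMeas fun x => f (G x) := by
  obtain ⟨C, hC⟩ := hG.bdd
  obtain ⟨D, hD⟩ := (isCompact_Icc (a := -C) (b := C)).exists_bound_of_continuousOn hf.continuousOn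
  exact ⟨hf.measurable.comp hG.meas, D, fun x => hD _ (abs_le.mp (hC x))⟩

lemma BddMeas.ite {X : Type*} [MeasurableSpace X] {q : X → Prop} (hq : MeasurableSet {x | q x})
    (a b : ℝ) : BddMeas fun x => if q x then a else b := by
  refine ⟨Measurable.ite hq measurable_const measurable_const, max |a| |b|, fun x => ?_⟩
  split_ifs <;> simp

/-- The average over a uniform point `v` of the ball around `u i` of the change of
`F (countIso c s)` when `u j` is moved to `v`, weighted by `α` of the number of neighbours of
`u i`. -/
noncomputable def moveEffect (c : E → E → Prop) (γ : Measure E) (p : ℝ) (α : ℕ → ℝ) (s : Finset ι)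
    (F : ℝ → ℝ) (u : ι → E) (i j : ι) : ℝ :=
  α (nbrs c s u i) * ∫ v, (if c (u i) v then p⁻¹ else 0) *
    (F (countIso c s (Function.update u j v)) - F (countIso c s u)) ∂γ

/-- The sum of `moveEffect` over all pairs of distinct indices. -/
noncomputable def totalEffect (c : E → E → Prop) (γ : Measure E) (p : ℝ) (α : ℕ → ℝ)
    (s : Finset ι) (F : ℝ → ℝ) (u : ι → E) : ℝ :=
  ∑ i ∈ s, ∑ j ∈ s.erase i, moveEffect c γ p α s F u i j

namespace ProximityModel

variable (M : ProximityModel ι c near γ p p' κ)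
include M

lemma measurableSet_pair (i j : ι) : MeasurableSet {u : ι → E | c (u i) (u j)} :=
  M.meas_c.preimage (f := fun u : ι → E => (u i, u j)) (by fun_prop)

lemma measurableSet_isolatedIn (s : Finset ι) (l : ι) :
    MeasurableSet {u : ι → E | IsolatedIn c s u l} := by
  have : {u : ι → E | IsolatedIn c s u l} = ⋂ b ∈ s, ⋂ (_ : b ≠ l), {u | c (u l) (u b)}ᶜ := by
    ext u; simp [IsolatedIn]
  rw [this]
  exact Finset.measurableSet_biInter _ fun b _ => MeasurableSet.iInter fun _ =>
    (M.measurableSet_pair l b).compl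

lemma bddMeas_countIso (s : Finset ι) : BddMeas fun u : ι → E => countIso c s u :=
  BddMeas.sum s fun l _ => BddMeas.ite (M.measurableSet_isolatedIn s l) 1 0

lemma bddMeas_weight (i : ι) (a : ℝ) :
    BddMeas fun q : (ι → E) × E => if c (q.1 i) q.2 then a else 0 :=
  BddMeas.ite (M.meas_c.preimage (f := fun q : (ι → E) × E => (q.1 i, q.2)) (by fun_prop)) a 0

lemma bddMeas_nbrs {α : ℕ → ℝ} (h0 : ∀ k, 0 ≤ α k) (h1 : ∀ k, α k ≤ 1) (s : Finset ι) (i : ι) :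
    BddMeas fun u : ι → E => α (nbrs c s u i) := by
  refine ⟨?_, 1, fun u => by rw [abs_of_nonneg (h0 _)]; exact h1 _⟩
  have : Measurable fun u : ι → E => nbrs c s u i := by
    simp only [nbrs, Finset.card_filter]
    refine Finset.measurable_sum _ fun b _ => Measurable.ite ?_ measurable_const measurable_const
    by_cases hb : b = i
    · simp [hb]
    · simpa [hb] using M.measurableSet_pair i b
  exact (measurable_of_countable α).comp this

lemma bddMeas_integrand {F : ℝ → ℝ} (hF : Continuous F) (s : Finset ι) (i j : ι) :
    BddMeas fun q : (ι → E) × E => (if c (q.1 i) q.2 then p⁻¹ else 0) *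
      (F (countIso c s (Function.update q.1 j q.2)) - F (countIso c s q.1)) := by
  have h := (M.bddMeas_countIso s).comp_continuous hF
  exact (M.bddMeas_weight i _).mul
    ((h.comp (measurable_update_prod j)).sub (h.comp measurable_fst))

lemma bddMeas_moveEffect {α : ℕ → ℝ} (h0 : ∀ k, 0 ≤ α k) (h1 : ∀ k, α k ≤ 1) {F : ℝ → ℝ}
    (hF : Continuous F) (s : Finset ι) (i j : ι) :
    BddMeas fun u : ι → E => moveEffect c γ p α s F u i j :=
  (M.bddMeas_nbrs h0 h1 s i).mul ((M.bddMeas_integrand hF s i j).integral_right γ)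

lemma bddMeas_totalEffect {α : ℕ → ℝ} (h0 : ∀ k, 0 ≤ α k) (h1 : ∀ k, α k ≤ 1) {F : ℝ → ℝ}
    (hF : Continuous F) (s : Finset ι) : BddMeas fun u : ι → E => totalEffect c γ p α s F u :=
  BddMeas.sum s fun i _ => BddMeas.sum _ fun j _ => M.bddMeas_moveEffect h0 h1 hF s i j

lemma measurableSet_ball (x : E) : MeasurableSet {v | c x v} :=
  M.meas_c.preimage (f := fun v => (x, v)) (by fun_prop)

lemma integral_weight (x : E) : ∫ v, (if c x v then p⁻¹ else 0) ∂γ = 1 := by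
  have : (fun v => if c x v then p⁻¹ else 0) = Set.indicator {v | c x v} fun _ => p⁻¹ := by
    ext v; simp [Set.indicator]
  rw [this, integral_indicator (M.measurableSet_ball x), setIntegral_const, M.prob, smul_eq_mul,
    mul_inv_cancel₀ M.p_pos.ne']

lemma average_mem {x : E} {G : E → ℝ} (hG : BddMeas G) {a b : ℝ}
    (h : ∀ v, c x v → a ≤ G v ∧ G v ≤ b) :
    a ≤ ∫ v, (if c x v then p⁻¹ else 0) * G v ∂γ ∧
      ∫ v, (if c x v then p⁻¹ else 0) * G v ∂γ ≤ b := by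
  have hw : BddMeas fun v => if c x v then p⁻¹ else 0 := BddMeas.ite (M.measurableSet_ball x) _ _
  have hp := inv_pos.mpr M.p_pos
  have e : ∀ r : ℝ, ∫ v, (if c x v then p⁻¹ else 0) * r ∂γ = r := fun r => by
    rw [integral_mul_const, M.integral_weight, one_mul]
  constructor
  · conv_lhs => rw [← e a]
    refine integral_mono ((hw.mul (BddMeas.const a)).integrable γ) ((hw.mul hG).integrable γ)
      fun v => ?_
    simp only
    split_ifs with hv
    · exact mul_le_mul_of_nonneg_left (h v hv).1 hp.le
    · simp
  · conv_rhs => rw [← e b]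
    refine integral_mono ((hw.mul hG).integrable γ) ((hw.mul (BddMeas.const b)).integrable γ)
      fun v => ?_
    simp only
    split_ifs with hv
    · exact mul_le_mul_of_nonneg_left (h v hv).2 hp.le
    · simp

lemma bddMeas_section {F : ℝ → ℝ} (hF : Continuous F) (s : Finset ι) (u : ι → E) (j : ι) :
    BddMeas fun v => F (countIso c s (Function.update u j v)) - F (countIso c s u) :=
  (((M.bddMeas_countIso s).comp_continuous hF).comp
    ((measurable_update_prod j).comp (measurable_const.prodMk measurable_id))).sub
    (BddMeas.const _)

/-- The total influence of the removal of one point on the effect of the point with index `k`. -/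
lemma sum_removal_le (u : ι → E) (k : ι) :
    ∑ j ∈ Finset.univ.erase k, ((if c (u j) (u k) then (1 : ℝ) else 0) +
      ∑ l ∈ Finset.univ.erase k, pivot c u k l j) ≤
      2 * ∑ i ∈ Finset.univ.erase k, if near (u i) (u k) then (1 : ℝ) else 0 := by
  rw [Finset.sum_add_distrib, Finset.sum_comm, two_mul]
  have hle : ∀ i, (if c (u i) (u k) then (1 : ℝ) else 0) ≤ if near (u i) (u k) then 1 else 0 := by
    intro i
    by_cases h : c (u i) (u k)
    · rw [if_pos h, if_pos (M.chain _ _ _ _ h (M.refl _) (M.refl _))]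
    · rw [if_neg h]; split_ifs <;> norm_num
  exact add_le_add (Finset.sum_le_sum fun i _ => hle i)
    (Finset.sum_le_sum fun l _ => (sum_pivot_le k l).trans (hle l))

variable {α : ℕ → ℝ} (h0 : ∀ k, 0 ≤ α k) (h1 : ∀ k, α k ≤ 1)
include h0 h1

/-- The signs of `a` and `b` are needed because the factor `α ∈ [0, 1]` shrinks the average towards
zero. -/
lemma moveEffect_mem {F : ℝ → ℝ} (hF : Continuous F) {s : Finset ι} {u : ι → E} {i j : ι}
    {a b : ℝ} (ha : a ≤ 0) (hb : 0 ≤ b)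
    (h : ∀ v, c (u i) v → a ≤ F (countIso c s (Function.update u j v)) - F (countIso c s u) ∧
      F (countIso c s (Function.update u j v)) - F (countIso c s u) ≤ b) :
    a ≤ moveEffect c γ p α s F u i j ∧ moveEffect c γ p α s F u i j ≤ b := by
  obtain ⟨h2, h3⟩ := M.average_mem (M.bddMeas_section hF s u j) h
  have := h0 (nbrs c s u i)
  have := h1 (nbrs c s u i)
  unfold moveEffect
  constructor
  · nlinarith
  · nlinarith

lemma moveEffect_id_mem {s : Finset ι} (u : ι → E) {i j : ι} (hi : i ∈ s) (hj : j ∈ s)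
    (hij : i ≠ j) : -((κ : ℝ) + 1) ≤ moveEffect c γ p α s id u i j ∧
      moveEffect c γ p α s id u i j ≤ κ :=
  M.moveEffect_mem h0 h1 continuous_id (by linarith [Nat.cast_nonneg (α := ℝ) κ])
    (Nat.cast_nonneg _) fun v hv => ⟨neg_le_countIso_update_sub M.pack hj v,
      countIso_update_sub_le M.symm M.pack hi hj hij hv⟩

lemma abs_moveEffect_id_le {s : Finset ι} (u : ι → E) {i j : ι} (hi : i ∈ s) (hj : j ∈ s)
    (hij : i ≠ j) : |moveEffect c γ p α s id u i j| ≤ κ + 1 := by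
  have := M.moveEffect_id_mem h0 h1 u hi hj hij
  rw [abs_le]
  constructor <;> linarith

/-- The difference is an averaged mixed second difference of the count: the change, caused by moving
`j`, in the gain of `k`. If `i` is far from `k`, deleting `k` does not alter the neighbour count of
`i`, and `v`, being adjacent to `u i`, has no common neighbour with `u k`. -/
lemma abs_moveEffect_sub_far_le (u : ι → E) {i j k : ι} (hjk : j ≠ k)
    (hfar : ¬near (u i) (u k)) :
    |moveEffect c γ p α Finset.univ id u i j -
      moveEffect c γ p α (Finset.univ.erase k) id u i j| ≤
      (if c (u j) (u k) then 1 else 0) + ∑ l ∈ Finset.univ.erase k, pivot c u k l j := by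
  set B := (if c (u j) (u k) then (1 : ℝ) else 0) +
    ∑ l ∈ Finset.univ.erase k, pivot c u k l j with hB
  have hB0 : 0 ≤ B := by
    refine add_nonneg (by split_ifs <;> norm_num) (Finset.sum_nonneg fun l _ => ?_)
    unfold pivot; split_ifs <;> norm_num
  have hn : nbrs c (Finset.univ.erase k) u i = nbrs c Finset.univ u i := by
    unfold nbrs
    congr 1
    ext b
    simp only [Finset.mem_filter, Finset.mem_erase, Finset.mem_univ, and_true, true_and]
    refine ⟨fun h => h.2, fun h => ⟨?_, h⟩⟩
    rintro rfl
    exact hfar (M.chain _ _ _ _ h.2 (M.refl _) (M.refl _))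
  have hgain : ∀ v, c (u i) v → -B ≤
      ((id (countIso c Finset.univ (Function.update u j v)) - id (countIso c Finset.univ u)) -
        (id (countIso c (Finset.univ.erase k) (Function.update u j v)) -
          id (countIso c (Finset.univ.erase k) u))) ∧
      ((id (countIso c Finset.univ (Function.update u j v)) - id (countIso c Finset.univ u)) -
        (id (countIso c (Finset.univ.erase k) (Function.update u j v)) -
          id (countIso c (Finset.univ.erase k) u))) ≤ B := by
    intro v hv
    have := abs_gain_update_sub_le (c := c) (u := u) M.symm hjk (v := v)
      (fun h => hfar (M.chain _ _ _ _ hv h (M.refl _)))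
      (fun x hx hxv => hfar (M.chain _ _ _ _ hv (M.symm _ _ hxv) hx))
    rw [← hB, abs_le] at this
    unfold gain at this
    simp only [id]
    constructor <;> linarith [this.1, this.2]
  have hs1 := M.bddMeas_section continuous_id Finset.univ u j
  have hs2 := M.bddMeas_section continuous_id (Finset.univ.erase k) u j
  have hav := M.average_mem (hs1.sub hs2) hgain
  have hw : BddMeas fun v => if c (u i) v then p⁻¹ else 0 :=
    BddMeas.ite (M.measurableSet_ball (u i)) _ _
  simp_rw [mul_sub (if c (u i) _ then p⁻¹ else 0) (id (countIso c Finset.univ _) - _)] at hav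
  rw [integral_sub ((hw.mul hs1).integrable γ) ((hw.mul hs2).integrable γ)] at hav
  unfold moveEffect
  rw [hn, ← mul_sub, abs_mul, abs_of_nonneg (h0 _)]
  exact (mul_le_of_le_one_left (abs_nonneg _) (h1 _)).trans (abs_le.mpr hav)

lemma abs_totalEffect_sub_le {m : ℕ} (hm : Fintype.card ι = m + 1) (u : ι → E) (k : ι) :
    |totalEffect c γ p α Finset.univ id u - totalEffect c γ p α (Finset.univ.erase k) id u| ≤
      m * (2 * (κ + 1) + (2 * κ + 3) *
        ∑ i ∈ Finset.univ.erase k, if near (u i) (u k) then (1 : ℝ) else 0) := by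
  set N : ℝ := ∑ i ∈ Finset.univ.erase k, if near (u i) (u k) then (1 : ℝ) else 0 with hN
  have hN0 : 0 ≤ N := Finset.sum_nonneg fun _ _ => by split_ifs <;> norm_num
  have hcard : ∀ i : ι, ((Finset.univ.erase i).card : ℝ) = m := fun i => by
    rw [Finset.card_erase_of_mem (Finset.mem_univ i), Finset.card_univ, hm, Nat.add_sub_cancel]
  set A := moveEffect c γ p α (Finset.univ : Finset ι) id u with hA
  set A' := moveEffect c γ p α (Finset.univ.erase k) id u with hA'
  have hrow : |∑ j ∈ Finset.univ.erase k, A k j| ≤ m * (κ + 1) := by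
    refine (Finset.abs_sum_le_sum_abs _ _).trans ?_
    rw [← hcard k, ← nsmul_eq_mul, ← Finset.sum_const]
    exact Finset.sum_le_sum fun j hj => M.abs_moveEffect_id_le h0 h1 u (Finset.mem_univ _)
      (Finset.mem_univ _) (Finset.ne_of_mem_erase hj).symm
  -- The column `j = k` costs `κ + 1`. For `i` near `k` each remaining entry costs at most `2κ + 1`,
  -- since both effects lie in `[-(κ + 1), κ]`. For `i` far from `k` the whole row costs at most
  -- `2N`, by `sum_removal_le`.
  have hoff : ∀ i ∈ Finset.univ.erase k,
      |∑ j ∈ Finset.univ.erase i, A i j - ∑ j ∈ (Finset.univ.erase k).erase i, A' i j| ≤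
        (κ + 1) + (m * (2 * κ + 1)) * (if near (u i) (u k) then (1 : ℝ) else 0) + 2 * N := by
    intro i hi
    have hik := Finset.ne_of_mem_erase hi
    have hk : k ∈ Finset.univ.erase i := by simp [hik.symm]
    rw [← Finset.add_sum_erase _ _ hk, Finset.erase_right_comm, add_sub_assoc,
      ← Finset.sum_sub_distrib, add_assoc]
    refine (abs_add_le _ _).trans (add_le_add (M.abs_moveEffect_id_le h0 h1 u (Finset.mem_univ _)
      (Finset.mem_univ _) hik) ((Finset.abs_sum_le_sum_abs _ _).trans ?_))
    by_cases hnear : near (u i) (u k)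
    · rw [if_pos hnear, mul_one]
      have h2 : ∑ j ∈ (Finset.univ.erase k).erase i, |A i j - A' i j| ≤
          ∑ j ∈ (Finset.univ.erase k).erase i, (2 * (κ : ℝ) + 1) := by
        refine Finset.sum_le_sum fun j hj => ?_
        have hj1 := Finset.ne_of_mem_erase hj
        have hj2 := Finset.mem_of_mem_erase hj
        have b1 := M.moveEffect_id_mem h0 h1 u (Finset.mem_univ i) (Finset.mem_univ j) hj1.symm
        have b2 := M.moveEffect_id_mem h0 h1 u hi hj2 hj1.symm
        rw [abs_le]
        constructor <;> linarith [b1.1, b1.2, b2.1, b2.2]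
      have h3 : ∑ j ∈ (Finset.univ.erase k).erase i, (2 * (κ : ℝ) + 1) ≤ m * (2 * κ + 1) := by
        rw [Finset.sum_const, nsmul_eq_mul, ← hcard k]
        refine mul_le_mul_of_nonneg_right ?_ (by positivity)
        exact_mod_cast Finset.card_le_card (Finset.erase_subset _ _)
      linarith
    · rw [if_neg hnear, mul_zero, zero_add]
      refine (Finset.sum_le_sum fun j hj => M.abs_moveEffect_sub_far_le h0 h1 u
        (Finset.ne_of_mem_erase (Finset.mem_of_mem_erase hj)) hnear).trans ?_
      refine (Finset.sum_le_sum_of_subset_of_nonneg (Finset.erase_subset _ _)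
        fun j _ _ => ?_).trans (M.sum_removal_le u k)
      refine add_nonneg (by split_ifs <;> norm_num) (Finset.sum_nonneg fun l _ => ?_)
      unfold pivot; split_ifs <;> norm_num
  unfold totalEffect
  rw [← Finset.add_sum_erase _ _ (Finset.mem_univ k), add_sub_assoc, ← Finset.sum_sub_distrib]
  refine (abs_add_le _ _).trans ((add_le_add hrow ((Finset.abs_sum_le_sum_abs _ _).trans
    (Finset.sum_le_sum hoff))).trans (le_of_eq ?_))
  rw [Finset.sum_add_distrib, Finset.sum_add_distrib, ← Finset.mul_sum, ← hN, Finset.sum_const,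
    Finset.sum_const, nsmul_eq_mul, nsmul_eq_mul, hcard]
  ring

end ProximityModel

end Coupling

end IsolatedPoints

namespace IsolatedPoints

/-! ### Variance of the total effect -/

section VarianceAndSizeBias

set_option linter.unusedSectionVars false

open Classical

variable {ι E : Type*} [Fintype ι] [MeasurableSpace E] {c near : E → E → Prop}
  {γ : Measure E} [IsProbabilityMeasure γ] {p p' : ℝ} {κ : ℕ}

namespace ProximityModel

variable (M : ProximityModel ι c near γ p p' κ)
include M

lemma bddMeas_near (i k : ι) :
    BddMeas fun u : ι → E => if near (u i) (u k) then (1 : ℝ) else 0 :=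
  BddMeas.ite (M.meas_near.preimage (f := fun u : ι → E => (u i, u k)) (by fun_prop)) _ _

lemma resample_near_le {i k : ι} (hik : i ≠ k) (u : ι → E) :
    resample γ i (fun u : ι → E => if near (u i) (u k) then (1 : ℝ) else 0) u ≤ p' := by
  have hm : MeasurableSet {y | near y (u k)} :=
    M.meas_near.preimage (f := fun y => (y, u k)) (by fun_prop)
  have : (fun v => if near v (u k) then (1 : ℝ) else 0) =
      Set.indicator {y | near y (u k)} fun _ => 1 := by
    ext v; simp [Set.indicator]
  simp only [resample, Function.update_self, Function.update_of_ne hik.symm, this]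
  rw [integral_indicator hm, setIntegral_const, smul_eq_mul, mul_one]
  exact M.near_prob _

lemma integral_near_le {i k : ι} (hik : i ≠ k) :
    ∫ u : ι → E, (if near (u i) (u k) then (1 : ℝ) else 0) ∂(Measure.pi fun _ => γ) ≤ p' := by
  rw [← integral_resample γ (M.bddMeas_near i k) i]
  refine (integral_mono (((M.bddMeas_near i k).resample γ i).integrable _) (integrable_const p')
    fun u => M.resample_near_le hik u).trans (by simp)

lemma integral_near_mul_le {i j k : ι} (hik : i ≠ k) (hjk : j ≠ k) (hij : i ≠ j) :
    ∫ u : ι → E, (if near (u i) (u k) then (1 : ℝ) else 0) *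
      (if near (u j) (u k) then (1 : ℝ) else 0) ∂(Measure.pi fun _ => γ) ≤ p' ^ 2 := by
  have hp' : 0 ≤ p' := by
    obtain ⟨x⟩ : Nonempty E := by
      by_contra h
      rw [not_nonempty_iff] at h
      have := measure_univ (μ := γ)
      simp [Set.eq_empty_of_isEmpty] at this
    exact measureReal_nonneg.trans (M.near_prob x)
  rw [← integral_mul_resample γ (M.bddMeas_near i k) (M.bddMeas_near j k) i fun u v => by
    simp [hik.symm, hij.symm]]
  have hi := ((M.bddMeas_near i k).resample γ i)
  have h1 := integral_mono (μ := Measure.pi fun _ : ι => γ)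
    ((hi.mul (M.bddMeas_near j k)).integrable _)
    (((BddMeas.const p').mul (M.bddMeas_near j k)).integrable _) fun u =>
      mul_le_mul_of_nonneg_right (M.resample_near_le hik u) (by split_ifs <;> norm_num)
  rw [integral_const_mul] at h1
  refine h1.trans ?_
  rw [pow_two]
  exact mul_le_mul_of_nonneg_left (M.integral_near_le hjk) hp'

lemma integral_sum_near_le {m : ℕ} (hm : Fintype.card ι = m + 1) (k : ι) :
    ∫ u : ι → E, (∑ i ∈ Finset.univ.erase k, if near (u i) (u k) then (1 : ℝ) else 0)
      ∂(Measure.pi fun _ => γ) ≤ m * p' := by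
  rw [integral_finsetSum _ fun i _ => (M.bddMeas_near i k).integrable _]
  refine (Finset.sum_le_sum fun i hi => M.integral_near_le (Finset.ne_of_mem_erase hi)).trans ?_
  rw [Finset.sum_const, Finset.card_erase_of_mem (Finset.mem_univ k), Finset.card_univ, hm,
    Nat.add_sub_cancel, nsmul_eq_mul]

/-- Diagonal terms contribute `m p'`. Off the diagonal, averaging over one point leaves a bound `p'`
uniform in the others, so each product has mean at most `p' ^ 2`. -/
lemma integral_sum_near_sq_le {m : ℕ} (hm : Fintype.card ι = m + 1) (k : ι) :
    ∫ u : ι → E, (∑ i ∈ Finset.univ.erase k, if near (u i) (u k) then (1 : ℝ) else 0) ^ 2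
      ∂(Measure.pi fun _ => γ) ≤ m * p' + (m * p') ^ 2 := by
  have hcard : ((Finset.univ.erase k).card : ℝ) = m := by
    rw [Finset.card_erase_of_mem (Finset.mem_univ k), Finset.card_univ, hm, Nat.add_sub_cancel]
  have hint : ∀ i j : ι, Integrable (fun u : ι → E => (if near (u i) (u k) then (1 : ℝ) else 0) *
      (if near (u j) (u k) then (1 : ℝ) else 0)) (Measure.pi fun _ => γ) := fun i j =>
    ((M.bddMeas_near i k).mul (M.bddMeas_near j k)).integrable _
  simp_rw [pow_two, Finset.sum_mul_sum]
  rw [integral_finsetSum _ fun i _ => integrable_finsetSum _ fun j _ => hint i j]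
  have h : ∀ i ∈ Finset.univ.erase k, ∫ u : ι → E, ∑ j ∈ Finset.univ.erase k,
      (if near (u i) (u k) then (1 : ℝ) else 0) * (if near (u j) (u k) then (1 : ℝ) else 0)
        ∂(Measure.pi fun _ => γ) ≤ p' + m * p' ^ 2 := by
    intro i hi
    rw [integral_finsetSum _ fun j _ => hint i j, ← Finset.add_sum_erase _ _ hi]
    refine add_le_add ?_ ?_
    · refine le_trans (le_of_eq ?_) (M.integral_near_le (Finset.ne_of_mem_erase hi))
      congr 1; ext u; split_ifs <;> norm_num
    · refine (Finset.sum_le_sum fun j hj => M.integral_near_mul_le (Finset.ne_of_mem_erase hi)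
        (Finset.ne_of_mem_erase (Finset.mem_of_mem_erase hj))
        (Finset.ne_of_mem_erase hj).symm).trans ?_
      rw [Finset.sum_const, nsmul_eq_mul, ← hcard]
      refine mul_le_mul_of_nonneg_right ?_ (sq_nonneg _)
      exact_mod_cast Finset.card_le_card (Finset.erase_subset _ _)
  refine (Finset.sum_le_sum h).trans (le_of_eq ?_)
  rw [Finset.sum_const, nsmul_eq_mul, hcard]
  ring

variable {α : ℕ → ℝ} (h0 : ∀ k, 0 ≤ α k) (h1 : ∀ k, α k ≤ 1)
include h0 h1

lemma totalEffect_variance_le {m : ℕ} (hm : Fintype.card ι = m + 1) {x : ℝ} (hx : m * p' ≤ x)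
    (hp' : 0 ≤ p') :
    ∫ u : ι → E, (totalEffect c γ p α Finset.univ id u -
      ∫ w : ι → E, totalEffect c γ p α Finset.univ id w ∂(Measure.pi fun _ => γ)) ^ 2
        ∂(Measure.pi fun _ => γ) ≤
      (m + 1) * m ^ 2 * ((2 * (κ + 1)) ^ 2 + 2 * (2 * (κ + 1)) * (2 * κ + 3) * x +
        (2 * κ + 3) ^ 2 * (x + x ^ 2)) := by
  have hT := M.bddMeas_totalEffect h0 h1 continuous_id (Finset.univ : Finset ι)
  refine (efron_stein γ (g := fun k u => totalEffect c γ p α (Finset.univ.erase k) id u) hT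
    (fun k => M.bddMeas_totalEffect h0 h1 continuous_id _) fun k u v => ?_).trans ?_
  -- The effect computed without index `k` never reads the coordinate `k`, so it is an admissible
  -- comparison function for `efron_stein`.
  · unfold totalEffect
    refine Finset.sum_congr rfl fun i hi => Finset.sum_congr rfl fun j hj => ?_
    have hik := Finset.ne_of_mem_erase hi
    have hjk := Finset.ne_of_mem_erase (Finset.mem_of_mem_erase hj)
    unfold moveEffect
    rw [nbrs_erase_update _ _ _ _ hik, countIso_erase_update, Function.update_of_ne hik]
    congr 2; ext w
    rw [Function.update_comm hjk.symm, countIso_erase_update]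
  · have hk : ∀ k : ι, ∫ u : ι → E, (totalEffect c γ p α Finset.univ id u -
        totalEffect c γ p α (Finset.univ.erase k) id u) ^ 2 ∂(Measure.pi fun _ => γ) ≤
        m ^ 2 * ((2 * (κ + 1)) ^ 2 + 2 * (2 * (κ + 1)) * (2 * κ + 3) * x +
        (2 * κ + 3) ^ 2 * (x + x ^ 2)) := by
      intro k
      have hN : BddMeas fun u : ι → E =>
          ∑ i ∈ Finset.univ.erase k, if near (u i) (u k) then (1 : ℝ) else 0 :=
        BddMeas.sum _ fun i _ => M.bddMeas_near i k
      have i1 := hN.integrable (Measure.pi fun _ => γ)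
      have i2 := hN.sq.integrable (Measure.pi fun _ => γ)
      have a1 := M.integral_sum_near_le hm k
      have a2 := M.integral_sum_near_sq_le hm k
      have hmp : 0 ≤ m * p' := by positivity
      have hle := integral_mono (μ := Measure.pi fun _ : ι => γ)
        ((hT.sub (M.bddMeas_totalEffect h0 h1 continuous_id _)).sq.integrable _)
        (((i1.const_mul (2 * (2 * ((κ : ℝ) + 1)) * (2 * κ + 3))).add
          (i2.const_mul ((2 * (κ : ℝ) + 3) ^ 2))).add
            (integrable_const ((2 * ((κ : ℝ) + 1)) ^ 2)) |>.const_mul ((m : ℝ) ^ 2))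
        fun u => by
          have h := M.abs_totalEffect_sub_le h0 h1 hm u k
          refine (sq_le_sq' (abs_le.mp h).1 (abs_le.mp h).2).trans (le_of_eq ?_)
          simp only [Pi.add_apply]
          ring
      refine hle.trans ?_
      rw [integral_const_mul]
      refine mul_le_mul_of_nonneg_left ?_ (by positivity)
      have e := integral_add ((i1.const_mul (2 * (2 * ((κ : ℝ) + 1)) * (2 * κ + 3))).add
          (i2.const_mul ((2 * (κ : ℝ) + 3) ^ 2)))
            (integrable_const (μ := Measure.pi fun _ : ι => γ) ((2 * ((κ : ℝ) + 1)) ^ 2))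
      have e' := integral_add (i1.const_mul (2 * (2 * ((κ : ℝ) + 1)) * (2 * κ + 3)))
          (i2.const_mul ((2 * (κ : ℝ) + 3) ^ 2))
      simp only [Pi.add_apply, integral_const_mul] at e e' ⊢
      rw [e, e']
      have b1 : 2 * (2 * ((κ : ℝ) + 1)) * (2 * κ + 3) * _ ≤
        2 * (2 * ((κ : ℝ) + 1)) * (2 * κ + 3) * x :=
        mul_le_mul_of_nonneg_left (a1.trans hx) (by positivity)
      have b2 : (2 * (κ : ℝ) + 3) ^ 2 * _ ≤ (2 * (κ : ℝ) + 3) ^ 2 * (x + x ^ 2) :=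
        mul_le_mul_of_nonneg_left (a2.trans (add_le_add hx (pow_le_pow_left₀ hmp hx 2)))
          (by positivity)
      simp only [integral_const, probReal_univ, one_smul] at *
      linarith
    refine (Finset.sum_le_sum fun k _ => hk k).trans (le_of_eq ?_)
    rw [Finset.sum_const, nsmul_eq_mul, Finset.card_univ, hm]
    push_cast; ring

end ProximityModel

end VarianceAndSizeBias

end IsolatedPoints

namespace IsolatedPoints

/-! ### Size-bias identity and normal approximation -/

section NormalApproximation

set_option linter.unusedSectionVars false

open Classical

variable {ι E : Type*} [Fintype ι] [MeasurableSpace E] {c near : E → E → Prop}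
  {γ : Measure E} [IsProbabilityMeasure γ] {p p' : ℝ} {κ : ℕ}

lemma nbrs_eq_erase_add (u : ι → E) {i j : ι} (hij : i ≠ j) :
    nbrs c Finset.univ u i =
      nbrs c (Finset.univ.erase j) u i + if c (u i) (u j) then 1 else 0 := by
  unfold nbrs
  rw [← Finset.insert_erase (Finset.mem_univ j), Finset.filter_insert]
  by_cases h : c (u i) (u j)
  · rw [if_pos ⟨hij.symm, h⟩, if_pos h, Finset.card_insert_of_notMem (by simp)]
    simp
  · rw [if_neg (fun h' => h h'.2), if_neg h]
    simp

lemma nbrs_update (u : ι → E) {i j : ι} (hij : i ≠ j) (v : E) (h : c (u i) (u j)) :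
    nbrs c Finset.univ (Function.update u j v) i =
      if c (u i) v then nbrs c Finset.univ u i else nbrs c Finset.univ u i - 1 := by
  rw [nbrs_eq_erase_add _ hij, nbrs_eq_erase_add u hij, nbrs_erase_update _ _ _ _ hij, if_pos h,
    Function.update_self, Function.update_of_ne hij]
  split_ifs <;> simp

lemma sum_adj_eq_nbrs (u : ι → E) (i : ι) (a : ℝ) :
    ∑ j ∈ Finset.univ.erase i, (if c (u i) (u j) then a else 0) = nbrs c Finset.univ u i * a := by
  rw [← Finset.sum_filter, Finset.sum_const, nsmul_eq_mul]
  congr 2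
  unfold nbrs
  congr 1
  ext b; simp

lemma isolatedIn_iff_nbrs (u : ι → E) (i : ι) :
    IsolatedIn c Finset.univ u i ↔ nbrs c Finset.univ u i = 0 := by
  unfold IsolatedIn nbrs
  rw [Finset.card_eq_zero, Finset.filter_eq_empty_iff]
  simp

lemma nbrs_le (u : ι → E) (i : ι) {m : ℕ} (hm : Fintype.card ι = m + 1) :
    nbrs c Finset.univ u i ≤ m := by
  have h : (Finset.univ.erase i).card = m := by
    rw [Finset.card_erase_of_mem (Finset.mem_univ i), Finset.card_univ, hm, Nat.add_sub_cancel]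
  rw [← h]
  refine Finset.card_le_card fun b hb => ?_
  simp only [Finset.mem_filter] at hb
  simp [hb.2.1]

namespace ProximityModel

variable (M : ProximityModel ι c near γ p p' κ)
include M

lemma integral_ite_ball (x : E) (a b : ℝ) :
    ∫ v, (if c x v then a else b) ∂γ = (1 - p) * b + p * a := by
  have : (fun v => if c x v then a else b) =
      fun v => b + Set.indicator {v | c x v} (fun _ => a - b) v := by
    ext v
    by_cases h : c x v <;> simp [Set.indicator, h]
  rw [this, integral_add (integrable_const _)
    ((integrable_const _).indicator (M.measurableSet_ball x)),
    integral_indicator (M.measurableSet_ball x), setIntegral_const, M.prob, smul_eq_mul]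
  simp; ring

variable {α : ℕ → ℝ} (h0 : ∀ k, 0 ≤ α k) (h1 : ∀ k, α k ≤ 1)
include h0 h1

/-- Exchanging `u j` with `v` transfers the test function to the unmoved configuration; the weight
then requires `u j` to be adjacent to `u i`. Averaging over the free point `v` lowers the neighbour
count by one with probability `1 - p` and keeps it otherwise. -/
lemma integral_moveEffect {F : ℝ → ℝ} (hF : Continuous F) {i j : ι} (hij : i ≠ j) :
    ∫ u : ι → E, moveEffect c γ p α Finset.univ F u i j ∂(Measure.pi fun _ => γ) =
      ∫ u : ι → E, F (countIso c Finset.univ u) * ((if c (u i) (u j) then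
        p⁻¹ * ((1 - p) * α (nbrs c Finset.univ u i - 1) + p * α (nbrs c Finset.univ u i)) else 0) -
          α (nbrs c Finset.univ u i)) ∂(Measure.pi fun _ => γ) := by
  have hS := (M.bddMeas_countIso (Finset.univ : Finset ι)).comp_continuous hF
  have hα := M.bddMeas_nbrs h0 h1 (Finset.univ : Finset ι) i
  have hw := M.bddMeas_weight i p⁻¹
  set S : (ι → E) → ℝ := fun u => F (countIso c Finset.univ u) with hSdef
  set a : (ι → E) → ℝ := fun u => α (nbrs c Finset.univ u i) with hadef
  have hup := measurable_update_prod (E := E) j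
  have e1 : ∀ u, moveEffect c γ p α Finset.univ F u i j =
      (∫ v, a u * (if c (u i) v then p⁻¹ else 0) * S (Function.update u j v) ∂γ) - a u * S u := by
    intro u
    have hwu : BddMeas fun v => if c (u i) v then p⁻¹ else 0 :=
      BddMeas.ite (M.measurableSet_ball (u i)) _ _
    have hSu : BddMeas fun v => S (Function.update u j v) :=
      hS.comp (hup.comp (measurable_const.prodMk measurable_id))
    simp only [moveEffect, mul_sub, mul_assoc, integral_const_mul]
    rw [integral_sub ((hwu.mul hSu).integrable γ) ((hwu.mul (BddMeas.const _)).integrable γ),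
      integral_mul_const, M.integral_weight, one_mul, mul_sub]
  have hG : BddMeas (Function.uncurry fun (u : ι → E) (v : E) =>
      a (Function.update u j v) * (if c (u i) (u j) then p⁻¹ else 0) * S u) :=
    ((hα.comp hup).mul ((BddMeas.ite (M.measurableSet_pair i j) p⁻¹ 0).comp measurable_fst)).mul
      (hS.comp measurable_fst)
  have hex := integral_exchange γ hG j
  simp only [Function.update_idem, Function.update_eq_self, Function.update_self,
    Function.update_of_ne hij] at hex
  have hint : BddMeas fun u => ∫ v, a u * (if c (u i) v then p⁻¹ else 0) *
      S (Function.update u j v) ∂γ :=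
    BddMeas.integral_right γ (F := fun q : (ι → E) × E => a q.1 *
      (if c (q.1 i) q.2 then p⁻¹ else 0) * S (Function.update q.1 j q.2))
      (((hα.comp measurable_fst).mul hw).mul (hS.comp hup))
  have hint2 : BddMeas fun u => ∫ v, a (Function.update u j v) *
      (if c (u i) (u j) then p⁻¹ else 0) * S u ∂γ := BddMeas.integral_right γ hG
  simp_rw [e1]
  rw [integral_sub (hint.integrable _) ((hα.mul hS).integrable _), hex,
    ← integral_sub (hint2.integrable _) ((hα.mul hS).integrable _)]
  congr 1; ext u
  rw [integral_mul_const, integral_mul_const]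
  by_cases h : c (u i) (u j)
  · have : ∀ v, a (Function.update u j v) =
        if c (u i) v then a u else α (nbrs c Finset.univ u i - 1) := fun v => by
      simp only [hadef]
      rw [nbrs_update u hij v h]
      split_ifs <;> rfl
    simp_rw [this]
    rw [M.integral_ite_ball, if_pos h, if_pos h]
    ring
  · rw [if_neg h, if_neg h]; ring

/-- The coupling realises the size-biased law of the number of non-isolated points. -/
lemma integral_totalEffect {m : ℕ} (hm : Fintype.card ι = m + 1) (hα0 : α 0 = 1)
    (hα : ∀ k < m, ((k : ℝ) + 1) * ((1 - p) * α k + p * α (k + 1)) =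
        m * p * ((1 - (1 - p) ^ m)⁻¹ - 1 + α (k + 1))) {F : ℝ → ℝ} (hF : Continuous F) :
    ∫ u : ι → E, totalEffect c γ p α Finset.univ F u ∂(Measure.pi fun _ => γ) =
      m * ∫ u : ι → E, F (countIso c Finset.univ u) *
        ((1 - (1 - p) ^ m)⁻¹ * (m + 1 - countIso c Finset.univ u) - (m + 1))
          ∂(Measure.pi fun _ => γ) := by
  set τ := (1 - (1 - p) ^ m)⁻¹
  have hp := M.p_pos
  have hcard : ∀ i : ι, ((Finset.univ.erase i).card : ℝ) = m := fun i => by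
    rw [Finset.card_erase_of_mem (Finset.mem_univ i), Finset.card_univ, hm, Nat.add_sub_cancel]
  have hS := (M.bddMeas_countIso (Finset.univ : Finset ι)).comp_continuous hF
  unfold totalEffect
  rw [integral_finsetSum _ fun i _ => integrable_finsetSum _ fun j _ =>
    (M.bddMeas_moveEffect h0 h1 hF _ i j).integrable _]
  have hrow : ∀ i : ι, ∫ u : ι → E, ∑ j ∈ Finset.univ.erase i,
      moveEffect c γ p α Finset.univ F u i j ∂(Measure.pi fun _ => γ) =
      ∫ u : ι → E, F (countIso c Finset.univ u) * (m * (τ *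
        (1 - if IsolatedIn c Finset.univ u i then 1 else 0) - 1)) ∂(Measure.pi fun _ => γ) := by
    intro i
    rw [integral_finsetSum _ fun j _ => (M.bddMeas_moveEffect h0 h1 hF _ i j).integrable _,
      Finset.sum_congr rfl fun j hj =>
        M.integral_moveEffect h0 h1 hF (Finset.ne_of_mem_erase hj).symm,
      ← integral_finsetSum]
    · congr 1; ext u
      rw [← Finset.mul_sum, Finset.sum_sub_distrib, Finset.sum_const, nsmul_eq_mul, hcard,
        sum_adj_eq_nbrs]
      congr 1
      have hN := nbrs_le (c := c) u i hm
      -- Without neighbours both sides equal `-m`, because `α 0 = 1`. With `k + 1` neighbours the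
      -- required equality is the defining relation of `α` at `k`.
      by_cases hiso : IsolatedIn c Finset.univ u i
      · rw [if_pos hiso, (isolatedIn_iff_nbrs u i).mp hiso, hα0]
        simp
      · rw [if_neg hiso]
        rw [isolatedIn_iff_nbrs] at hiso
        obtain ⟨k, hk⟩ := Nat.exists_eq_succ_of_ne_zero hiso
        rw [hk] at hN ⊢
        have := hα k (by omega)
        simp only [Nat.succ_eq_add_one, Nat.add_sub_cancel]
        push_cast
        have e : ((k : ℝ) + 1) * (p⁻¹ * ((1 - p) * α k + p * α (k + 1))) =
            p⁻¹ * (((k : ℝ) + 1) * ((1 - p) * α k + p * α (k + 1))) := by ring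
        rw [e, this]
        field_simp
        ring
    · intro j _
      refine (hS.mul (BddMeas.sub ?_ (M.bddMeas_nbrs h0 h1 _ i))).integrable _
      have e : (fun u : ι → E => if c (u i) (u j) then
        p⁻¹ * ((1 - p) * α (nbrs c Finset.univ u i - 1) + p * α (nbrs c Finset.univ u i)) else 0) =
        fun u => (if c (u i) (u j) then 1 else 0) *
          (p⁻¹ * ((1 - p) * α (nbrs c Finset.univ u i - 1) + p * α (nbrs c Finset.univ u i))) := by
        ext u; split_ifs <;> simp
      rw [e]
      refine (BddMeas.ite (M.measurableSet_pair i j) 1 0).mul ((BddMeas.const _).mul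
        (((BddMeas.const _).mul ?_).add ((BddMeas.const _).mul (M.bddMeas_nbrs h0 h1 _ i))))
      exact M.bddMeas_nbrs (α := fun k => α (k - 1)) (fun k => h0 _) (fun k => h1 _) _ i
  rw [Finset.sum_congr rfl fun i _ => hrow i, ← integral_finsetSum, ← integral_const_mul]
  · congr 1; ext u
    rw [← Finset.mul_sum, ← Finset.mul_sum, Finset.sum_sub_distrib, ← Finset.mul_sum,
      Finset.sum_sub_distrib]
    simp only [Finset.sum_const, Finset.card_univ, hm, nsmul_eq_mul, mul_one, countIso]
    push_cast; ring
  · intro i _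
    exact (hS.mul ((BddMeas.const _).mul (((BddMeas.const _).mul ((BddMeas.const _).sub
      (BddMeas.ite (M.measurableSet_isolatedIn _ i) 1 0))).sub (BddMeas.const _)))).integrable _

lemma abs_totalEffect_sub_mul_le {m : ℕ} (hm : Fintype.card ι = m + 1) {F : ℝ → ℝ}
    (hF : Continuous F) (u : ι → E) {b R : ℝ}
    (h : ∀ t, |t - countIso c Finset.univ u| ≤ κ + 1 →
      |F t - F (countIso c Finset.univ u) - b * (t - countIso c Finset.univ u)| ≤ R) :
    |totalEffect c γ p α Finset.univ F u - b * totalEffect c γ p α Finset.univ id u| ≤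
      (m + 1) * m * R := by
  have hR : 0 ≤ R := (abs_nonneg _).trans (h (countIso c Finset.univ u) (by
    rw [sub_self, abs_zero]; positivity))
  have hcard : ∀ i : ι, ((Finset.univ.erase i).card : ℝ) = m := fun i => by
    rw [Finset.card_erase_of_mem (Finset.mem_univ i), Finset.card_univ, hm, Nat.add_sub_cancel]
  unfold totalEffect
  simp only [Finset.mul_sum, ← Finset.sum_sub_distrib]
  have hij : ∀ i : ι, ∀ j ∈ Finset.univ.erase i, |moveEffect c γ p α Finset.univ F u i j -
      b * moveEffect c γ p α Finset.univ id u i j| ≤ R := by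
    intro i j hj
    have hne := (Finset.ne_of_mem_erase hj).symm
    have e : moveEffect c γ p α Finset.univ F u i j -
        b * moveEffect c γ p α Finset.univ id u i j =
        moveEffect c γ p α Finset.univ (fun t => F t - b * t) u i j := by
      have hw : BddMeas fun v => if c (u i) v then p⁻¹ else 0 :=
        BddMeas.ite (M.measurableSet_ball (u i)) _ _
      have i1 := (hw.mul (M.bddMeas_section hF Finset.univ u j)).integrable γ
      have i2 := (hw.mul (M.bddMeas_section continuous_id Finset.univ u j)).integrable γ
      unfold moveEffect
      rw [mul_left_comm b, ← mul_sub, ← integral_const_mul, ← integral_sub i1 (i2.const_mul b)]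
      congr 2; ext v
      simp only [id]; ring
    rw [e, abs_le]
    refine M.moveEffect_mem h0 h1 (by fun_prop) (by linarith) hR fun v hv => ?_
    have b1 := neg_le_countIso_update_sub (u := u) M.pack (Finset.mem_univ j) v
    have b2 := countIso_update_sub_le (u := u) M.symm M.pack (Finset.mem_univ i)
      (Finset.mem_univ j) hne hv
    have b3 := abs_le.mp (h (countIso c Finset.univ (Function.update u j v))
      (abs_le.mpr ⟨b1, by linarith⟩))
    constructor <;> linarith [b3.1, b3.2]
  refine (Finset.abs_sum_le_sum_abs _ _).trans ((Finset.sum_le_sum fun i _ =>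
    (Finset.abs_sum_le_sum_abs _ _).trans (Finset.sum_le_sum (hij i))).trans (le_of_eq ?_))
  simp only [Finset.sum_const, nsmul_eq_mul, hcard, Finset.card_univ, hm]
  push_cast; ring

omit h0 h1 in
/-- Positivity of the variance and the Kolmogorov bound for the number of isolated points in an
abstract proximity model. -/
theorem normal_approximation {m : ℕ} (hm : Fintype.card ι = m + 1) (hm1 : 1 ≤ m) (hp' : 0 ≤ p')
    (hA : ∃ A : Set E, γ A ≠ 0 ∧ ∀ x ∈ A, ∀ y ∈ A, c x y) {x η : ℝ} (hx : m * p' ≤ x)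
    (hη : (2 * ((κ : ℝ) + 1)) ^ 2 + 2 * (2 * (κ + 1)) * (2 * κ + 3) * x +
        (2 * κ + 3) ^ 2 * (x + x ^ 2) ≤ η) {μ σ : ℝ}
    (hμ : μ = ∫ u : ι → E, countIso c Finset.univ u ∂(Measure.pi fun _ => γ))
    (hσ : σ = √(∫ u : ι → E, (countIso c Finset.univ u - μ) ^ 2 ∂(Measure.pi fun _ => γ))) :
    0 < σ ∧ ⨆ z, |((Measure.pi fun _ => γ).map
        fun u : ι → E => (countIso c Finset.univ u - μ) / σ).real (Set.Iic z) -
          (gaussianReal 0 1).real (Set.Iic z)| ≤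
      (m + 1 - μ) / (5 * σ ^ 2) * (√(11 * ((κ : ℝ) + 1) ^ 2 / σ + 5 * √η / √(m + 1)) +
        2 * (κ + 1) / √σ) ^ 2 := by
  obtain ⟨α, h0, h1, hα0, hα⟩ := exists_resampling_probabilities m hm1 p M.p_pos M.p_lt_one
  set π : Measure (ι → E) := Measure.pi fun _ => γ with hπ
  set S : (ι → E) → ℝ := fun u => countIso c Finset.univ u with hSdef
  have hS : BddMeas S := M.bddMeas_countIso Finset.univ
  have hq : 0 < (1 - p) ^ m := pow_pos (by linarith [M.p_lt_one]) _
  have hq1 : (1 - p) ^ m < 1 :=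
    pow_lt_one₀ (by linarith [M.p_lt_one]) (by linarith [M.p_pos]) (by omega)
  have hτ : 0 < 1 - (1 - p) ^ m := by linarith
  have hmR : (0 : ℝ) < m := by exact_mod_cast hm1
  -- Testing the size-bias identity with the constant `1` gives the mean, since moves do not change
  -- a constant.
  have hmean : (m + 1) - μ = (m + 1) * (1 - (1 - p) ^ m) := by
    have h := M.integral_totalEffect h0 h1 hm hα0 hα (continuous_const (y := (1 : ℝ)))
    have e : ∀ u : ι → E, totalEffect c γ p α Finset.univ (fun _ => (1 : ℝ)) u = 0 := fun u => by
      simp [totalEffect, moveEffect]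
    simp_rw [e, one_mul] at h
    have i1 : Integrable (fun u => (m + 1 : ℝ) - S u) π :=
      (integrable_const _).sub (hS.integrable π)
    rw [integral_sub (i1.const_mul _) (integrable_const _), integral_const_mul,
      integral_sub (integrable_const _) (hS.integrable π), ← hμ] at h
    simp only [integral_const, probReal_univ, one_smul] at h
    have h2 := (mul_eq_zero.mp h.symm).resolve_left hmR.ne'
    field_simp at h2
    linarith
  have hsq : BddMeas fun u => (S u - μ) ^ 2 := (hS.sub (BddMeas.const μ)).sq
  -- If the variance vanished, `S` would equal `μ` almost surely. All points lie in the clique `A`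
  -- with positive probability, and then `S = 0`; so `μ = 0`, against the formula for the mean.
  have hV : 0 < ∫ u, (S u - μ) ^ 2 ∂π := by
    refine lt_of_le_of_ne (integral_nonneg fun _ => sq_nonneg _) fun hne => ?_
    have hae := (integral_eq_zero_iff_of_nonneg (fun _ => sq_nonneg _) (hsq.integrable π)).mp hne.symm
    obtain ⟨A, hA0, hA⟩ := hA
    have hπA : π (Set.univ.pi fun _ => A) ≠ 0 := by
      rw [hπ, Measure.pi_pi]
      exact Finset.prod_ne_zero_iff.mpr fun _ _ => hA0
    obtain ⟨u, hu1, hu2⟩ : ∃ u, u ∈ (Set.univ.pi fun _ => A) ∧ (S u - μ) ^ 2 = 0 := by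
      by_contra hcon
      push Not at hcon
      refine hπA (measure_mono_null (fun u hu => ?_) (ae_iff.mp hae))
      exact hcon u hu
    have hSu : S u = 0 := by
      refine Finset.sum_eq_zero fun l _ => if_neg fun hl => ?_
      have : Nontrivial ι := Fintype.one_lt_card_iff_nontrivial.mp (by omega)
      obtain ⟨b, hb⟩ := exists_ne l
      exact hl b (Finset.mem_univ b) hb (hA _ (hu1 l trivial) _ (hu1 b trivial))
    rw [hSu] at hu2
    have : μ = 0 := by nlinarith
    rw [this] at hmean
    nlinarith
  have hσ0 : 0 < σ := hσ ▸ Real.sqrt_pos.mpr hV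
  have hσ2 : σ ^ 2 = ∫ u, (S u - μ) ^ 2 ∂π := by rw [hσ, Real.sq_sqrt hV.le]
  refine ⟨hσ0, ?_⟩
  set K : (ℝ → ℝ) → (ι → E) → ℝ := fun f u =>
    ((m + 1 : ℝ) * m)⁻¹ * totalEffect c γ p α Finset.univ (fun t => f ((t - μ) / σ)) u with hK
  set g : (ι → E) → ℝ := fun u =>
    ((m + 1 : ℝ) * m)⁻¹ * (σ⁻¹ * totalEffect c γ p α Finset.univ id u) with hg
  have hT := M.bddMeas_totalEffect h0 h1 continuous_id (Finset.univ : Finset ι)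
  have hgB : BddMeas g := (BddMeas.const _).mul ((BddMeas.const _).mul hT)
  have hκ : (0 : ℝ) < κ + 1 := by positivity
  have hη0 : 0 < η := by
    refine lt_of_lt_of_le ?_ hη
    have : 0 ≤ x := (by positivity : 0 ≤ m * p').trans hx
    positivity
  have hlocal : ∀ (f : ℝ → ℝ), Continuous f → ∀ (u : ι → E) (a R : ℝ),
      (∀ w', |w' - (S u - μ) / σ| ≤ (κ + 1) / σ →
        |f w' - f ((S u - μ) / σ) - (w' - (S u - μ) / σ) * a| ≤ R) →
      |K f u - a * g u| ≤ R := by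
    intro f hf u a R h
    have h2 := M.abs_totalEffect_sub_mul_le h0 h1 hm (F := fun t => f ((t - μ) / σ))
      (by fun_prop) u (b := a * σ⁻¹) (R := R) fun t ht => by
        have e : (t - μ) / σ - (S u - μ) / σ = (t - S u) / σ := by ring
        have := h ((t - μ) / σ) (by
          rw [e, abs_div, abs_of_pos hσ0]
          gcongr)
        rw [e] at this
        refine le_trans (le_of_eq ?_) this
        congr 1; ring
    have e : K f u - a * g u = ((m + 1 : ℝ) * m)⁻¹ *
        (totalEffect c γ p α Finset.univ (fun t => f ((t - μ) / σ)) u -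
          a * σ⁻¹ * totalEffect c γ p α Finset.univ id u) := by
      simp only [hK, hg]; ring
    rw [e, abs_mul, abs_of_pos (by positivity), inv_mul_le_iff₀ (by positivity)]
    exact h2
  have hstein : ∀ f : ℝ → ℝ, Continuous f → ∫ u, (S u - μ) / σ * f ((S u - μ) / σ) ∂π =
      (-((m + 1 - μ) / σ)) * ∫ u, K f u ∂π := by
    intro f hf
    have hF : Continuous fun t => f ((t - μ) / σ) := by fun_prop
    have h := M.integral_totalEffect h0 h1 hm hα0 hα hF
    simp only [hK]
    rw [integral_const_mul, h, ← integral_const_mul, ← integral_const_mul, ← integral_const_mul]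
    congr 1; ext u
    rw [hmean]
    have : μ = (m + 1) - (m + 1) * (1 - (1 - p) ^ m) := by linarith
    simp only [hSdef]
    field_simp
    rw [this]
    ring
  -- The parameter `θ` is negative because it is `n - S`, not `S`, that is size-biased. The value of
  -- `v` is the Efron–Stein bound `(m + 1) m² η` after division by `((m + 1) m σ)²`, followed by a
  -- square root.
  have hC : SteinCoupling π (fun u => (S u - μ) / σ) K g (-((m + 1 - μ) / σ)) ((κ + 1) / σ)
      (√η / √(m + 1) / σ) := by
    have hid : ∀ u, K id u = g u := fun u => by
      have := hlocal id continuous_id u 1 0 fun w' _ => by simp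
      have := abs_nonpos_iff.mp this
      linarith
    have hW2 : ∫ u, ((S u - μ) / σ) ^ 2 ∂π = 1 := by
      simp_rw [div_pow]
      rw [integral_div, ← hσ2, div_self (by positivity)]
    refine ⟨(hS.meas.sub_const μ).div_const σ, ?_, hW2.le, ?_, hstein, hlocal, hgB.integrable π, ?_,
      (hgB.sub (BddMeas.const _)).sq.integrable π, ?_, by positivity, by positivity⟩
    · simp_rw [div_pow]
      exact (hsq.integrable π).div_const _
    · exact fun f hf => ((BddMeas.const _).mul (M.bddMeas_totalEffect h0 h1
        (by fun_prop) Finset.univ)).integrable π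
    · have := hstein id continuous_id
      simp_rw [hid, id, ← pow_two, hW2] at this
      exact this.symm
    · have hv := M.totalEffect_variance_le h0 h1 hm hx hp'
      have e : ∀ u, (g u - ∫ w, g w ∂π) ^ 2 = ((m + 1 : ℝ) * m * σ)⁻¹ ^ 2 *
          (totalEffect c γ p α Finset.univ id u -
            ∫ w, totalEffect c γ p α Finset.univ id w ∂π) ^ 2 := fun u => by
        simp only [hg, integral_const_mul, mul_inv]; ring
      simp_rw [e]
      rw [integral_const_mul]
      refine (mul_le_mul_of_nonneg_left (hv.trans (mul_le_mul_of_nonneg_left hη (by positivity)))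
        (by positivity)).trans (le_of_eq ?_)
      rw [div_pow, div_pow, Real.sq_sqrt hη0.le, Real.sq_sqrt (by positivity)]
      field_simp
  have hfin := hC.kolmogorov_le
  refine hfin.trans (le_of_eq ?_)
  have hpos : 0 < m + 1 - μ := by rw [hmean]; positivity
  have hsσ : 0 < √σ := Real.sqrt_pos.mpr hσ0
  have e1 : √(11 * ((κ + 1) / σ) ^ 2 + 5 * (√η / √(m + 1) / σ)) =
      √(11 * ((κ : ℝ) + 1) ^ 2 / σ + 5 * √η / √(m + 1)) / √σ := by
    rw [← Real.sqrt_div' _ hσ0.le]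
    congr 1
    field_simp
  have e2 : 2 * (((κ : ℝ) + 1) / σ) = (2 * (κ + 1) / √σ) / √σ := by
    rw [div_div, Real.mul_self_sqrt hσ0.le]; ring
  rw [e1, e2, ← add_div, div_pow, Real.sq_sqrt hσ0.le, abs_neg, abs_of_pos (by positivity)]
  field_simp

end ProximityModel

end NormalApproximation

end IsolatedPoints

namespace IsolatedPoints

/-! ### Geometry of the torus -/

section Torus

variable {n d : ℕ}

lemma side_pos (hn : 0 < n) : 0 < side n d := Real.rpow_pos_of_pos (by exact_mod_cast hn) _

lemma side_pow (hd : 1 ≤ d) : side n d ^ d = n := by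
  rw [side, ← Real.rpow_natCast, ← Real.rpow_mul (Nat.cast_nonneg n), one_div,
    inv_mul_cancel₀ (by positivity), Real.rpow_one]

/-- The projection of `ℝ^d` to the torus. -/
noncomputable def toTorus (n d : ℕ) (x : EuclideanSpace ℝ (Fin d)) :
    Fin d → AddCircle (side n d) := fun i => (x i : AddCircle (side n d))

/-- The Euclidean norm on the torus. -/
noncomputable def torusNorm {L : ℝ} {d : ℕ} (z : Fin d → AddCircle L) : ℝ :=
  √(∑ i, ‖z i‖ ^ 2)

lemma torusDist_eq (x y : EuclideanSpace ℝ (Fin d)) :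
    torusDist n d x y = torusNorm (toTorus n d x - toTorus n d y) := by
  simp [torusDist, torusNorm, toTorus]

variable {L : ℝ}

lemma torusNorm_eq_norm (z : Fin d → AddCircle L) : torusNorm z = ‖WithLp.toLp 2 z‖ := by
  rw [PiLp.norm_eq_of_L2]; rfl

lemma torusNorm_add_le (z w : Fin d → AddCircle L) :
    torusNorm (z + w) ≤ torusNorm z + torusNorm w := by
  simp only [torusNorm_eq_norm, WithLp.toLp_add]
  exact norm_add_le _ _

lemma torusNorm_neg (z : Fin d → AddCircle L) : torusNorm (-z) = torusNorm z := by
  simp [torusNorm]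

lemma continuous_torusNorm : Continuous (torusNorm (L := L) (d := d)) := by
  unfold torusNorm; fun_prop

lemma continuous_toTorus : Continuous (toTorus n d) :=
  continuous_pi fun i => (AddCircle.continuous_mk' _).comp (by fun_prop)

lemma torusDist_comm (x y : EuclideanSpace ℝ (Fin d)) : torusDist n d x y = torusDist n d y x := by
  rw [torusDist_eq, torusDist_eq, ← torusNorm_neg, neg_sub]

lemma torusDist_self (x : EuclideanSpace ℝ (Fin d)) : torusDist n d x x = 0 := by
  simp [torusDist]

lemma torusDist_triangle (x y z : EuclideanSpace ℝ (Fin d)) :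
    torusDist n d x z ≤ torusDist n d x y + torusDist n d y z := by
  simp only [torusDist_eq]
  refine le_trans (le_of_eq ?_) (torusNorm_add_le _ _)
  rw [sub_add_sub_cancel]

lemma measurableSet_torusDist_le (r : ℝ) :
    MeasurableSet {q : EuclideanSpace ℝ (Fin d) × EuclideanSpace ℝ (Fin d) |
      torusDist n d q.1 q.2 ≤ r} := by
  refine (isClosed_le ?_ continuous_const).measurableSet
  simp only [torusDist_eq]
  exact continuous_torusNorm.comp ((continuous_toTorus.comp continuous_fst).sub
    (continuous_toTorus.comp continuous_snd))

lemma norm_coe_le_abs (t : ℝ) : ‖(t : AddCircle L)‖ ≤ |t| := by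
  rw [← Real.norm_eq_abs]
  exact QuotientAddGroup.norm_mk_le_norm

lemma torusNorm_coe_le (v : EuclideanSpace ℝ (Fin d)) :
    torusNorm (fun i => (v i : AddCircle L)) ≤ ‖v‖ := by
  rw [EuclideanSpace.norm_eq]
  refine Real.sqrt_le_sqrt (Finset.sum_le_sum fun i _ => ?_)
  exact pow_le_pow_left₀ (norm_nonneg _) (norm_coe_le_abs _) 2

/-- Subtracting the nearest multiple of the side length in each coordinate gives a shortest
representative of the displacement. -/
lemma exists_lift (x y : EuclideanSpace ℝ (Fin d)) :
    ∃ v : EuclideanSpace ℝ (Fin d), toTorus n d v = toTorus n d x - toTorus n d y ∧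
      ‖v‖ = torusDist n d x y := by
  refine ⟨WithLp.toLp 2 fun i => (x i - y i) -
    round ((side n d)⁻¹ * (x i - y i)) * side n d, ?_, ?_⟩
  · ext i
    simp only [toTorus, Pi.sub_apply]
    have h : ((round ((side n d)⁻¹ * (x i - y i)) * side n d : ℝ) : AddCircle (side n d)) = 0 := by
      rw [AddCircle.coe_eq_zero_iff]
      exact ⟨_, zsmul_eq_mul _ _⟩
    rw [AddCircle.coe_sub, h, sub_zero, AddCircle.coe_sub]
  · rw [EuclideanSpace.norm_eq, torusDist]
    simp only [AddCircle.norm_eq, Real.norm_eq_abs]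

-- Lifted displacements from `x` have length at most `ρ` and are more than `ρ` apart, as projection
-- to the torus does not increase lengths. This needs no bound on `ρ` in terms of the side. Scaled
-- by `2/ρ` they are centres of disjoint unit balls, and the ball at `(2/ρ) v` meets the central one
-- at `(1/ρ) v`.
open Classical in
lemma packingBound_kappa {ρ : ℝ} (hρ : 0 < ρ) (ι : Type*) :
    PackingBound ι (fun x y : EuclideanSpace ℝ (Fin d) => torusDist n d x y ≤ ρ) (kappa d) := by
  intro x F u h1 h2
  choose v hv1 hv2 using fun l => exists_lift (n := n) (u l) x
  have hsep : ∀ l ∈ F, ∀ l' ∈ F, l ≠ l' → ρ < ‖v l - v l'‖ := by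
    intro l hl l' hl' hne
    have h3 := not_le.mp (h2 l hl l' hl' hne)
    refine h3.trans_le (le_trans (le_of_eq ?_) (torusNorm_coe_le (L := side n d) (v l - v l')))
    rw [torusDist_eq]
    congr 1
    have : (fun i => (((v l - v l') i : ℝ) : AddCircle (side n d))) =
        toTorus n d (v l) - toTorus n d (v l') := by
      ext i; simp [toTorus]
    rw [this, hv1, hv1]
    abel
  have hinj : Set.InjOn (fun l => (2 / ρ) • v l) F := by
    intro l hl l' hl' heq
    by_contra hne
    have h3 := hsep l hl l' hl' hne
    have : v l = v l' := smul_right_injective _ (by positivity : (2 / ρ : ℝ) ≠ 0) heq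
    rw [this, sub_self, norm_zero] at h3
    linarith
  rw [← Finset.card_image_of_injOn hinj]
  refine (isGreatest_kappa d).2 ⟨_, ⟨?_, ?_⟩, rfl⟩
  · intro y hy
    obtain ⟨l, hl, rfl⟩ := Finset.mem_image.mp hy
    have hn : ‖(1 / ρ) • v l‖ ≤ 1 := by
      rw [norm_smul, hv2, Real.norm_eq_abs, abs_of_pos (by positivity), one_div,
        inv_mul_le_iff₀ hρ, mul_one]
      exact h1 l hl
    refine ⟨(1 / ρ) • v l, ?_, ?_⟩
    · rw [Metric.mem_closedBall, dist_eq_norm, ← sub_smul, ← norm_neg, ← neg_smul]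
      have e : -(1 / ρ - 2 / ρ) = 1 / ρ := by ring
      rwa [e]
    · simpa [Metric.mem_closedBall] using hn
  · intro y hy y' hy' hne
    obtain ⟨l, hl, rfl⟩ := Finset.mem_image.mp hy
    obtain ⟨l', hl', rfl⟩ := Finset.mem_image.mp hy'
    have h3 := hsep l hl l' hl' (fun h => hne (by rw [h]))
    refine Metric.closedBall_disjoint_closedBall ?_
    rw [dist_eq_norm, ← smul_sub, norm_smul, Real.norm_eq_abs, abs_of_pos (by positivity),
      div_mul_eq_mul_div, lt_div_iff₀ hρ]
    linarith

/-- Balls centred at `±2e`, for a unit vector `e`, touch the central ball from opposite sides. The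
bound serves to absorb lower-order terms in `κ_d`. -/
lemma two_le_kappa (hd : 1 ≤ d) : 2 ≤ kappa d := by
  classical
  set e : EuclideanSpace ℝ (Fin d) := EuclideanSpace.single ⟨0, hd⟩ 1 with he
  have hne : ‖e‖ = 1 := by simp [he]
  have h2 : ‖(2 : ℝ) • e - (-2 : ℝ) • e‖ = 4 := by
    rw [← sub_smul, norm_smul, hne]; norm_num
  have hdiff : (2 : ℝ) • e ≠ (-2 : ℝ) • e := fun h => by
    rw [h, sub_self, norm_zero] at h2; norm_num at h2
  have hmid : ∀ a : ℝ, |a| = 2 →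
      (Metric.closedBall (a • e) 1 ∩ Metric.closedBall 0 1).Nonempty := by
    intro a ha
    refine ⟨(a / 2) • e, ?_, ?_⟩
    · rw [Metric.mem_closedBall, dist_eq_norm, ← sub_smul, norm_smul, hne, Real.norm_eq_abs]
      rw [show a / 2 - a = -(a / 2) by ring, abs_neg, abs_div, ha]; norm_num
    · rw [Metric.mem_closedBall, dist_zero_right, norm_smul, hne, Real.norm_eq_abs, abs_div, ha]
      norm_num
  have hdisj : Disjoint (Metric.closedBall ((2 : ℝ) • e) 1)
      (Metric.closedBall ((-2 : ℝ) • e) 1) :=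
    Metric.closedBall_disjoint_closedBall (by rw [dist_eq_norm, h2]; norm_num)
  refine (isGreatest_kappa d).2 ⟨{(2 : ℝ) • e, (-2 : ℝ) • e}, ⟨?_, ?_⟩, Finset.card_pair hdiff⟩
  · intro x hx
    rcases Finset.mem_insert.mp hx with rfl | hx
    · exact hmid 2 (by norm_num)
    · rw [Finset.mem_singleton.mp hx]; exact hmid (-2) (by norm_num)
  · intro x hx y hy hxy
    simp only [Finset.mem_insert, Finset.mem_singleton] at hx hy
    rcases hx with rfl | rfl <;> rcases hy with rfl | rfl
    · exact absurd rfl hxy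
    · exact hdisj
    · exact hdisj.symm
    · exact absurd rfl hxy

/-! ### Volumes of torus balls -/

section Volume

variable [Fact (0 < side n d)]

lemma measurePreserving_coe_box (a : ℝ) :
    MeasurePreserving (fun (t : Fin d → ℝ) i => (t i : AddCircle (side n d)))
      (volume.restrict (Set.univ.pi fun _ => Set.Ioc a (a + side n d))) volume := by
  rw [volume_pi, Measure.restrict_pi_pi, volume_pi]
  exact measurePreserving_pi _ _ fun _ => AddCircle.measurePreserving_mk _ a

lemma measurePreserving_toTorus :
    MeasurePreserving (toTorus n d) (volume.restrict (cube n d)) volume := by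
  have h1 : MeasurePreserving (fun (t : Fin d → ℝ) i => (t i : AddCircle (side n d)))
      (volume.restrict (Set.univ.pi fun _ => Set.Ico 0 (side n d))) volume := by
    have h := measurePreserving_coe_box (n := n) (d := d) 0
    rw [zero_add, volume_pi, Measure.restrict_pi_pi] at h
    rw [volume_pi, Measure.restrict_pi_pi]
    simpa only [restrict_Ico_eq_restrict_Ioc] using h
  have h2 := (PiLp.volume_preserving_ofLp (Fin d)).restrict_preimage
    (s := Set.univ.pi fun _ => Set.Ico 0 (side n d))
    (MeasurableSet.univ_pi fun _ => measurableSet_Ico)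
  have h3 : (WithLp.ofLp (p := 2) (V := Fin d → ℝ)) ⁻¹'
      (Set.univ.pi fun _ => Set.Ico 0 (side n d)) = cube n d := by
    ext x; simp [cube]
  rw [h3] at h2
  exact h1.comp h2

lemma volume_cube (hd : 1 ≤ d) : volume (cube n d) = n := by
  have h := (measurePreserving_toTorus (n := n) (d := d)).measure_preimage
    (s := Set.univ) MeasurableSet.univ.nullMeasurableSet
  rw [Set.preimage_univ, Measure.restrict_apply_univ] at h
  rw [h, volume_pi, Measure.pi_univ]
  simp only [AddCircle.measure_univ, Finset.prod_const, Finset.card_univ, Fintype.card_fin]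
  rw [← ENNReal.ofReal_pow (le_of_lt Fact.out), side_pow hd, ENNReal.ofReal_natCast]

/-- The volume of a ball of radius `r` in the torus. -/
noncomputable def torusBallVolume (n d : ℕ) [Fact (0 < side n d)] (r : ℝ) : ℝ :=
  volume.real {z : Fin d → AddCircle (side n d) | torusNorm z ≤ r}

lemma measurableSet_torusNorm_le (r : ℝ) :
    MeasurableSet {z : Fin d → AddCircle L | torusNorm z ≤ r} :=
  (isClosed_le continuous_torusNorm continuous_const).measurableSet

lemma cond_torusDist_le (hd : 1 ≤ d) (x : EuclideanSpace ℝ (Fin d)) (r : ℝ) :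
    (cond volume (cube n d)).real {y | torusDist n d x y ≤ r} = (n : ℝ)⁻¹ * torusBallVolume n d r := by
  have hset : {y | torusDist n d x y ≤ r} =
      toTorus n d ⁻¹' {z | torusNorm (z - toTorus n d x) ≤ r} := by
    ext y; rw [Set.mem_ofPred_eq, torusDist_comm, torusDist_eq]; rfl
  have hm : MeasurableSet {z : Fin d → AddCircle (side n d) |
      torusNorm (z - toTorus n d x) ≤ r} :=
    (isClosed_le (continuous_torusNorm.comp (by fun_prop)) continuous_const).measurableSet
  have h1 := (measurePreserving_toTorus (n := n) (d := d)).measure_preimage hm.nullMeasurableSet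
  have h2 := (measurePreserving_sub_right (volume : Measure (Fin d → AddCircle (side n d)))
    (toTorus n d x)).measure_preimage (measurableSet_torusNorm_le r).nullMeasurableSet
  rw [ProbabilityTheory.cond, Measure.real, Measure.smul_apply, hset, h1, volume_cube hd,
    smul_eq_mul, ENNReal.toReal_mul]
  congr 1
  · simp
  · rw [torusBallVolume, Measure.real, ← h2]; rfl

/-- On the fundamental box centred at the origin the circle norm is the absolute value, so the torus
ball lifts into the Euclidean ball. Only an inequality holds in general, since the Euclidean ball
may leave the box. -/
lemma torusBallVolume_le {r : ℝ} (hr : 0 ≤ r) : torusBallVolume n d r ≤ phi d r := by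
  have hL : 0 < side n d := Fact.out
  have h1 := (measurePreserving_coe_box (n := n) (d := d) (-(side n d / 2))).measure_preimage
    (measurableSet_torusNorm_le r).nullMeasurableSet
  have hphi : phi d r = volume.real (Metric.closedBall (0 : EuclideanSpace ℝ (Fin d)) r) := by
    have : volume (Metric.closedBall (0 : EuclideanSpace ℝ (Fin d)) r) =
        ENNReal.ofReal (r ^ d) * volume (Metric.ball (0 : EuclideanSpace ℝ (Fin d)) 1) := by
      simpa using Measure.addHaar_closedBall (volume : Measure (EuclideanSpace ℝ (Fin d))) 0 hr
    rw [phi, Measure.real, Measure.real, this, ENNReal.toReal_mul,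
      ENNReal.toReal_ofReal (by positivity), mul_comm]
  rw [hphi, torusBallVolume, Measure.real, Measure.real, ← h1]
  refine ENNReal.toReal_mono (measure_closedBall_lt_top).ne ?_
  rw [Measure.restrict_apply' (MeasurableSet.univ_pi fun _ => measurableSet_Ioc),
    ← (PiLp.volume_preserving_toLp (Fin d)).measure_preimage
      measurableSet_closedBall.nullMeasurableSet]
  refine measure_mono fun t ht => ?_
  obtain ⟨ht1, ht2⟩ := ht
  simp only [Set.mem_preimage, Metric.mem_closedBall, dist_zero_right, Set.mem_ofPred_eq] at ht1 ⊢
  refine le_trans (le_of_eq ?_) ht1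
  rw [EuclideanSpace.norm_eq, torusNorm]
  congr 1
  refine Finset.sum_congr rfl fun i _ => ?_
  have hi := ht2 i trivial
  rw [Real.norm_eq_abs, ((AddCircle.norm_coe_eq_abs_iff (x := t i) (side n d) hL.ne').mpr ?_)]
  rw [abs_of_pos hL, abs_le]
  constructor <;> linarith [hi.1, hi.2]

lemma torusBallVolume_pos {r : ℝ} (hr : 0 < r) : 0 < torusBallVolume n d r := by
  refine ENNReal.toReal_pos ?_ (measure_lt_top _ _).ne
  have ho : IsOpen {z : Fin d → AddCircle (side n d) | torusNorm z < r} :=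
    isOpen_lt continuous_torusNorm continuous_const
  have hpos := ho.measure_pos volume ⟨0, by simpa [torusNorm] using hr⟩
  exact (hpos.trans_le (measure_mono fun z (hz : torusNorm z < r) => hz.le)).ne'

end Volume

lemma phi_mul (a ρ : ℝ) : phi d (a * ρ) = a ^ d * phi d ρ := by
  unfold phi; ring

lemma phi_nonneg {ρ : ℝ} (hρ : 0 ≤ ρ) : 0 ≤ phi d ρ :=
  mul_nonneg measureReal_nonneg (by positivity)

/-- Two points joined by a chain of three steps are within `3ρ`, which accounts for the factor `3 ^
d`. -/
lemma proximityModel (hd : 1 ≤ d) (hn : 0 < n) {ρ : ℝ} (hρ : 0 < ρ) (hlarge : phi d ρ < n)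
    (ι : Type*) :
    ∃ p, ProximityModel ι (fun x y => torusDist n d x y ≤ ρ)
      (fun x y => torusDist n d x y ≤ 3 * ρ) (cond volume (cube n d)) p
        ((n : ℝ)⁻¹ * (3 ^ d * phi d ρ)) (kappa d) := by
  have : Fact (0 < side n d) := ⟨side_pos hn⟩
  have hnR : (0 : ℝ) < n := by exact_mod_cast hn
  refine ⟨(n : ℝ)⁻¹ * torusBallVolume n d ρ, fun x y h => by rwa [torusDist_comm],
    fun x => by rw [torusDist_self]; exact hρ.le, measurableSet_torusDist_le ρ,
    measurableSet_torusDist_le _, fun x => cond_torusDist_le hd x ρ,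
    mul_pos (inv_pos.mpr hnR) (torusBallVolume_pos hρ), ?_, fun x => ?_, fun x v y z h1 h2 h3 => ?_,
    packingBound_kappa hρ ι⟩
  · rw [inv_mul_lt_iff₀ hnR, mul_one]
    exact (torusBallVolume_le hρ.le).trans_lt hlarge
  · simp_rw [fun y => torusDist_comm (n := n) y x]
    rw [cond_torusDist_le hd, ← phi_mul]
    exact mul_le_mul_of_nonneg_left (torusBallVolume_le (by positivity)) (inv_pos.mpr hnR).le
  · have := torusDist_triangle (n := n) x v z
    have := torusDist_triangle (n := n) v y z
    linarith

lemma exists_clique (hd : 1 ≤ d) (hn : 0 < n) {ρ : ℝ} (hρ : 0 < ρ) :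
    ∃ A : Set (EuclideanSpace ℝ (Fin d)), cond volume (cube n d) A ≠ 0 ∧
      ∀ x ∈ A, ∀ y ∈ A, torusDist n d x y ≤ ρ := by
  have : Fact (0 < side n d) := ⟨side_pos hn⟩
  have hnR : (0 : ℝ) < n := by exact_mod_cast hn
  refine ⟨{y | torusDist n d 0 y ≤ ρ / 2}, fun h => ?_, fun x hx y hy => ?_⟩
  · have h1 := cond_torusDist_le (n := n) hd 0 (ρ / 2)
    rw [Measure.real, h, ENNReal.toReal_zero] at h1
    have h2 := mul_pos (inv_pos.mpr hnR) (torusBallVolume_pos (n := n) (d := d) (half_pos hρ))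
    linarith
  · have h1 := torusDist_triangle (n := n) x 0 y
    rw [torusDist_comm x 0] at h1
    have h2 : torusDist n d 0 x ≤ ρ / 2 := hx
    have h3 : torusDist n d 0 y ≤ ρ / 2 := hy
    linarith

end Torus

end IsolatedPoints

namespace IsolatedPoints

/-! ### From the abstract model to the stated count and constant -/

section Transfer

open Classical

variable {n d : ℕ}

/-- The two counts, one through the set of points and one through indices, can differ when points
coincide; injectivity rules this out. -/
lemma numIsolated_eq_countIso {ρ : ℝ} (hρ : 0 < ρ) {u : Fin n → EuclideanSpace ℝ (Fin d)}
    (hcube : ∀ i, u i ∈ cube n d) (hinj : Function.Injective u) :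
    numIsolated n d ρ u = countIso (fun x y => torusDist n d x y ≤ ρ) Finset.univ u := by
  unfold numIsolated countIso
  refine Finset.sum_congr rfl fun i _ => ?_
  have : Set.range u ∩ torusBall n d ρ (u i) = {u i} ↔
      IsolatedIn (fun x y => torusDist n d x y ≤ ρ) Finset.univ u i := by
    constructor
    · intro h b _ hb hc
      have : u b ∈ Set.range u ∩ torusBall n d ρ (u i) := ⟨⟨b, rfl⟩, hcube b, hc⟩
      rw [h] at this
      exact hb (hinj this)
    · intro h
      ext y
      constructor
      · rintro ⟨⟨b, rfl⟩, _, hc⟩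
        by_contra hne
        exact h b (Finset.mem_univ b) (fun hb => hne (by rw [hb]; rfl)) hc
      · rintro rfl
        exact ⟨⟨i, rfl⟩, hcube i, by rw [torusDist_self]; exact hρ.le⟩
  simp only [this]

lemma ae_injective {E : Type*} [MeasurableSpace E] [MeasurableSingletonClass E]
    [MeasurableEq E] (γ : Measure E) [IsProbabilityMeasure γ] (hγ : ∀ x, γ {x} = 0)
    {ι : Type*} [Fintype ι] :
    ∀ᵐ u ∂(Measure.pi fun _ : ι => γ), Function.Injective u := by
  have hij : ∀ i j : ι, i ≠ j → ∀ᵐ u ∂(Measure.pi fun _ : ι => γ), u i ≠ u j := by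
    intro i j hij
    have hm : MeasurableSet {u : ι → E | u i = u j} :=
      measurableSet_eq_fun (measurable_pi_apply i) (measurable_pi_apply j)
    have hB : BddMeas fun u : ι → E => if u i = u j then (1 : ℝ) else 0 := BddMeas.ite hm 1 0
    have h0 : ∀ u, resample γ i (fun u : ι → E => if u i = u j then (1 : ℝ) else 0) u = 0 := by
      intro u
      simp only [resample, Function.update_self, Function.update_of_ne hij.symm]
      rw [integral_eq_zero_iff_of_nonneg (fun v => by positivity)
        ((BddMeas.ite (q := fun v => v = u j) (measurableSet_singleton _) 1 0).integrable γ)]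
      rw [Filter.EventuallyEq, ae_iff]
      simpa using hγ (u j)
    have h1 := integral_resample γ hB i
    simp_rw [h0, integral_zero] at h1
    have h2 := (integral_eq_zero_iff_of_nonneg (fun u => by positivity) (hB.integrable _)).mp h1.symm
    filter_upwards [h2] with u hu heq
    simp [heq] at hu
  have : ∀ᵐ u ∂(Measure.pi fun _ : ι => γ), ∀ i j : ι, i ≠ j → u i ≠ u j := by
    rw [ae_all_iff]; intro i
    rw [ae_all_iff]; intro j
    by_cases h : i = j
    · simp [h]
    · filter_upwards [hij i j h] with u hu _ using hu
  filter_upwards [this] with u hu i j h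
  by_contra hne
  exact hu i j hne h

lemma measurableSet_cube : MeasurableSet (cube n d) := by
  have : cube n d = ⋂ i, {x : EuclideanSpace ℝ (Fin d) | x i ∈ Set.Ico 0 (side n d)} := by
    ext x; simp [cube]
  rw [this]
  exact MeasurableSet.iInter fun i =>
    measurableSet_Ico.preimage (f := fun x : EuclideanSpace ℝ (Fin d) => x i) (by fun_prop)

lemma ae_numIsolated_eq (hd : 1 ≤ d) {ρ : ℝ} (hρ : 0 < ρ)
    [IsProbabilityMeasure (cond volume (cube n d))] :
    ∀ᵐ u ∂(Measure.pi fun _ : Fin n => cond volume (cube n d)),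
      numIsolated n d ρ u = countIso (fun x y => torusDist n d x y ≤ ρ) Finset.univ u := by
  have : Nonempty (Fin d) := ⟨⟨0, hd⟩⟩
  have h1 : ∀ᵐ u ∂(Measure.pi fun _ : Fin n => cond volume (cube n d)), ∀ i, u i ∈ cube n d := by
    rw [ae_all_iff]
    exact fun i => (Measure.tendsto_eval_ae_ae (i := i)).eventually (ae_cond_mem measurableSet_cube)
  have h2 := ae_injective (cond volume (cube n d))
    (fun x => cond_absolutelyContinuous (measure_singleton x)) (ι := Fin n)
  filter_upwards [h1, h2] with u hu1 hu2
  exact numIsolated_eq_countIso hρ hu1 hu2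

lemma variance_constant_le_etaS (hd : 1 ≤ d) (hn : 1 < n) {ρ : ℝ} (hρ : 0 < ρ)
    (h3 : 3 ^ d * phi d ρ < n) (h2 : (2 ^ (d + 1) + 1) * phi d ρ < n) :
    (2 * ((kappa d : ℝ) + 1)) ^ 2 + 2 * (2 * (kappa d + 1)) * (2 * kappa d + 3) *
      (3 ^ d * phi d ρ) + (2 * kappa d + 3) ^ 2 * (3 ^ d * phi d ρ + (3 ^ d * phi d ρ) ^ 2) ≤
      etaS n d ρ := by
  have hφ := phi_nonneg (d := d) hρ.le
  have hκ : (2 : ℝ) ≤ kappa d := by exact_mod_cast two_le_kappa hd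
  have hnR : (1 : ℝ) < n := by exact_mod_cast hn
  have hratio : ∀ y : ℝ, 0 ≤ y → y < n → 2 ≤ (2 * n - y) / (n - y) := fun y hy0 hy => by
    rw [le_div_iff₀ (by linarith)]; linarith
  have hsecond : 0 ≤ ((kappa d : ℝ) + 1) ^ 2 / 2 *
      ((2 ^ d + 2 * 3 ^ d + 3) * phi d ρ +
        (2 ^ (d + 1) + 1) *
          ((2 * n - (2 ^ (d + 1) + 1) * phi d ρ) / (n - (2 ^ (d + 1) + 1) * phi d ρ)) *
            phi d ρ ^ 2 + (4 * n - 2) / (n - 1)) := by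
    have h4 := hratio _ (by positivity) h2
    have h5 : (0 : ℝ) ≤ (4 * n - 2) / (n - 1) := div_nonneg (by linarith) (by linarith)
    have h6 := zero_le_two.trans h4
    positivity
  have h4 := hratio _ (by positivity) h3
  have h9 : (9 : ℝ) ^ d = 3 ^ d * 3 ^ d := by rw [← mul_pow]; norm_num
  have h2d : (3 : ℝ) ≤ 2 ^ d + 1 := by
    have : (2 : ℝ) ^ 1 ≤ 2 ^ d := pow_le_pow_right₀ (by norm_num) hd
    linarith
  unfold etaS
  set κ : ℝ := (kappa d : ℝ)
  refine le_trans ?_ (le_add_of_nonneg_right hsecond)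
  set x := 3 ^ d * phi d ρ with hx
  have hx0 : 0 ≤ x := by positivity
  have e1 : (2 ^ d + 1) * 3 ^ d * phi d ρ = (2 ^ d + 1) * x := by rw [hx]; ring
  have e2 : (2 * n - x) / (n - x) * 9 ^ d * phi d ρ ^ 2 = (2 * n - x) / (n - x) * x ^ 2 := by
    rw [hx, h9]; ring
  rw [e1, e2]
  -- The first summand of `etaS` alone suffices. After this reduction the comparison is between
  -- polynomials in `x`, whose coefficient differences are the nonnegative quantities `c0`, `c1`,
  -- `c2`.
  have h5 : 1 + 3 * x + 2 * x ^ 2 ≤ 1 + (2 ^ d + 1) * x + (2 * n - x) / (n - x) * x ^ 2 := by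
    gcongr
  refine le_trans ?_ (mul_le_mul_of_nonneg_left h5 (by positivity))
  have c0 : 0 ≤ 4 * κ ^ 2 - 2 := by nlinarith
  have c1 : 0 ≤ (12 * κ ^ 2 - 8 * κ - 15) * x := mul_nonneg (by nlinarith) hx0
  have c2 : 0 ≤ (12 * κ ^ 2 + 4 * κ - 5) * x ^ 2 := mul_nonneg (by nlinarith) (sq_nonneg x)
  nlinarith

end Transfer

end IsolatedPoints

/-! ### Proof of the theorem -/

open IsolatedPoints in
theorem theorem2p2 {Ω : Type*} [MeasurableSpace Ω] (P : Measure Ω) [IsProbabilityMeasure P]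
    (d n : ℕ) (hd : 1 ≤ d) (hn : 4 ≤ n) (ρ : ℝ) (hρ : 0 < ρ)
    (U : Fin n → Ω → EuclideanSpace ℝ (Fin d)) (hmeas : ∀ i, Measurable (U i))
    (hindep : iIndepFun U P)
    (hunif : ∀ i, pdf.IsUniform (U i) (IsolatedPoints.cube n d) P volume)
    (S : Ω → ℝ) (hS : S = fun ω => IsolatedPoints.numIsolated n d ρ (fun i => U i ω))
    (μS σS : ℝ) (hμS : μS = ∫ ω, S ω ∂P) (hσS : σS = √(variance S P))
    (hlarge : max (3 ^ d) (2 ^ (d + 1) + 1) * IsolatedPoints.phi d ρ < n) :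
    0 < σS ∧
      IsolatedPoints.kolmogorovDist P S ≤
        (n - μS) / (5 * σS ^ 2) *
          (√(11 * ((IsolatedPoints.kappa d : ℝ) + 1) ^ 2 / σS +
              5 * √(IsolatedPoints.etaS n d ρ) / √n) +
            2 * ((IsolatedPoints.kappa d : ℝ) + 1) / √σS) ^ 2 := by
  have hφ := phi_nonneg (d := d) hρ.le
  have h3 : 3 ^ d * phi d ρ < n :=
    (mul_le_mul_of_nonneg_right (le_max_left _ _) hφ).trans_lt hlarge
  have h2 : (2 ^ (d + 1) + 1) * phi d ρ < n :=
    (mul_le_mul_of_nonneg_right (le_max_right _ _) hφ).trans_lt hlarge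
  have h1 : phi d ρ < n :=
    (le_mul_of_one_le_left hφ (one_le_pow₀ (by norm_num : (1 : ℝ) ≤ 3))).trans_lt h3
  have hn0 : 0 < n := by omega
  have hnR : (0 : ℝ) < n := by exact_mod_cast hn0
  set γ := cond volume (cube n d)
  have hγ : IsProbabilityMeasure γ := by
    rw [← (show P.map (U ⟨0, hn0⟩) = γ from hunif _)]
    exact Measure.isProbabilityMeasure_map (hmeas _).aemeasurable
  set V : Ω → Fin n → EuclideanSpace ℝ (Fin d) := fun ω i => U i ω
  have hV : Measurable V := measurable_pi_iff.mpr hmeas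
  have hlaw : P.map V = Measure.pi fun _ => γ := by
    have := (iIndepFun_iff_map_fun_eq_pi_map fun i => (hmeas i).aemeasurable).mp hindep
    rw [this]
    congr 1; ext1 i
    exact hunif i
  obtain ⟨p, M⟩ := proximityModel hd hn0 hρ h1 (Fin n)
  set c := fun x y : EuclideanSpace ℝ (Fin d) => torusDist n d x y ≤ ρ
  set T : (Fin n → EuclideanSpace ℝ (Fin d)) → ℝ := fun u => countIso c Finset.univ u with hT
  have hTB : BddMeas T := M.bddMeas_countIso Finset.univ
  have hST : S =ᵐ[P] fun ω => T (V ω) := by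
    have := ae_of_ae_map hV.aemeasurable
      (p := fun u => numIsolated n d ρ u = T u) (by rw [hlaw]; exact ae_numIsolated_eq hd hρ)
    rw [hS]
    exact this
  have hTV : Measurable fun ω => T (V ω) := hTB.meas.comp hV
  have hμ : μS = ∫ u, T u ∂(Measure.pi fun _ => γ) := by
    rw [hμS, integral_congr_ae hST, ← hlaw,
      integral_map hV.aemeasurable hTB.meas.aestronglyMeasurable]
  have hσ : σS = √(∫ u, (T u - μS) ^ 2 ∂(Measure.pi fun _ => γ)) := by
    rw [hσS, variance_congr hST, variance_eq_integral hTV.aemeasurable, ← integral_congr_ae hST,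
      ← hμS, ← hlaw, integral_map hV.aemeasurable
        (hTB.sub (BddMeas.const μS)).sq.meas.aestronglyMeasurable]
  obtain ⟨m, rfl⟩ : ∃ m, n = m + 1 := ⟨n - 1, by omega⟩
  obtain ⟨hpos, hbound⟩ := M.normal_approximation (m := m) (by simp) (by omega) (by positivity)
    -- A point has `m = n - 1` others, each within `3ρ` with probability at most `3 ^ d φ / n`, so
    -- the expected number of near points is at most `3 ^ d φ`.
    (exists_clique hd hn0 hρ) (x := 3 ^ d * phi d ρ) (by
      rw [← mul_assoc]
      refine mul_le_of_le_one_left (by positivity) ?_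
      rw [mul_inv_le_iff₀ hnR, one_mul]
      push_cast; linarith)
    (variance_constant_le_etaS hd (by omega) hρ h3 h2) hμ hσ
  refine ⟨hpos, ?_⟩
  have hK : kolmogorovDist P S = ⨆ z, |((Measure.pi fun _ => γ).map
      fun u => (T u - μS) / σS).real (Set.Iic z) - (gaussianReal 0 1).real (Set.Iic z)| := by
    unfold kolmogorovDist
    congr 1; ext t
    rw [← hσS, ← hμS, ← hlaw, Measure.map_map ((hTB.meas.sub_const _).div_const _) hV,
      map_measureReal_apply (((hTB.meas.sub_const _).div_const _).comp hV) measurableSet_Iic]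
    congr 2
    refine measureReal_congr ?_
    filter_upwards [hST] with ω hω
    refine propext ?_
    change (S ω - μS) / σS ≤ t ↔ _
    rw [hω]
    exact Iff.rfl
  rw [hK]
  push_cast at hbound ⊢
  exact hbound
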